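/- Let $n\geq 1$, let $M$ be a (finite-dimensional, Hausdorff, second countable) smooth manifold with an open cover $\mathcal U=\{U_a\}_{a\in\Lambda}$ (for example a good one), write $\check C_k\,\mathcal U=\bigsqcup_{a_0,\dots,a_k}U_{a_0}\cap\cdots\cap U_{a_k}$, let $\check\delta$ be the Čech differential, and let $TM$ be the $C^\infty(M)$-module of smooth vector fields, i.e. of derivations of $C^\infty(M)$. Let $g$ be a smooth $\mathrm U(1)$-valued Čech $n$-cocycle on $\mathcal U$, with $\mathrm d\log g:=\frac1{2\pi\mathrm i}g^{-1}\mathrm dg$. Let $H\in\Omega^{n+1}(M)$ be closed, and let $\mathcal A=(A^{(1)},\dots,A^{(n)})$, $A^{(p)}\in\Omega^p(\check C_{n-p}\,\mathcal U)$, be a full Čech–Deligne connection on $g$ with curvature $H$, i.e. $$\mathrm d\log g-\check\delta A^{(1)}=0,\qquad \mathrm dA^{(p-1)}+(-1)^p\,\check\delta A^{(p)}=0\quad(2\le p\le n),\qquad \mathrm dA^{(n)}=H|_{\check C_0\mathcal U}$$ (so that $H$ represents, up to the sign convention, the class of $g$ in de Rham cohomology). Let $\mathrm{At}_{n-1}(H)=TM\oplus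 C^\infty(M)[n-1]$, with zero differential, with anchor the projection to $TM$, with binary bracket given by the Lie bracket of vector fields and $[X,f]=\mathcal L_Xf$, with $(n+1)$-ary bracket $[X_1,\dots,X_{n+1}]=H(X_1,\dots,X_{n+1})$ (added to the binary bracket if $n=1$), and no other brackets. Let $\check{\mathrm C}\mathrm{At}(g)$ be the complex with $C^\infty(\check C_k\,\mathcal U)$ in degree $k-(n-1)$ for $0\le k<n-1$ and with $$E_{n-1}(g)=\{(X,f)\in TM\oplus C^\infty(\check C_{n-1}\,\mathcal U)\mid \mathrm d\log(g)(X)=\check\delta f\}$$ in degree $0$, with differential $(-1)^{n-k}\check\delta$ on $C^\infty(\check C_k\,\mathcal U)$ for $k<n-1$ (followed by $f\mapsto(0,f)$ if $k=n-2$), with anchor $(X,f)\mapsto X$, and with only the binary bracket $[(X,f),(Y,h)]=([X,Y],\mathcal L_Xh-\mathcal L_Yf)$ in degree $0$, $[(X,f),h]=\mathcal L_Xh$ for $h$ of negative degree, and zero on pairs of elements of negative degree. Then $\mathrm{At}_{n-1}(H)$ and $\check{\mathrm C}\mathrm{At}(g)$ are $L_\infty$-algebroids over $C^\infty(M)$ (the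 latter is a dg Lie algebroid), and $\mathcal A$ induces an $\infty$-quasi-isomorphism of $L_\infty$-algebroids $$\Phi_{g,\mathcal A}\colon \mathrm{At}_{n-1}(H)\rightsquigarrow\check{\mathrm C}\mathrm{At}(g),$$ that is, a $C^\infty(M)$-linear map $\overline{\mathrm{Sym}}_{C^\infty(M)}(\mathrm{At}_{n-1}(H)[1])\to\check{\mathrm C}\mathrm{At}(g)[1]$ of degree $0$ which satisfies the Maurer–Cartan equation, which is compatible with the anchors, and whose linear part is a quasi-isomorphism. It is the map given by $X\mapsto(X,A^{(1)}(X))$ and $f\mapsto f|_{\check C_0\mathcal U}$ on $\mathrm{At}_{n-1}(H)$, by $(X_1,\dots,X_k)\mapsto A^{(k)}(X_1,\dots,X_k)\in C^\infty(\check C_{n-k}\,\mathcal U)$ for $2\le k\le n$, and by zero on all other products. -/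

import Mathlib

open scoped Manifold ContDiff Topology

noncomputable section

namespace CechAtiyah

section LInfinity

/-- The Koszul sign for rearranging shifted homogeneous elements `x_0, …, x_{k-1}`, where `x_i` has
(unshifted) degree `d i`, in the order prescribed by `p` (elements with equal value of `p` keep
their order): each pair that changes its order contributes `(-1)^((d i - 1) (d j - 1))`. -/
def koszulSign {k : ℕ} {ι : Type*} [LinearOrder ι] (p : Fin k → ι) (d : Fin k → ℤ) : ℤˣ :=
  ∏ i, ∏ j, if i < j ∧ p j < p i then ((d i - 1) * (d j - 1)).negOnePow else 1

/-- The subtuple of `x` with indices in `S`, in increasing order. -/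
def subtuple {V : Type*} {k : ℕ} (x : Fin k → V) (S : Finset (Fin k)) : Fin S.card → V :=
  fun i => x (S.orderEmbOfFin rfl i)

/-- The data underlying an `L_∞`-algebroid over an algebra `A` (in degree zero): a graded
`A`-module, an anchor, and brackets of all arities `k ≥ 1` (the bracket of arity `0` is a dummy),
the unary one being the differential.

The brackets are those of the Chevalley–Eilenberg coalgebra, i.e. the graded symmetric operations of
degree one on `𝔤[1]`. They correspond to graded antisymmetric brackets of degree `2 - k` on `𝔤`
through `bracket (x_1, …, x_k) = (-1)^(∑ (k - i) |x_i|) [x_1, …, x_k]`; in particular both agree on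
tuples in which all elements but the last one have degree zero. -/
structure PreLInftyAlgebroid (A : Type*) [CommRing A] [Algebra ℝ A] where
  carrier : Type*
  [addCommGroup : AddCommGroup carrier]
  [moduleReal : Module ℝ carrier]
  [module : Module A carrier]
  [isScalarTower : IsScalarTower ℝ A carrier]
  /-- the homogeneous elements of (unshifted) degree `i` -/
  deg : ℤ → Submodule A carrier
  bracket : ∀ k : ℕ, (Fin k → carrier) → carrier
  anchor : carrier →ₗ[A] Derivation ℝ A A

attribute [instance] PreLInftyAlgebroid.addCommGroup PreLInftyAlgebroid.moduleReal
  PreLInftyAlgebroid.module PreLInftyAlgebroid.isScalarTower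

variable {A : Type*} [CommRing A] [Algebra ℝ A]

/-- The differential. -/
def PreLInftyAlgebroid.diff (𝔤 : PreLInftyAlgebroid A) (x : 𝔤.carrier) : 𝔤.carrier :=
  𝔤.bracket 1 fun _ => x

/-- The axioms of an `L_∞`-algebroid. -/
structure PreLInftyAlgebroid.IsLInftyAlgebroid (𝔤 : PreLInftyAlgebroid A) : Prop where
  graded : DirectSum.IsInternal 𝔤.deg
  bracket_zero : ∀ x, 𝔤.bracket 0 x = 0
  multilinear : ∀ k, ∃ F : MultilinearMap ℝ (fun _ : Fin k => 𝔤.carrier) 𝔤.carrier,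
    ⇑F = 𝔤.bracket k
  bracket_mem : ∀ (k : ℕ) (d : Fin k → ℤ) (x : Fin k → 𝔤.carrier), (∀ i, x i ∈ 𝔤.deg (d i)) →
    𝔤.bracket k x ∈ 𝔤.deg ((∑ i, d i) + 2 - k)
  symmetric : ∀ (k : ℕ) (d : Fin k → ℤ) (x : Fin k → 𝔤.carrier), (∀ i, x i ∈ 𝔤.deg (d i)) →
    ∀ σ : Equiv.Perm (Fin k), 𝔤.bracket k (x ∘ σ.symm) = koszulSign σ d • 𝔤.bracket k x
  /-- The homotopy Jacobi identities: the sum runs over all ways to choose the arguments of the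
  inner bracket, i.e. over all shuffles. -/
  jacobi : ∀ (k : ℕ) (d : Fin k → ℤ) (x : Fin k → 𝔤.carrier), (∀ i, x i ∈ 𝔤.deg (d i)) →
    ∑ S : Finset (Fin k) with S.Nonempty, koszulSign (fun i => if i ∈ S then 0 else 1) d •
      𝔤.bracket (Sᶜ.card + 1) (Fin.cons (𝔤.bracket S.card (subtuple x S)) (subtuple x Sᶜ)) = 0
  diff_smul : ∀ (a : A) (x : 𝔤.carrier), 𝔤.diff (a • x) = a • 𝔤.diff x
  leibniz : ∀ (a : A) (x y : 𝔤.carrier),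
    𝔤.bracket 2 ![x, a • y] = a • 𝔤.bracket 2 ![x, y] + 𝔤.anchor x a • y
  linear : ∀ k, 3 ≤ k → ∃ F : MultilinearMap A (fun _ : Fin k => 𝔤.carrier) 𝔤.carrier,
    ⇑F = 𝔤.bracket k
  anchor_deg : ∀ i, i ≠ 0 → ∀ x ∈ 𝔤.deg i, 𝔤.anchor x = 0
  anchor_diff : ∀ x, 𝔤.anchor (𝔤.diff x) = 0
  anchor_bracket : ∀ x y, 𝔤.anchor (𝔤.bracket 2 ![x, y]) = ⁅𝔤.anchor x, 𝔤.anchor y⁆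
  anchor_higher : ∀ k, 3 ≤ k → ∀ x, 𝔤.anchor (𝔤.bracket k x) = 0

/-- An `∞`-morphism `𝔤 ⇝ 𝔥` of `L_∞`-algebroids over `A`: graded symmetric `A`-multilinear maps
`φ_k : 𝔤[1]^k → 𝔥[1]` of degree zero, `k ≥ 1` (`φ_0 = 0` is a dummy), i.e. a map
`Sym_A (𝔤[1]) → 𝔥[1]` on the reduced symmetric coalgebra, which satisfies the Maurer–Cartan equation
and is compatible with the anchors. -/
structure InfinityMorphism (𝔤 𝔥 : PreLInftyAlgebroid A) where
  comp : ∀ k : ℕ, (Fin k → 𝔤.carrier) → 𝔥.carrier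
  comp_zero : ∀ x, comp 0 x = 0
  multilinear : ∀ k, ∃ F : MultilinearMap A (fun _ : Fin k => 𝔤.carrier) 𝔥.carrier, ⇑F = comp k
  comp_mem : ∀ (k : ℕ) (d : Fin k → ℤ) (x : Fin k → 𝔤.carrier), (∀ i, x i ∈ 𝔤.deg (d i)) →
    comp k x ∈ 𝔥.deg ((∑ i, d i) + 1 - k)
  symmetric : ∀ (k : ℕ) (d : Fin k → ℤ) (x : Fin k → 𝔤.carrier), (∀ i, x i ∈ 𝔤.deg (d i)) →
    ∀ σ : Equiv.Perm (Fin k), comp k (x ∘ σ.symm) = koszulSign σ d • comp k x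
  /-- The Maurer–Cartan equation, i.e. compatibility with the Chevalley–Eilenberg differentials:
  `∑ l, (1/l!) [φ, …, φ]_l (Δ^{l-1} (x_1 ⋯ x_k)) = φ (δ_CE (x_1 ⋯ x_k))`. The iterated coproduct is
  the sum over all decompositions into `l` nonempty blocks, given by surjections `p`. -/
  maurerCartan : ∀ (k : ℕ) (d : Fin k → ℤ) (x : Fin k → 𝔤.carrier), (∀ i, x i ∈ 𝔤.deg (d i)) →
    ∑ l ∈ Finset.Icc 1 k, ((l.factorial : ℝ)⁻¹) • ∑ p : Fin k → Fin l with Function.Surjective p,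
      koszulSign p d • 𝔥.bracket l (fun b =>
        comp (Finset.univ.filter (p · = b)).card (subtuple x (Finset.univ.filter (p · = b)))) =
    ∑ S : Finset (Fin k) with S.Nonempty, koszulSign (fun i => if i ∈ S then 0 else 1) d •
      comp (Sᶜ.card + 1) (Fin.cons (𝔤.bracket S.card (subtuple x S)) (subtuple x Sᶜ))
  anchor_one : ∀ x : Fin 1 → 𝔤.carrier, 𝔥.anchor (comp 1 x) = 𝔤.anchor (x 0)
  anchor_higher : ∀ k, 2 ≤ k → ∀ x, 𝔥.anchor (comp k x) = 0

/-- The linear part of an `∞`-morphism. -/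
def InfinityMorphism.linearPart {𝔤 𝔥 : PreLInftyAlgebroid A} (Φ : InfinityMorphism 𝔤 𝔥)
    (x : 𝔤.carrier) : 𝔥.carrier :=
  Φ.comp 1 fun _ => x

/-- An `∞`-morphism is an `∞`-quasi-isomorphism if its linear part induces a bijection on the
cohomology of the underlying complexes in every degree; the two fields express injectivity and
surjectivity in terms of representatives. -/
structure InfinityMorphism.IsQuasiIso {𝔤 𝔥 : PreLInftyAlgebroid A}
    (Φ : InfinityMorphism 𝔤 𝔥) : Prop where
  injective : ∀ (i : ℤ), ∀ x ∈ 𝔤.deg i, 𝔤.diff x = 0 →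
    (∃ w ∈ 𝔥.deg (i - 1), Φ.linearPart x = 𝔥.diff w) → ∃ y ∈ 𝔤.deg (i - 1), x = 𝔤.diff y
  surjective : ∀ (i : ℤ), ∀ z ∈ 𝔥.deg i, 𝔥.diff z = 0 →
    ∃ x ∈ 𝔤.deg i, 𝔤.diff x = 0 ∧ ∃ w ∈ 𝔥.deg (i - 1), z = Φ.linearPart x + 𝔥.diff w

end LInfinity

section Manifold

variable (E : Type*) [NormedAddCommGroup E] [NormedSpace ℝ E]

/-- The algebra `C^∞(N)` of smooth real functions on a manifold `N` modelled on `E`. -/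
abbrev SmoothFn (N : Type*) [TopologicalSpace N] [ChartedSpace E N] : Type _ :=
  C^∞⟮modelWithCornersSelf ℝ E, N; ℝ⟯

/-- The `C^∞(N)`-module (and Lie algebra) `T_{C^∞(N)}` of smooth vector fields on `N`: the
derivations of `C^∞(N)`. -/
abbrev VectorFields (N : Type*) [TopologicalSpace N] [ChartedSpace E N] : Type _ :=
  Derivation ℝ (SmoothFn E N) (SmoothFn E N)

/-- Differential `p`-forms on `N`: alternating `C^∞(N)`-multilinear maps from vector fields to
functions. -/
abbrev DiffForm (N : Type*) [TopologicalSpace N] [ChartedSpace E N] (p : ℕ) : Type _ :=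
  VectorFields E N [⋀^Fin p]→ₗ[SmoothFn E N] SmoothFn E N

variable {E}
variable {M : Type*} [TopologicalSpace M] [ChartedSpace E M]

/-- The global (coordinate free) formula for the exterior derivative of a `p`-form, evaluated on
vector fields `X 0, …, X p`:
`∑ i, (-1)^i X_i (η (X_0, …, X̂_i, …, X_p))
  + ∑ i<j, (-1)^j η (X_0, …, [X_i, X_j] in place of X_i, …, X̂_j, …, X_p)`.
Moving the bracket to the front gives the usual sign `(-1)^(i+j)`. -/
def exteriorDeriv {p : ℕ} (η : DiffForm E M p) (X : Fin (p + 1) → VectorFields E M) : SmoothFn E M :=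
  (∑ i : Fin (p + 1), (-1 : ℝ) ^ (i : ℕ) • X i (η (i.removeNth X))) +
  ∑ j : Fin (p + 1), ∑ i ∈ Finset.univ.filter (· < j),
    (-1 : ℝ) ^ (j : ℕ) • η (j.removeNth (Function.update X i ⁅X i, X j⁆))

open TopologicalSpace (Opens)

/-- Restriction of functions from `M` to an open subset. -/
def resFn (U : Opens M) : SmoothFn E M →ₐ[ℝ] SmoothFn E U where
  toFun f := ⟨fun x => f x, f.contMDiff.comp contMDiff_subtype_val⟩
  map_one' := rfl
  map_mul' _ _ := rfl
  map_zero' := rfl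
  map_add' _ _ := rfl
  commutes' _ := rfl

/-- Restriction of functions between open subsets. -/
def resOpen {U V : Opens M} (h : U ≤ V) : SmoothFn E V →ₐ[ℝ] SmoothFn E U where
  toFun f := ⟨fun x => f ⟨x, h x.2⟩, f.contMDiff.comp (contMDiff_inclusion h)⟩
  map_one' := rfl
  map_mul' _ _ := rfl
  map_zero' := rfl
  map_add' _ _ := rfl
  commutes' _ := rfl

/-- Functions on an open subset form a `C^∞(M)`-algebra through restriction. -/
instance (U : Opens M) : Algebra (SmoothFn E M) (SmoothFn E U) := (resFn U).toRingHom.toAlgebra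

instance (U : Opens M) : IsScalarTower ℝ (SmoothFn E M) (SmoothFn E U) :=
  ⟨fun r f h => by ext x; exact mul_assoc r (f x) (h x)⟩

section Restriction

variable [FiniteDimensional ℝ E] [IsManifold (modelWithCornersSelf ℝ E) ∞ M] [T2Space M]

theorem exists_bump (U : Opens M) (x : M) (hx : x ∈ U) :
    ∃ ρ : SmoothFn E M, (∀ᶠ y in 𝓝 x, ρ y = 1) ∧ tsupport ρ ⊆ U := by
  obtain ⟨f, -, hf⟩ := (SmoothBumpFunction.nhds_basis_tsupport
    (I := modelWithCornersSelf ℝ E) x).mem_iff.1 (U.isOpen.mem_nhds hx)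
  exact ⟨⟨f, f.contMDiff⟩, f.eventuallyEq_one, hf⟩

/-- Every germ of a function on an open subset is the germ of a global function. -/
theorem exists_extension (U : Opens M) (f : SmoothFn E U) (x : U) :
    ∃ F : SmoothFn E M, ∀ᶠ y : U in 𝓝 x, F y = f y := by
  obtain ⟨ρ, h1, h2⟩ := exists_bump (E := E) U x x.2
  classical
  let F : M → ℝ := fun y => if h : y ∈ U then ρ y * f ⟨y, h⟩ else 0
  have hF : ∀ y ∈ U, ContMDiffAt (modelWithCornersSelf ℝ E) 𝓘(ℝ, ℝ) ∞ F y := by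
    intro y hy
    rw [← contMDiffAt_subtype_iff (U := U) (x := ⟨y, hy⟩)]
    refine ((resFn U ρ * f).contMDiff ⟨y, hy⟩).congr_of_eventuallyEq (.of_forall fun z => ?_)
    simp only [F, z.2, dite_true]
    rfl
  refine ⟨⟨F, contMDiff_of_tsupport fun y hy => hF y (h2 (closure_mono ?_ hy))⟩, ?_⟩
  · intro z hz
    by_contra h
    apply hz
    simp only [F]
    split_ifs with h'
    · rw [Function.notMem_support.1 h, zero_mul]
    · rfl
  · filter_upwards [continuous_subtype_val.continuousAt.eventually h1] with y hy
    change F y = f y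
    simp only [F, y.2, dite_true, hy, one_mul]

/-- Derivations are local operators. -/
theorem derivation_local (X : VectorFields E M) {F G : SmoothFn E M} {x : M}
    (h : ∀ᶠ y in 𝓝 x, F y = G y) : X F x = X G x := by
  obtain ⟨V, hV, hVo, hxV⟩ := eventually_nhds_iff.1 h
  obtain ⟨ρ, h1, h2⟩ := exists_bump (E := E) ⟨V, hVo⟩ x hxV
  have key : F - G = (1 - ρ) * (F - G) := by
    ext y
    change F y - G y = (1 - ρ y) * (F y - G y)
    by_cases hy : y ∈ V
    · rw [hV y hy]; ring
    · rw [image_eq_zero_of_notMem_tsupport fun hh => hy (h2 hh)]; ring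
  have e := congrArg (fun f => X f x) key
  simp only [Derivation.leibniz, map_sub] at e
  have e' : X F x - X G x =
      (1 - ρ x) * (X F x - X G x) + (F x - G x) * (X 1 x - X ρ x) := e
  rw [h1.self_of_nhds, h.self_of_nhds] at e'
  linarith

/-- The germ of a global function extending `f` near `x`. -/
def extendAt (U : Opens M) (f : SmoothFn E U) (x : U) : SmoothFn E M :=
  (exists_extension U f x).choose

theorem extendAt_spec (U : Opens M) (f : SmoothFn E U) (x : U) :
    ∀ᶠ y : U in 𝓝 x, extendAt U f x y = f y :=
  (exists_extension U f x).choose_spec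

theorem apply_eq_of_germ (X : VectorFields E M) (U : Opens M) (f : SmoothFn E U) (x : U)
    (F : SmoothFn E M) (h : ∀ᶠ y : U in 𝓝 x, F y = f y) : X (extendAt U f x) x = X F x := by
  refine derivation_local X ?_
  have : ∀ᶠ y : U in 𝓝 x, extendAt U f x y = F y := by
    filter_upwards [extendAt_spec U f x, h] with y h1 h2
    rw [h1, h2]
  rw [nhds_subtype_eq_comap, Filter.eventually_comap] at this
  filter_upwards [this, U.isOpen.mem_nhds x.2] with y hy hyU
  exact hy ⟨y, hyU⟩ rfl

theorem smooth_restrict (X : VectorFields E M) (U : Opens M) (f : SmoothFn E U) :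
    ContMDiff (modelWithCornersSelf ℝ E) 𝓘(ℝ, ℝ) ∞ fun x : U => X (extendAt U f x) x := by
  intro x
  refine ((resFn U (X (extendAt U f x))).contMDiff x).congr_of_eventuallyEq ?_
  filter_upwards [(extendAt_spec U f x).eventually_nhds] with y hy
  exact apply_eq_of_germ X U f y _ hy

/-- The restriction `X|_U` of a vector field to an open subset: `(X|_U f)(x) = (X F)(x)` for any
global function `F` that agrees with `f` near `x`. -/
def resVF (U : Opens M) (X : VectorFields E M) : VectorFields E U :=
  Derivation.mk'
    { toFun := fun f => ⟨fun x => X (extendAt U f x) x, smooth_restrict X U f⟩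
      map_add' := fun f h => by
        ext x
        change X (extendAt U (f + h) x) x = X (extendAt U f x) x + X (extendAt U h x) x
        rw [apply_eq_of_germ X U (f + h) x (extendAt U f x + extendAt U h x), map_add]
        · rfl
        · filter_upwards [extendAt_spec U f x, extendAt_spec U h x] with y h1 h2
          exact congrArg₂ (· + ·) h1 h2
      map_smul' := fun c f => by
        ext x
        change X (extendAt U (c • f) x) x = c • X (extendAt U f x) x
        rw [apply_eq_of_germ X U (c • f) x (c • extendAt U f x), Derivation.map_smul]
        · rfl
        · filter_upwards [extendAt_spec U f x] with y h1
          exact congrArg (c • ·) h1 }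
    fun f h => by
      ext x
      change X (extendAt U (f * h) x) x =
        f x * X (extendAt U h x) x + h x * X (extendAt U f x) x
      rw [apply_eq_of_germ X U (f * h) x (extendAt U f x * extendAt U h x), Derivation.leibniz]
      · rw [← (extendAt_spec U f x).self_of_nhds, ← (extendAt_spec U h x).self_of_nhds]
        rfl
      · filter_upwards [extendAt_spec U f x, extendAt_spec U h x] with y h1 h2
        exact congrArg₂ (· * ·) h1 h2

theorem resVF_apply (U : Opens M) (X : VectorFields E M) (f : SmoothFn E U) (x : U)
    (F : SmoothFn E M) (h : ∀ᶠ y : U in 𝓝 x, F y = f y) : resVF U X f x = X F x :=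
  apply_eq_of_germ X U f x F h

theorem resVF_zero (U : Opens M) : resVF U (0 : VectorFields E M) = 0 := rfl

theorem resVF_add (U : Opens M) (X Y : VectorFields E M) :
    resVF U (X + Y) = resVF U X + resVF U Y := rfl

theorem resVF_smul (U : Opens M) (a : SmoothFn E M) (X : VectorFields E M) :
    resVF U (a • X) = resFn U a • resVF U X := rfl

theorem resVF_lie (U : Opens M) (X Y : VectorFields E M) :
    resVF U ⁅X, Y⁆ = ⁅resVF U X, resVF U Y⁆ := by
  ext f x
  have hX : ∀ Z : VectorFields E M, ∀ᶠ y : U in 𝓝 x, Z (extendAt U f x) y = resVF U Z f y := by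
    intro Z
    filter_upwards [(extendAt_spec U f x).eventually_nhds] with y hy
    exact (resVF_apply U Z f y _ hy).symm
  have h := resVF_apply U ⁅X, Y⁆ f x _ (extendAt_spec U f x)
  rw [h, Derivation.commutator_apply, Derivation.commutator_apply]
  change X (Y (extendAt U f x)) x - Y (X (extendAt U f x)) x =
    resVF U X (resVF U Y f) x - resVF U Y (resVF U X f) x
  rw [resVF_apply U X _ x _ (hX Y), resVF_apply U Y _ x _ (hX X)]

/-- Restricting vector fields is compatible with restricting functions between open subsets. -/
theorem resVF_resOpen {U V : Opens M} (h : U ≤ V) (X : VectorFields E M) (f : SmoothFn E V) :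
    resVF U X (resOpen h f) = resOpen h (resVF V X f) := by
  ext x
  change resVF U X (resOpen h f) x = resVF V X f ⟨x, h x.2⟩
  rw [resVF_apply V X f ⟨x, h x.2⟩ _ (extendAt_spec V f ⟨x, h x.2⟩)]
  refine resVF_apply U X _ x _ ?_
  exact (continuous_inclusion h).continuousAt.eventually (extendAt_spec V f ⟨x, h x.2⟩)

end Restriction

section Cech

variable {Λ : Type*} (U : Λ → Opens M)

/-- The finite intersection `U_{a 0} ∩ … ∩ U_{a (k-1)}`. -/
def inter {k : ℕ} (a : Fin k → Λ) : Opens M :=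
  ⟨⋂ i, (U (a i) : Set M), isOpen_iInter_of_finite fun i => (U (a i)).isOpen⟩

theorem inter_le {j k : ℕ} (a : Fin k → Λ) (s : Fin j → Fin k) :
    inter U a ≤ inter U (a ∘ s) := fun _ hx =>
  Set.mem_iInter.2 fun i => Set.mem_iInter.1 hx (s i)

/-- `C^∞(Č_k U)`, where `Č_k U` is the disjoint union of all `(k+1)`-fold intersections. -/
abbrev CechFn (k : ℕ) : Type _ := ∀ a : Fin (k + 1) → Λ, SmoothFn E (inter U a)

/-- `Ω^p(Č_k U)`. -/
abbrev CechForm (E : Type*) [NormedAddCommGroup E] [NormedSpace ℝ E] {M : Type*}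
    [TopologicalSpace M] [ChartedSpace E M] {Λ : Type*} (U : Λ → Opens M) (p k : ℕ) : Type _ :=
  ∀ a : Fin (k + 1) → Λ, DiffForm E (inter U a) p

/-- The Čech differential `(δf)_{a_0 … a_{k+1}} = ∑ i, (-1)^i f_{a_0 … â_i … a_{k+1}}`. -/
def cechDiff (k : ℕ) :
    CechFn (E := E) U k →ₗ[SmoothFn E M] CechFn (E := E) U (k + 1) where
  toFun f a := ∑ i : Fin (k + 2),
    (-1 : ℝ) ^ (i : ℕ) • resOpen (inter_le U a i.succAbove) (f (a ∘ i.succAbove))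
  map_add' f h := by
    ext1 a
    simp only [Pi.add_apply, map_add, smul_add, Finset.sum_add_distrib]
  map_smul' c f := by
    ext1 a
    simp only [Pi.smul_apply, RingHom.id_apply, Finset.smul_sum]
    refine Finset.sum_congr rfl fun i _ => ?_
    rw [smul_comm]
    rfl

theorem alternating_faces {ι : Type*} {k : ℕ} (F : (Fin k → ι) → ℝ) (a : Fin (k + 2) → ι) :
    ∑ i : Fin (k + 2), ∑ j : Fin (k + 1), (-1 : ℝ) ^ (i : ℕ) * ((-1 : ℝ) ^ (j : ℕ) *
      F ((a ∘ i.succAbove) ∘ j.succAbove)) = 0 := by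
  rw [← Finset.sum_product']
  refine Finset.sum_involution (fun p _ => (p.1.succAbove p.2, p.2.predAbove p.1)) ?_ ?_
    (fun _ _ => by simp) ?_
  · rintro ⟨i, j⟩ -
    have h : (a ∘ (i.succAbove j).succAbove) ∘ (j.predAbove i).succAbove =
        (a ∘ i.succAbove) ∘ j.succAbove := by
      funext l
      simp [Fin.succAbove_succAbove_succAbove_predAbove]
    simp only [h]
    rw [← mul_assoc, ← mul_assoc, ← pow_add, ← pow_add, Fin.neg_one_pow_succAbove_add_predAbove,
      pow_add]
    ring
  · rintro ⟨i, j⟩ - - h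
    exact Fin.succAbove_ne i j (congrArg Prod.fst h)
  · rintro ⟨i, j⟩ -
    simp [Fin.succAbove_succAbove_predAbove, Fin.predAbove_predAbove_succAbove]

theorem cechDiff_cechDiff (k : ℕ) (f : CechFn (E := E) U k) :
    cechDiff U (k + 1) (cechDiff U k f) = 0 := by
  classical
  ext a x
  let F : (Fin (k + 1) → Λ) → ℝ := fun b => if h : (x : M) ∈ inter U b then f b ⟨x, h⟩ else 0
  have hF : ∀ (j : ℕ) (b : Fin j → Λ) (hb : (x : M) ∈ inter U b) (s : Fin (k + 1) → Fin j),
      f (b ∘ s) ⟨x, inter_le U b s hb⟩ = F (b ∘ s) := by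
    intro j b hb s
    simp only [F]
    rw [dif_pos (show (x : M) ∈ inter U (b ∘ s) from inter_le U b s hb)]
  refine Eq.trans ?_ (alternating_faces F a)
  let ev (V : Opens M) (z : V) : SmoothFn E V →+ ℝ := ⟨⟨fun f => f z, rfl⟩, fun _ _ => rfl⟩
  change ev _ x _ = _
  simp only [cechDiff, LinearMap.coe_mk, AddHom.coe_mk, map_sum]
  refine Finset.sum_congr rfl fun i _ => ?_
  change (-1 : ℝ) ^ (i : ℕ) * ev (inter U a) x _ = _
  rw [map_sum, Finset.mul_sum]
  refine Finset.sum_congr rfl fun j _ => ?_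
  rw [← hF _ (a ∘ i.succAbove) (inter_le U a i.succAbove x.2) j.succAbove]
  rfl

/-- Restriction `C^∞(M) → C^∞(Č_0 U)`. -/
def augment : SmoothFn E M →ₗ[SmoothFn E M] CechFn (E := E) U 0 where
  toFun f a := resFn (inter U a) f
  map_add' _ _ := rfl
  map_smul' _ _ := rfl

/-- Čech cochains `(h_k)_k`, `h_k ∈ C^∞(Č_k U)`, of all degrees. -/
abbrev CechCochains (E : Type*) [NormedAddCommGroup E] [NormedSpace ℝ E] {M : Type*}
    [TopologicalSpace M] [ChartedSpace E M] {Λ : Type*} (U : Λ → Opens M) : Type _ :=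
  ∀ k : ℕ, CechFn (E := E) U k

/-- The Čech differential on cochains of all degrees, `(δh)_{k+1} = δ(h_k)` and `(δh)_0 = 0`. -/
def totalCechDiff (h : CechCochains E U) : CechCochains E U
  | 0 => 0
  | k + 1 => cechDiff U k (h k)

variable [FiniteDimensional ℝ E] [IsManifold (modelWithCornersSelf ℝ E) ∞ M] [T2Space M]

/-- The Lie derivative of a function on `Č_k U` along a vector field on `M`. -/
def lieCech {k : ℕ} (X : VectorFields E M) (f : CechFn (E := E) U k) : CechFn (E := E) U k :=
  fun a => resVF (inter U a) X (f a)

variable {U}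

/-- Evaluation of a form on `Č_k U` on vector fields on `M`. -/
def CechForm.eval {p k : ℕ} (η : CechForm E U p k) (X : Fin p → VectorFields E M) :
    CechFn (E := E) U k :=
  fun a => η a fun i => resVF (inter U a) (X i)

/-- Evaluation of the exterior derivative of a form on `Č_k U` on vector fields on `M`. -/
def CechForm.extEval {p k : ℕ} (η : CechForm E U p k) (X : Fin (p + 1) → VectorFields E M) :
    CechFn (E := E) U k :=
  fun a => exteriorDeriv (η a) fun i => resVF (inter U a) (X i)

end Cech

section U1

/-- Smooth functions with values in `U(1)`. -/
abbrev CircleFn (E : Type*) [NormedAddCommGroup E] [NormedSpace ℝ E]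
    (N : Type*) [TopologicalSpace N] [ChartedSpace E N] : Type _ :=
  C^∞⟮modelWithCornersSelf ℝ E, N; 𝓡 1, Circle⟯

theorem contMDiff_circle_coe : ContMDiff (𝓡 1) 𝓘(ℝ, ℂ) ∞ (fun z : Circle => (z : ℂ)) :=
  have : Fact (Module.finrank ℝ ℂ = 1 + 1) := finrank_real_complex_fact'
  contMDiff_coe_sphere (E := ℂ)

/-- The real part of a `U(1)`-valued function. -/
def reFn (g : CircleFn E M) : SmoothFn E M :=
  ⟨fun x => (g x : ℂ).re,
    Complex.reCLM.contDiff.contMDiff.comp (contMDiff_circle_coe.comp g.contMDiff)⟩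

/-- The imaginary part of a `U(1)`-valued function. -/
def imFn (g : CircleFn E M) : SmoothFn E M :=
  ⟨fun x => (g x : ℂ).im,
    Complex.imCLM.contDiff.contMDiff.comp (contMDiff_circle_coe.comp g.contMDiff)⟩

theorem re_sq_add_im_sq (g : CircleFn E M) : reFn g * reFn g + imFn g * imFn g = 1 := by
  ext x
  have h := Circle.normSq_coe (g x)
  rw [Complex.normSq_apply] at h
  exact h

/-- The real one-form `d log g = (2πi)⁻¹ g⁻¹ dg`, for `U(1) = ℝ/ℤ`, evaluated on a vector field:
with `g = u + iv` it is `(2π)⁻¹ (u dv - v du)`. -/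
def dlog (g : CircleFn E M) (X : VectorFields E M) : SmoothFn E M :=
  (2 * Real.pi)⁻¹ • (reFn g * X (imFn g) - imFn g * X (reFn g))

theorem dlog_lie (g : CircleFn E M) (X Y : VectorFields E M) :
    dlog g ⁅X, Y⁆ = X (dlog g Y) - Y (dlog g X) := by
  have h := re_sq_add_im_sq g
  have hX := congrArg X h
  have hY := congrArg Y h
  simp only [map_add, Derivation.leibniz, smul_eq_mul, Derivation.map_one_eq_zero] at hX hY
  simp only [dlog, Derivation.map_smul, map_sub, Derivation.leibniz, smul_eq_mul,
    Derivation.commutator_apply]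
  rw [← smul_sub]
  congr 1
  set u := reFn g
  set v := imFn g
  have half : ∀ w : SmoothFn E M, w + w = 0 → w = 0 := by
    intro w hw
    ext x
    have : w x + w x = 0 := congrArg (fun f => f x) hw
    change w x = 0
    linarith
  have eX : u * X u + v * X v = 0 := half _ (by linear_combination hX)
  have eY : u * Y u + v * Y v = 0 := half _ (by linear_combination hY)
  have e : X u * Y v - X v * Y u = 0 := by
    linear_combination (-(X u * Y v - X v * Y u)) * h + (u * Y v - v * Y u) * eX
      + (v * X u - u * X v) * eY
  linear_combination (-2) * e

variable {Λ : Type*} (U : Λ → Opens M)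

/-- `U(1)`-valued Čech `k`-cochains. -/
abbrev CircleCochain (E : Type*) [NormedAddCommGroup E] [NormedSpace ℝ E] {M : Type*}
    [TopologicalSpace M] [ChartedSpace E M] {Λ : Type*} (U : Λ → Opens M) (k : ℕ) : Type _ :=
  ∀ a : Fin (k + 1) → Λ, CircleFn E (inter U a)

variable {U}

/-- The cocycle condition `δg = 1`. -/
def IsCocycle {k : ℕ} (g : CircleCochain E U k) : Prop :=
  ∀ (a : Fin (k + 2) → Λ) (x : M) (hx : x ∈ inter U a),
    ∏ i : Fin (k + 2),
      g (a ∘ i.succAbove) ⟨x, inter_le U a i.succAbove hx⟩ ^ ((-1 : ℤ) ^ (i : ℕ)) = 1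

variable [FiniteDimensional ℝ E] [IsManifold (modelWithCornersSelf ℝ E) ∞ M] [T2Space M]

/-- `d log g` evaluated on a vector field on `M`. -/
def cechDlog {k : ℕ} (g : CircleCochain E U k) : 
    VectorFields E M →ₗ[SmoothFn E M] CechFn (E := E) U k where
  toFun X a := dlog (g a) (resVF (inter U a) X)
  map_add' X Y := by
    ext1 a
    simp only [dlog, resVF_add, Derivation.add_apply, Pi.add_apply, ← smul_add]
    congr 1
    ring
  map_smul' c X := by
    ext1 a
    simp only [dlog, resVF_smul, Derivation.smul_apply, smul_eq_mul, Pi.smul_apply,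
      RingHom.id_apply, Algebra.smul_def]
    change _ = resFn (inter U a) c * _
    ring

theorem cechDlog_lie {k : ℕ} (g : CircleCochain E U k) (X Y : VectorFields E M) :
    cechDlog g ⁅X, Y⁆ = lieCech U X (cechDlog g Y) - lieCech U Y (cechDlog g X) := by
  ext1 a
  change dlog (g a) (resVF (inter U a) ⁅X, Y⁆) = _
  rw [resVF_lie, dlog_lie]
  rfl

theorem lieCech_cechDiff {k : ℕ} (X : VectorFields E M) (f : CechFn (E := E) U k) :
    lieCech U X (cechDiff U k f) = cechDiff U k (lieCech U X f) := by
  ext1 a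
  simp only [lieCech, cechDiff, LinearMap.coe_mk, AddHom.coe_mk, map_sum, Derivation.map_smul]
  refine Finset.sum_congr rfl fun i _ => ?_
  rw [resVF_resOpen]

end U1

section Atiyah

/-- `At_{n-1}(H)` for an `(n+1)`-form `H`, where `n = m + 1`: the graded module
`TM ⊕ C^∞(M)[n-1]` with zero differential, anchor the projection, binary bracket given by the Lie
bracket and `[X, f] = X f` (hence `(-1)^n X f` for the shifted arguments in the order `f, X`), and
`(n+1)`-ary bracket `H(X_1, …, X_{n+1})`. -/
def atiyah {m : ℕ} (H : DiffForm E M (m + 2)) : PreLInftyAlgebroid (SmoothFn E M) where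
  carrier := VectorFields E M × SmoothFn E M
  deg i :=
    { carrier := {x | (i ≠ 0 → x.1 = 0) ∧ (i ≠ -m → x.2 = 0)}
      add_mem' := by
        rintro x y ⟨h1, h2⟩ ⟨h3, h4⟩
        exact ⟨fun h => by simp [h1 h, h3 h], fun h => by simp [h2 h, h4 h]⟩
      zero_mem' := ⟨fun _ => rfl, fun _ => rfl⟩
      smul_mem' := by
        rintro c x ⟨h1, h2⟩
        exact ⟨fun h => by simp [h1 h], fun h => by simp [h2 h]⟩ }
  bracket k x :=
    (if h : k = 2 then
      let v := x (Fin.cast h.symm 0)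
      let w := x (Fin.cast h.symm 1)
      (⁅v.1, w.1⁆, v.1 w.2 + (-1 : ℝ) ^ (m + 1) • w.1 v.2)
    else 0) +
    (if h : k = m + 2 then (0, H fun i => (x (Fin.cast h.symm i)).1) else 0)
  anchor := LinearMap.fst _ _ _

variable {Λ : Type*} {U : Λ → Opens M}
variable [FiniteDimensional ℝ E] [IsManifold (modelWithCornersSelf ℝ E) ∞ M] [T2Space M]

/-- The module underlying `ČAt(g)`, for a `U(1)`-valued Čech `n`-cochain `g`, `n = m + 1`: families
`(X, h_0, …, h_{n-1})` with `h_k ∈ C^∞(Č_k U)` and `d log g (X) = δ h_{n-1}`, i.e. the sum of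
`C^∞(Č_k U)`, `k < n - 1`, and of `E_{n-1}(g)`. -/
def cechAtiyahModule {m : ℕ} (g : CircleCochain E U (m + 1)) :
    Submodule (SmoothFn E M) (VectorFields E M × CechCochains E U) where
  carrier := {x | (∀ k, m < k → x.2 k = 0) ∧ cechDlog g x.1 = cechDiff U m (x.2 m)}
  add_mem' := by
    rintro x y ⟨h1, h2⟩ ⟨h3, h4⟩
    exact ⟨fun k hk => by simp [h1 k hk, h3 k hk], by simp [h2, h4]⟩
  zero_mem' := ⟨fun _ _ => rfl, by simp⟩
  smul_mem' := by
    rintro c x ⟨h1, h2⟩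
    exact ⟨fun k hk => by simp [h1 k hk], by simp [h2]⟩

/-- The differential of `ČAt(g)`: it vanishes on `E_{n-1}(g)` and is `(-1)^(n-k) δ` on
`C^∞(Č_k U)`, `k < n - 1`. In terms of `m = n - 1` and the target index `k`, the sign is
`(-1)^(m+k)`. -/
def cechAtiyahDiff {m : ℕ} (g : CircleCochain E U (m + 1)) (x : cechAtiyahModule g) :
    cechAtiyahModule g :=
  ⟨(0, fun k => if k ≤ m then (-1 : ℝ) ^ (m + k) • totalCechDiff U x.1.2 k else 0), by
    refine ⟨fun k hk => if_neg (not_le.2 hk), ?_⟩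
    rw [map_zero]
    simp only [le_refl, if_true]
    have h : cechDiff U m (totalCechDiff U x.1.2 m) = 0 := by
      cases m with
      | zero => exact map_zero _
      | succ k => exact cechDiff_cechDiff U k _
    rw [LinearMap.map_smul_of_tower, h, smul_zero]⟩

/-- The binary bracket of `ČAt(g)`, on shifted arguments: `[(X, f), (Y, h)] = ([X, Y], X h - Y f)`
in degree zero, `[(X, f), h] = X h` for `h` in negative degree, hence `(-1)^(n-k) X h` for
`h ∈ C^∞(Č_k U)` and the order `h, (X, f)` of the shifted arguments, and zero if both arguments have
negative degree. -/
def cechAtiyahBracket {m : ℕ} (g : CircleCochain E U (m + 1)) (x y : cechAtiyahModule g) :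
    cechAtiyahModule g :=
  ⟨(⁅x.1.1, y.1.1⁆, fun k =>
      lieCech U x.1.1 (y.1.2 k) + (-1 : ℝ) ^ (m + 1 + k) • lieCech U y.1.1 (x.1.2 k)), by
    obtain ⟨⟨X, f⟩, hf, hX⟩ := x
    obtain ⟨⟨Y, h⟩, hh, hY⟩ := y
    dsimp only at hf hX hh hY ⊢
    refine ⟨fun k hk => ?_, ?_⟩
    · have e : ∀ Z : VectorFields E M, lieCech U Z (0 : CechFn (E := E) U k) = 0 := fun Z => by
        ext1 a
        exact map_zero (resVF (inter U a) Z)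
      simp only [hf k hk, hh k hk, e, smul_zero, add_zero]
    · have e : (-1 : ℝ) ^ (m + 1 + m) = -1 := by
        rw [show m + 1 + m = 2 * m + 1 by ring, pow_succ, pow_mul]
        simp
      simp only [e, neg_smul, one_smul]
      rw [cechDlog_lie, hX, hY, lieCech_cechDiff, lieCech_cechDiff, map_add, map_neg,
        sub_eq_add_neg]⟩

/-- The Čech–Atiyah dg Lie algebroid `ČAt(g)` of a `U(1)`-valued Čech `n`-cochain `g`, `n = m + 1`:
`C^∞(Č_k U)` has degree `k - (n - 1)` for `k < n - 1`, and `E_{n-1}(g)` has degree zero. -/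
def cechAtiyah {m : ℕ} (g : CircleCochain E U (m + 1)) :
    PreLInftyAlgebroid (SmoothFn E M) where
  carrier := cechAtiyahModule g
  deg i :=
    { carrier := {x | (i ≠ 0 → x.1.1 = 0) ∧ ∀ k : ℕ, (k : ℤ) ≠ m + i → x.1.2 k = 0}
      add_mem' := by
        rintro x y ⟨h1, h2⟩ ⟨h3, h4⟩
        exact ⟨fun h => by simp [h1 h, h3 h], fun k h => by simp [h2 k h, h4 k h]⟩
      zero_mem' := ⟨fun _ => rfl, fun _ _ => rfl⟩
      smul_mem' := by
        rintro c x ⟨h1, h2⟩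
        exact ⟨fun h => by simp [h1 h], fun k h => by simp [h2 k h]⟩ }
  bracket k x :=
    if h : k = 1 then cechAtiyahDiff g (x (Fin.cast h.symm 0))
    else if h : k = 2 then
      cechAtiyahBracket g (x (Fin.cast h.symm 0)) (x (Fin.cast h.symm 1))
    else 0
  anchor := LinearMap.fst _ _ _ ∘ₗ (cechAtiyahModule g).subtype

/-- A full connection `(A^(1), …, A^(n))`, `A^(p) ∈ Ω^p(Č_{n-p} U)`, on a `U(1)`-valued Čech
`n`-cochain `g`, `n = m + 1`, i.e. an enhancement of `g` to a full Čech–Deligne cochain that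
satisfies `d log g = δ A^(1)` and `d A^(p-1) + (-1)^p δ A^(p) = 0` for `2 ≤ p ≤ n`. Here
`form q k = A^(q+1)`, where `q + k = m`. Forms on open subsets are determined by their values on
restrictions of vector fields on `M`, and the Čech differential of forms satisfies
`(δη)(X_1, …) = δ(η(X_1, …))`. -/
structure FullConnection {m : ℕ} (g : CircleCochain E U (m + 1)) where
  form : ∀ q k : ℕ, q + k = m → CechForm E U (q + 1) k
  dlog_eq : ∀ X : Fin 1 → VectorFields E M,
    cechDlog g (X 0) = cechDiff U m ((form 0 m (zero_add m)).eval X)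
  deligne : ∀ (q k : ℕ) (h : q + (k + 1) = m) (X : Fin (q + 2) → VectorFields E M),
    (form q (k + 1) h).extEval X +
      (-1 : ℝ) ^ (q + 2) • cechDiff U k ((form (q + 1) k (by omega)).eval X) = 0

/-- The connection has curvature `H`: `d A^(n)` is the restriction of `H` to the open cover. -/
def FullConnection.HasCurvature {m : ℕ} {g : CircleCochain E U (m + 1)} (𝒜 : FullConnection g)
    (H : DiffForm E M (m + 2)) : Prop :=
  ∀ X : Fin (m + 2) → VectorFields E M,
    (𝒜.form m 0 (add_zero m)).extEval X = augment U (H X)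

/-- The formula for the maps `At_{n-1}(H)^{⊗ k} → ČAt(g)` induced by a full connection:
`X ↦ (X, A^(1)(X))` and `f ↦ δf ∈ C^∞(Č_0 U)` for `k = 1`, and
`(X_1, …, X_k) ↦ A^(k)(X_1, …, X_k) ∈ C^∞(Č_{n-k} U)` for `2 ≤ k ≤ n`. -/
def FullConnection.inducedMap {m : ℕ} {g : CircleCochain E U (m + 1)} (𝒜 : FullConnection g) :
    ∀ k : ℕ, (Fin k → VectorFields E M × SmoothFn E M) → VectorFields E M × CechCochains E U
  | 0, _ => 0
  | q + 1, x =>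
    (if q = 0 then (x 0).1 else 0, fun j =>
      if h : q + j = m then (𝒜.form q j h).eval fun i => (x i).1 else 0) +
    (0, if q = 0 then Pi.single 0 (augment U (x 0).2) else 0)

end Atiyah
end Manifold
end CechAtiyah

end

/-!
All brackets and components in sight are assembled from two kinds of operations on pairs
`(X, f)` of a derivation and a function: the binary semidirect product bracket and alternating forms
in the derivations. This is the structure of `At_{n-1}(H)` itself, and the components of
`ČAt(g)` over the intersections of members of the cover turn its bracket into the semidirect
product bracket and the components of `Φ_{g,𝒜}` into the forms of the connection. For such
operations the Koszul signs of the quadratic sums in the Jacobi and Maurer–Cartan identities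
reduce to those of the global formula for the exterior derivative: the Jacobi identities of
`At_{n-1}(H)` amount to `d H = 0`, and the Maurer–Cartan equation in arity `p + 1` amounts to
the Čech–Deligne equation relating `d A^{(p)}` to `δ̌ A^{(p+1)}`, or to `H` if `p = n`. The
remaining Čech–Deligne equation `d log g = δ̌ A^{(1)}` says that the linear part of `Φ_{g,𝒜}`
takes values in `ČAt(g)`; it is a quasi-isomorphism because the augmented Čech complex of smooth
functions is exact, by a partition of unity.
-/

noncomputable section

namespace CechAtiyah

section Signs

theorem neg_one_pow_units_smul {W : Type*} [AddCommGroup W] [Module ℝ W] (n : ℕ) (w : W) :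
    ((-1 : ℤˣ) ^ n) • w = ((-1 : ℝ) ^ n) • w := by
  rcases n.even_or_odd with h | h <;> simp [h.neg_one_pow]

variable {k : ℕ} {ι : Type*} [LinearOrder ι]

theorem koszulSign_of_monotone {p : Fin k → ι} (hp : Monotone p) (d : Fin k → ℤ) :
    koszulSign p d = 1 :=
  Finset.prod_eq_one fun _ _ => Finset.prod_eq_one fun _ _ =>
    if_neg fun h => (hp h.1.le).not_gt h.2

theorem koszulSign_strictMono_comp {κ : Type*} [LinearOrder κ] {f : ι → κ} (hf : StrictMono f)
    (p : Fin k → ι) (d : Fin k → ℤ) : koszulSign (f ∘ p) d = koszulSign p d := by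
  simp only [koszulSign, Function.comp_apply, hf.lt_iff_lt]

theorem koszulSign_degree_zero (p : Fin k → ι) :
    koszulSign p 0 = ∏ b, ∏ a, if a < b ∧ p b < p a then (-1 : ℤˣ) else 1 := by
  rw [koszulSign, Finset.prod_comm]
  simp

theorem koszulSign_smul_of_degree {W : Type*} [AddCommGroup W] (p : Fin k → ι) {d : Fin k → ℤ}
    {w : W} (h : d ≠ 0 → w = 0) : koszulSign p d • w = koszulSign p 0 • w := by
  by_cases hd : d = 0
  · rw [hd]
  · rw [h hd, smul_zero, smul_zero]

theorem koszulSign_perm_zero (σ : Equiv.Perm (Fin k)) :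
    koszulSign σ 0 = Equiv.Perm.sign σ := by
  rw [koszulSign_degree_zero, Equiv.Perm.sign_eq_prod_prod_Iio]
  refine Finset.prod_congr rfl fun b _ => ?_
  rw [← Finset.prod_subset (Finset.subset_univ (Finset.Iio b))]
  · refine Finset.prod_congr rfl fun a ha => ?_
    have hab := Finset.mem_Iio.1 ha
    rcases lt_or_gt_of_ne (σ.injective.ne hab.ne) with h | h
    · simp [h, h.not_gt]
    · simp [h, h.not_gt, hab]
  · intro a _ ha
    exact if_neg fun h => ha (Finset.mem_Iio.2 h.1)

/-- The Koszul sign of the shuffle that moves the elements with indices in `S` to the front. -/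
def shuffleSign (S : Finset (Fin k)) (d : Fin k → ℤ) : ℤˣ :=
  koszulSign (fun i => if i ∈ S then 0 else 1) d

theorem shuffleSign_univ (d : Fin k → ℤ) : shuffleSign Finset.univ d = 1 :=
  koszulSign_of_monotone (by simp [monotone_const]) d

theorem shuffleSign_zero (S : Finset (Fin k)) :
    shuffleSign S 0 = ∏ b ∈ S, ∏ a ∈ Sᶜ, if a < b then (-1 : ℤˣ) else 1 := by
  rw [shuffleSign, koszulSign_degree_zero]
  simp only [← Finset.prod_ite_mem_eq S, ← Finset.prod_ite_mem_eq Sᶜ, Finset.mem_compl]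
  refine Finset.prod_congr rfl fun b _ => ?_
  by_cases hb : b ∈ S
  · simp only [hb, if_true]
    refine Finset.prod_congr rfl fun a _ => ?_
    by_cases ha : a ∈ S <;> simp [ha]
  · simp only [hb, if_false]
    exact Finset.prod_eq_one fun a _ => by by_cases ha : a ∈ S <;> simp [ha]

theorem prod_ite_lt (i : Fin k) : (∏ a, if a < i then (-1 : ℤˣ) else 1) = (-1) ^ (i : ℕ) := by
  rw [Finset.prod_ite, Finset.prod_const, Finset.prod_const_one, mul_one,
    show Finset.univ.filter (· < i) = Finset.Iio i by ext; simp, Fin.card_Iio]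

theorem prod_ite_gt {n : ℕ} (i : Fin (n + 1)) :
    (∏ a, if i < a then (-1 : ℤˣ) else 1) = (-1) ^ (n + i : ℕ) := by
  rw [Finset.prod_ite, Finset.prod_const, Finset.prod_const_one, mul_one,
    show Finset.univ.filter (i < ·) = Finset.Ioi i by ext; simp, Fin.card_Ioi,
    Int.units_pow_eq_pow_mod_two, Int.units_pow_eq_pow_mod_two (-1) (n + i)]
  congr 1
  omega

theorem shuffleSign_singleton_zero (i : Fin k) : shuffleSign {i} 0 = (-1) ^ (i : ℕ) := by
  rw [shuffleSign_zero, Finset.prod_singleton, ← prod_ite_lt, ← Finset.prod_compl_mul_prod {i}]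
  simp

theorem shuffleSign_compl_singleton_zero {n : ℕ} (i : Fin (n + 1)) :
    shuffleSign {i}ᶜ 0 = (-1) ^ (n + i : ℕ) := by
  rw [shuffleSign_zero, ← prod_ite_gt, ← Finset.prod_compl_mul_prod {i}]
  simp

theorem shuffleSign_pair_zero {i j : Fin k} (hij : i < j) :
    shuffleSign {i, j} 0 = -((-1) ^ (i : ℕ) * (-1) ^ (j : ℕ)) := by
  rw [shuffleSign_zero, Finset.prod_pair hij.ne, ← prod_ite_lt i, ← prod_ite_lt j,
    ← Finset.prod_compl_mul_prod {i, j}, ← Finset.prod_compl_mul_prod {i, j},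
    Finset.prod_pair hij.ne, Finset.prod_pair hij.ne]
  simp [hij, hij.not_gt]

end Signs

section Subsets

variable {V W N : Type*} [AddCommMonoid N] {k n : ℕ}

/-- A family of operations, one of each arity, on elements of `V` with values in `W`. -/
abbrev Operations (V W : Type*) : Type _ := ∀ k : ℕ, (Fin k → V) → W

theorem apply_subtuple (B : Operations V W) (x : Fin k → V) (S : Finset (Fin k))
    (e : S.card = n) (f : Fin n → Fin k) (hf : StrictMono f) (hS : ∀ i, f i ∈ S) :
    B S.card (subtuple x S) = B n (x ∘ f) := by
  subst e
  rw [Finset.orderEmbOfFin_unique rfl hS hf]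
  rfl

theorem apply_subtuple_empty (B : Operations V W) (x : Fin k → V) :
    B (∅ : Finset (Fin k)).card (subtuple x ∅) = B 0 Fin.elim0 := by
  rw [apply_subtuple B x ∅ Finset.card_empty Fin.elim0 (Subsingleton.strictMono _) fun i => i.elim0]
  congr 1
  exact Subsingleton.elim _ _

theorem apply_subtuple_univ (B : Operations V W) (x : Fin k → V) :
    B (Finset.univ : Finset (Fin k)).card (subtuple x Finset.univ) = B k x :=
  apply_subtuple B x _ (by simp) id strictMono_id fun _ => Finset.mem_univ _

theorem apply_subtuple_singleton (B : Operations V W) (x : Fin k → V) (i : Fin k) :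
    B ({i} : Finset (Fin k)).card (subtuple x {i}) = B 1 fun _ => x i :=
  apply_subtuple B x _ (by simp) (fun _ => i) (Subsingleton.strictMono _) fun _ => by simp

theorem apply_subtuple_pair (B : Operations V W) (x : Fin k → V) {i j : Fin k} (hij : i < j) :
    B ({i, j} : Finset (Fin k)).card (subtuple x {i, j}) = B 2 ![x i, x j] := by
  rw [apply_subtuple B x _ (Finset.card_pair hij.ne) ![i, j]
    (by simpa [Fin.strictMono_iff_lt_succ] using hij) (by simp [Fin.forall_fin_two])]
  congr 1
  ext l
  fin_cases l <;> rfl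

theorem apply_subtuple_compl_singleton (B : Operations V W) (x : Fin (n + 1) → V)
    (i : Fin (n + 1)) :
    B ({i}ᶜ : Finset (Fin (n + 1))).card (subtuple x {i}ᶜ) = B n (i.removeNth x) :=
  apply_subtuple B x _ (by simp [Finset.card_compl]) i.succAbove (Fin.strictMono_succAbove i)
    fun l => by simp [Fin.succAbove_ne]

theorem apply_subtuple_compl_pair (B : Operations V W) (x : Fin (n + 2) → V) (j : Fin (n + 2))
    (l : Fin (n + 1)) :
    B ({j.succAbove l, j}ᶜ : Finset (Fin (n + 2))).card (subtuple x {j.succAbove l, j}ᶜ) =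
      B n (l.removeNth (j.removeNth x)) := by
  refine apply_subtuple B x _ ?_ (j.succAbove ∘ l.succAbove)
    ((Fin.strictMono_succAbove j).comp (Fin.strictMono_succAbove l)) fun i => ?_
  · rw [Finset.card_compl, Finset.card_pair (Fin.succAbove_ne j l)]
    simp
  · simp [Fin.succAbove_ne]

theorem card_compl_add_card_fin (S : Finset (Fin k)) : Sᶜ.card + S.card = k := by
  simp

theorem sum_card_one (F : Finset (Fin k) → N) :
    ∑ S : Finset (Fin k) with S.card = 1, F S = ∑ i, F {i} := by
  rw [Finset.univ_filter_card_eq, Finset.powersetCard_one, Finset.sum_map]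
  rfl

theorem sum_card_compl (F : Finset (Fin (n + 1)) → N) :
    ∑ S : Finset (Fin (n + 1)) with S.card = n, F S = ∑ i, F {i}ᶜ := by
  rw [← sum_card_one fun S => F Sᶜ]
  refine Finset.sum_nbij' compl compl (fun S hS => ?_) (fun S hS => ?_) (by simp) (by simp)
    (by simp)
  all_goals
    have := card_compl_add_card_fin S
    simp only [Finset.mem_filter, Finset.mem_univ, true_and] at hS ⊢
    omega

theorem sum_card_two (F : Finset (Fin k) → N) :
    ∑ S : Finset (Fin k) with S.card = 2, F S =
      ∑ j : Fin k, ∑ i ∈ Finset.univ.filter (· < j), F {i, j} := by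
  rw [Finset.sum_sigma']
  symm
  refine Finset.sum_bij (fun p _ => {p.2, p.1}) ?_ ?_ ?_ fun _ _ => rfl
  · rintro ⟨j, i⟩ h
    have h : i < j := by simpa using h
    simpa using Finset.card_pair h.ne
  · rintro ⟨j, i⟩ h ⟨j', i'⟩ h' e
    have h : i < j := by simpa using h
    have h' : i' < j' := by simpa using h'
    have e : ({i, j} : Finset (Fin k)) = {i', j'} := e
    rw [← Finset.coe_inj, Finset.coe_pair, Finset.coe_pair, Set.pair_eq_pair_iff] at e
    obtain ⟨rfl, rfl⟩ : i = i' ∧ j = j' := by omega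
    rfl
  · intro S hS
    obtain ⟨a, b, hab, rfl⟩ := Finset.card_eq_two.1 (Finset.mem_filter.1 hS).2
    rcases lt_or_gt_of_ne hab with h | h
    · exact ⟨⟨b, a⟩, by simpa using h, rfl⟩
    · exact ⟨⟨a, b⟩, by simpa using h, Finset.pair_comm _ _⟩

end Subsets

section Multilinear

variable {R V W N : Type*} [CommRing R] [AddCommGroup V] [Module R V] [AddCommGroup W]
  [Module R W] [AddCommGroup N] [Module R N] {k n : ℕ}

variable (R) in
/-- The operation `B` is the underlying function of an `R`-multilinear map. -/
def IsMultilinear (B : (Fin k → V) → W) : Prop :=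
  ∃ F : MultilinearMap R (fun _ : Fin k => V) W, ⇑F = B

namespace IsMultilinear

theorem zero : IsMultilinear R (0 : (Fin k → V) → W) := ⟨0, rfl⟩

theorem add {B C : (Fin k → V) → W} (hB : IsMultilinear R B) (hC : IsMultilinear R C) :
    IsMultilinear R (B + C) := by
  obtain ⟨F, rfl⟩ := hB
  obtain ⟨G, rfl⟩ := hC
  exact ⟨F + G, rfl⟩

theorem piSingle {B : (Fin n → V) → W} (hB : IsMultilinear R B) (k : ℕ) :
    IsMultilinear R ((Pi.single n B : Operations V W) k) := by
  obtain rfl | hk := eq_or_ne k n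
  · rwa [Pi.single_eq_same]
  · rw [Pi.single_eq_of_ne hk]
    exact zero

theorem map {B : (Fin k → V) → W} (hB : IsMultilinear R B) (f : W →ₗ[R] N) :
    IsMultilinear R fun x => f (B x) := by
  obtain ⟨F, rfl⟩ := hB
  exact ⟨f.compMultilinearMap F, rfl⟩

theorem unary (D : V →ₗ[R] W) : IsMultilinear R fun x : Fin 1 → V => D (x 0) :=
  ⟨(LinearMap.compMultilinearMap D) (MultilinearMap.ofSubsingleton R V V (0 : Fin 1) .id), rfl⟩

theorem binary (B : V →ₗ[R] V →ₗ[R] W) : IsMultilinear R fun x : Fin 2 → V => B (x 0) (x 1) := by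
  refine ⟨.mk' (fun x : Fin 2 → V => B (x 0) (x 1)) (fun x i u v => ?_) fun x i c u => ?_, rfl⟩ <;>
    fin_cases i <;> simp

theorem cons_add {B : (Fin (n + 1) → V) → W} (hB : IsMultilinear R B) (u v : V)
    (y : Fin n → V) : B (Fin.cons (u + v) y) = B (Fin.cons u y) + B (Fin.cons v y) := by
  obtain ⟨F, rfl⟩ := hB
  exact F.cons_add y u v

theorem map_update_add {B : (Fin k → V) → W} (hB : IsMultilinear R B) (x : Fin k → V) (i : Fin k)
    (u v : V) : B (Function.update x i (u + v)) =
      B (Function.update x i u) + B (Function.update x i v) := by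
  obtain ⟨F, rfl⟩ := hB
  exact F.map_update_add x i u v

theorem map_update_smul {B : (Fin k → V) → W} (hB : IsMultilinear R B) (x : Fin k → V)
    (i : Fin k) (c : R) (u : V) : B (Function.update x i (c • u)) =
      c • B (Function.update x i u) := by
  obtain ⟨F, rfl⟩ := hB
  exact F.map_update_smul x i c u

theorem map_coord_zero {B : (Fin k → V) → W} (hB : IsMultilinear R B) {x : Fin k → V} (i : Fin k)
    (hx : x i = 0) : B x = 0 := by
  obtain ⟨F, rfl⟩ := hB
  exact F.map_coord_zero i hx

theorem cons_zero {B : (Fin (n + 1) → V) → W} (hB : IsMultilinear R B) (y : Fin n → V) :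
    B (Fin.cons 0 y) = 0 :=
  hB.map_coord_zero 0 rfl

end IsMultilinear

end Multilinear

section ShuffleSums

variable {V W N : Type*} [AddCommGroup W] {k : ℕ}

/-- The sum over all shuffles, with the operation `B` inserted into `C`, that occurs in the homotopy
Jacobi identities and in the Maurer–Cartan equation. -/
def shuffleSum (B : Operations V V) (C : Operations V W) (d : Fin k → ℤ) (x : Fin k → V) : W :=
  ∑ S : Finset (Fin k) with S.Nonempty, shuffleSign S d •
    C (Sᶜ.card + 1) (Fin.cons (B S.card (subtuple x S)) (subtuple x Sᶜ))

theorem map_units_smul {F : Type*} [AddCommGroup N] [FunLike F W N] [AddMonoidHomClass F W N]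
    (f : F) (u : ℤˣ) (w : W) : f (u • w) = u • f w := by
  rw [Units.smul_def, map_zsmul, Units.smul_def]

theorem map_shuffleSum {F : Type*} [AddCommGroup N] [FunLike F W N] [AddMonoidHomClass F W N]
    (f : F) (B : Operations V V) (C : Operations V W) (d : Fin k → ℤ) (x : Fin k → V) :
    f (shuffleSum B C d x) = shuffleSum B (fun k x => f (C k x)) d x := by
  simp only [shuffleSum, map_sum, map_units_smul]

theorem shuffleSum_add_right (B : Operations V V) (C D : Operations V W) (d : Fin k → ℤ)
    (x : Fin k → V) : shuffleSum B (C + D) d x = shuffleSum B C d x + shuffleSum B D d x := by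
  simp only [shuffleSum, Pi.add_apply, smul_add, Finset.sum_add_distrib]

variable {R : Type*} [CommRing R] [AddCommGroup V] [Module R V] [Module R W] {n r : ℕ}

theorem shuffleSum_add_left (A B : Operations V V) {C : Operations V W}
    (hC : ∀ r, IsMultilinear R (C r)) (d : Fin k → ℤ) (x : Fin k → V) :
    shuffleSum (A + B) C d x = shuffleSum A C d x + shuffleSum B C d x := by
  simp only [shuffleSum, Pi.add_apply, (hC _).cons_add, smul_add, Finset.sum_add_distrib]

theorem shuffleSum_single (hn : 0 < n) (B : (Fin n → V) → V) {C : Operations V W}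
    (hC : ∀ r, IsMultilinear R (C r)) (d : Fin k → ℤ) (x : Fin k → V) :
    shuffleSum (Pi.single n B) C d x =
      ∑ S : Finset (Fin k) with S.card = n, shuffleSign S d • C (Sᶜ.card + 1)
        (Fin.cons ((Pi.single n B : Operations V V) S.card (subtuple x S)) (subtuple x Sᶜ)) := by
  refine (Finset.sum_subset_zero_on_sdiff (fun S hS => ?_) (fun S hS => ?_) fun _ _ => rfl).symm
  · simp only [Finset.mem_filter, Finset.mem_univ, true_and] at hS ⊢
    exact Finset.card_pos.1 (hS ▸ hn)
  · have hS : S.card ≠ n := fun h => (Finset.mem_sdiff.1 hS).2 (by simp [h])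
    rw [Pi.single_eq_of_ne hS, Pi.zero_apply, (hC _).cons_zero, smul_zero]

theorem shuffleSum_single_of_lt (B : (Fin n → V) → V) {C : Operations V W}
    (hC : ∀ r, IsMultilinear R (C r)) (hk : k < n) (d : Fin k → ℤ) (x : Fin k → V) :
    shuffleSum (Pi.single n B) C d x = 0 := by
  rw [shuffleSum_single (by omega) B hC]
  refine Finset.sum_eq_zero fun S hS => ?_
  have := (Finset.mem_filter.1 hS).2 ▸ card_finset_fin_le S
  omega

theorem shuffleSum_single_single_of_ne (hn : 0 < n) (B : (Fin n → V) → V)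
    {C : (Fin (r + 1) → V) → W} (hC : IsMultilinear R C) (hk : k ≠ n + r) (d : Fin k → ℤ)
    (x : Fin k → V) : shuffleSum (Pi.single n B) (Pi.single (r + 1) C) d x = 0 := by
  rw [shuffleSum_single hn B hC.piSingle]
  refine Finset.sum_eq_zero fun S hS => ?_
  have hS : Sᶜ.card + 1 ≠ r + 1 := by
    have h := card_compl_add_card_fin S
    rw [(Finset.mem_filter.1 hS).2] at h
    omega
  rw [Pi.single_eq_of_ne hS, Pi.zero_apply, smul_zero]

theorem shuffleSum_single_two (B : (Fin 2 → V) → V) {C : Operations V W}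
    (hC : ∀ r, IsMultilinear R (C r)) (d : Fin k → ℤ) (x : Fin k → V) :
    shuffleSum (Pi.single 2 B) C d x = ∑ j : Fin k, ∑ i ∈ Finset.univ.filter (· < j),
      shuffleSign {i, j} d • C (({i, j}ᶜ : Finset (Fin k)).card + 1)
        (Fin.cons (B ![x i, x j]) (subtuple x {i, j}ᶜ)) := by
  rw [shuffleSum_single two_pos B hC, sum_card_two]
  refine Finset.sum_congr rfl fun j _ => Finset.sum_congr rfl fun i hi => ?_
  rw [apply_subtuple_pair (Pi.single 2 B) x (Finset.mem_filter.1 hi).2, Pi.single_eq_same]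

theorem shuffleSum_single_compl (hn : 0 < n) (B : (Fin n → V) → V) {C : Operations V W}
    (hC : ∀ r, IsMultilinear R (C r)) (d : Fin (n + 1) → ℤ) (x : Fin (n + 1) → V) :
    shuffleSum (Pi.single n B) C d x = ∑ i : Fin (n + 1),
      shuffleSign {i}ᶜ d • C 2 ![B (i.removeNth x), x i] := by
  rw [shuffleSum_single hn B hC, sum_card_compl]
  refine Finset.sum_congr rfl fun i _ => ?_
  rw [apply_subtuple_compl_singleton (Pi.single n B), Pi.single_eq_same, compl_compl,
    apply_subtuple_singleton fun k y => C (k + 1) (Fin.cons (B (i.removeNth x)) y)]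
  congr 2
  ext l
  fin_cases l <;> rfl

theorem shuffleSum_single_self (hn : 0 < n) (B : (Fin n → V) → V) {C : Operations V W}
    (hC : ∀ r, IsMultilinear R (C r)) (d : Fin n → ℤ) (x : Fin n → V) :
    shuffleSum (Pi.single n B) C d x = C 1 fun _ => B x := by
  have filter_card : (Finset.univ.filter fun S : Finset (Fin n) => S.card = n) = {Finset.univ} := by
    ext S
    simp [← Finset.card_eq_iff_eq_univ]
  rw [shuffleSum_single hn B hC, filter_card, Finset.sum_singleton,
    apply_subtuple_univ (Pi.single n B), Pi.single_eq_same, Finset.compl_univ, shuffleSign_univ,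
    one_smul, apply_subtuple_empty fun k y => C (k + 1) (Fin.cons (B x) y)]
  congr 1
  ext l
  exact Fin.cases rfl (fun l => l.elim0) l

theorem shuffleSum_binary (B : (Fin 2 → V) → V) {C : (Fin 2 → V) → W} (hC : IsMultilinear R C)
    (d : Fin 3 → ℤ) (x : Fin 3 → V) :
    shuffleSum (Pi.single 2 B) (Pi.single 2 C) d x =
      C ![B ![x 0, x 1], x 2] +
      ((d 1 - 1) * (d 2 - 1)).negOnePow • C ![B ![x 0, x 2], x 1] +
      (((d 0 - 1) * (d 1 - 1)).negOnePow * ((d 0 - 1) * (d 2 - 1)).negOnePow) •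
        C ![B ![x 1, x 2], x 0] := by
  have remove_zero : (0 : Fin 3).removeNth x = ![x 1, x 2] := by ext i; fin_cases i <;> rfl
  have remove_one : (1 : Fin 3).removeNth x = ![x 0, x 2] := by ext i; fin_cases i <;> rfl
  have remove_two : (2 : Fin 3).removeNth x = ![x 0, x 1] := by ext i; fin_cases i <;> rfl
  rw [shuffleSum_single_compl two_pos B hC.piSingle, Fin.sum_univ_three, Pi.single_eq_same,
    remove_zero, remove_one, remove_two, add_comm, ← add_assoc, add_right_comm]
  congr 2
  all_goals simp [shuffleSign, koszulSign, Fin.prod_univ_three]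

end ShuffleSums

section Alternating

variable {R V W L : Type*} [CommRing R] [AddCommGroup W] [Module R W] {n : ℕ}

theorem removeNth_update_succAbove {k : ℕ} (X : Fin (k + 2) → L) (j : Fin (k + 2))
    (l : Fin (k + 1)) (v : L) :
    j.removeNth (Function.update X (j.succAbove l) v) =
      l.insertNth v (l.removeNth (j.removeNth X)) := by
  rw [Fin.insertNth_removeNth]
  ext i
  obtain rfl | h := eq_or_ne i l
  · simp [Fin.removeNth]
  · simp [Fin.removeNth, h]

theorem map_cons_lie_eq_zero [LieRing L] [Module R L] (η : L [⋀^Fin (n + 1)]→ₗ[R] W)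
    {X : Fin (n + 2) → L} {a : Fin (n + 2)} (ha : X a = 0) (j : Fin (n + 2)) (l : Fin (n + 1)) :
    η (Fin.cons ⁅X (j.succAbove l), X j⁆ (l.removeNth (j.removeNth X))) = 0 := by
  obtain rfl | haj := eq_or_ne a j
  · exact η.map_coord_zero 0 (by simp [ha])
  obtain ⟨b, rfl⟩ := Fin.exists_succAbove_eq haj
  obtain rfl | hbl := eq_or_ne b l
  · exact η.map_coord_zero 0 (by simp [ha])
  obtain ⟨c, rfl⟩ := Fin.exists_succAbove_eq hbl
  exact η.map_coord_zero c.succ (by simpa [Fin.removeNth] using ha)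

theorem shuffleSum_single_two_alternating [AddCommGroup V] [LieRing L] [Module R L] [Module ℝ W]
    {S : Type*} [CommRing S] [Module S V] [Module S W]
    (η : L [⋀^Fin (n + 1)]→ₗ[R] W) (B : (Fin 2 → V) → V) {C : Operations V W}
    (hC : ∀ r, IsMultilinear S (C r)) (π : V → L) (hη : ∀ y, C (n + 1) y = η (π ∘ y))
    (hπ : ∀ u v, π (B ![u, v]) = ⁅π u, π v⁆) {d : Fin (n + 2) → ℤ} {x : Fin (n + 2) → V}
    (hd : ∀ i, d i ≠ 0 → π (x i) = 0) :
    shuffleSum (Pi.single 2 B) C d x = -∑ j : Fin (n + 2), ∑ i ∈ Finset.univ.filter (· < j),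
      (-1 : ℝ) ^ (j : ℕ) •
        η (j.removeNth (Function.update (π ∘ x) i ⁅π (x i), π (x j)⁆)) := by
  simp only [shuffleSum_single_two B hC, ← Finset.sum_neg_distrib]
  refine Finset.sum_congr rfl fun j _ => Finset.sum_congr rfl fun i hi => ?_
  have hij : i < j := (Finset.mem_filter.1 hi).2
  obtain ⟨l, rfl⟩ := Fin.exists_succAbove_eq hij.ne
  have hl : (j.succAbove l : ℕ) = l := by
    rw [Fin.succAbove_of_castSucc_lt _ _ ((Fin.succAbove_lt_iff_castSucc_lt j l).1 hij)]
    rfl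
  have hcons : π ∘ (Fin.cons (B ![x (j.succAbove l), x j]) (l.removeNth (j.removeNth x)) :
      Fin (n + 1) → V) = Fin.cons ⁅π (x (j.succAbove l)), π (x j)⁆
        (l.removeNth (j.removeNth (π ∘ x))) := by
    ext a
    refine Fin.cases (hπ _ _) (fun _ => rfl) a
  rw [apply_subtuple_compl_pair fun k y => C (k + 1) (Fin.cons (B ![x (j.succAbove l), x j]) y),
    hη, hcons, shuffleSign, koszulSign_smul_of_degree, ← shuffleSign, shuffleSign_pair_zero hij,
    hl, removeNth_update_succAbove, AlternatingMap.map_insertNth, mul_comm, Units.neg_smul,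
    mul_smul, neg_one_pow_units_smul]
  · rfl
  · intro h
    obtain ⟨a, ha⟩ := Function.ne_iff.1 h
    exact map_cons_lie_eq_zero (X := π ∘ x) η (hd a ha) j l

end Alternating

section Blocks

variable {V W : Type*} [AddCommGroup W] {k : ℕ}

/-- The left-hand side of the Maurer–Cartan equation: the sum over all decompositions of the
arguments into nonempty blocks, to which `φ` is applied, followed by the operations `B`. -/
def blockSum [Module ℝ W] (B : Operations W W) (φ : Operations V W) (d : Fin k → ℤ)
    (x : Fin k → V) : W :=
  ∑ l ∈ Finset.Icc 1 k, ((l.factorial : ℝ)⁻¹) • ∑ p : Fin k → Fin l with Function.Surjective p,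
    koszulSign p d • B l (fun b =>
      φ (Finset.univ.filter (p · = b)).card (subtuple x (Finset.univ.filter (p · = b))))

/-- The contribution of the ordered decompositions into two blocks, the first one being `S`. -/
def twoBlockSum (B : (Fin 2 → W) → W) (φ : Operations V W) (d : Fin k → ℤ) (x : Fin k → V) : W :=
  ∑ S : Finset (Fin k) with S.Nonempty ∧ Sᶜ.Nonempty,
    shuffleSign S d • B ![φ S.card (subtuple x S), φ Sᶜ.card (subtuple x Sᶜ)]

theorem sum_surjective_fin_one (B : (Fin 1 → W) → W) (φ : Operations V W)
    (d : Fin (k + 1) → ℤ) (x : Fin (k + 1) → V) :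
    (∑ p : Fin (k + 1) → Fin 1 with Function.Surjective p, koszulSign p d • B (fun b =>
      φ (Finset.univ.filter (p · = b)).card (subtuple x (Finset.univ.filter (p · = b))))) =
      B fun _ => φ (k + 1) x := by
  have filter_surjective :
      (Finset.univ.filter fun p : Fin (k + 1) → Fin 1 => Function.Surjective p) =
        {fun _ => 0} := by
    ext p
    rw [Subsingleton.elim p fun _ => 0]
    simp only [Finset.mem_filter, Finset.mem_univ, true_and, Finset.mem_singleton, iff_true]
    exact fun b => ⟨0, Subsingleton.elim _ _⟩
  rw [filter_surjective, Finset.sum_singleton, koszulSign_of_monotone monotone_const, one_smul]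
  congr 1
  ext b
  rw [show (Finset.univ.filter fun _ : Fin (k + 1) => (0 : Fin 1) = b) =
    Finset.univ by ext; simp [Subsingleton.elim b 0], apply_subtuple_univ φ]

theorem sum_surjective_fin_two (B : (Fin 2 → W) → W) (φ : Operations V W) (d : Fin k → ℤ)
    (x : Fin k → V) :
    (∑ p : Fin k → Fin 2 with Function.Surjective p, koszulSign p d • B (fun b =>
      φ (Finset.univ.filter (p · = b)).card (subtuple x (Finset.univ.filter (p · = b))))) =
      twoBlockSum B φ d x := by
  have fin_two (a : Fin 2) : (if a = 0 then 0 else 1) = a := by fin_cases a <;> rfl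
  refine Finset.sum_nbij' (fun p => Finset.univ.filter (p · = 0))
    (fun S i => if i ∈ S then 0 else 1)
    (fun p hp => ?_) (fun S hS => ?_) (fun p _ => ?_) (fun S _ => ?_) fun p _ => ?_
  · obtain ⟨i, hi⟩ := (Finset.mem_filter.1 hp).2 0
    obtain ⟨j, hj⟩ := (Finset.mem_filter.1 hp).2 1
    exact Finset.mem_filter.2 ⟨Finset.mem_univ _, ⟨i, by simp [hi]⟩, ⟨j, by simp [hj]⟩⟩
  · obtain ⟨-, ⟨i, hi⟩, j, hj⟩ := Finset.mem_filter.1 hS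
    refine Finset.mem_filter.2 ⟨Finset.mem_univ _, Fin.forall_fin_two.2 ⟨⟨i, by simp [hi]⟩, j, ?_⟩⟩
    simpa using hj
  · ext i
    simp [fin_two]
  · ext i
    simp
  · have koszulSign_eq : koszulSign p d = shuffleSign (Finset.univ.filter (p · = 0)) d := by
      rw [shuffleSign, ← koszulSign_strictMono_comp Fin.val_strictMono p]
      congr 1
      ext i
      rcases Fin.exists_fin_two.1 ⟨p i, rfl⟩ with h | h <;> simp [h]
    rw [koszulSign_eq]
    congr 2
    ext b
    fin_cases b
    · rfl
    · have : (Finset.univ.filter (p · = 1)) = (Finset.univ.filter (p · = 0))ᶜ := by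
        ext i
        rcases Fin.exists_fin_two.1 ⟨p i, rfl⟩ with h | h <;> simp [h]
      exact congrArg (fun T => φ (Finset.card T) (subtuple x T)) this

theorem blockSum_zero [Module ℝ W] (B : Operations W W) (φ : Operations V W)
    (d : Fin 0 → ℤ) (x : Fin 0 → V) : blockSum B φ d x = 0 := rfl

theorem twoBlockSum_one (B : (Fin 2 → W) → W) (φ : Operations V W) (d : Fin 1 → ℤ)
    (x : Fin 1 → V) : twoBlockSum B φ d x = 0 := by
  refine Finset.sum_eq_zero fun S hS => ?_
  obtain ⟨-, ⟨i, hi⟩, j, hj⟩ := Finset.mem_filter.1 hS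
  exact absurd (Subsingleton.elim i j ▸ hi) (Finset.mem_compl.1 hj)

theorem blockSum_succ [Module ℝ W] (D : (Fin 1 → W) → W) (B : (Fin 2 → W) → W)
    (φ : Operations V W) (d : Fin (k + 1) → ℤ) (x : Fin (k + 1) → V) :
    blockSum (Pi.single 1 D + Pi.single 2 B) φ d x =
      D (fun _ => φ (k + 1) x) + (2 : ℝ)⁻¹ • twoBlockSum B φ d x := by
  have eq_one : (Pi.single 1 D + Pi.single 2 B : Operations W W) 1 = D := by simp
  have eq_two : (Pi.single 1 D + Pi.single 2 B : Operations W W) 2 = B := by simp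
  rw [blockSum, ← Finset.add_sum_erase _ _ (Finset.mem_Icc.2 ⟨le_rfl, by omega⟩ : 1 ∈ _), eq_one,
    sum_surjective_fin_one, Nat.factorial_one, Nat.cast_one, inv_one, one_smul]
  congr 1
  obtain rfl | hk := eq_or_ne k 0
  · rw [twoBlockSum_one, smul_zero]
    rfl
  rw [Finset.sum_eq_single_of_mem 2 (by simp; omega), eq_two, sum_surjective_fin_two,
    Nat.factorial_two, Nat.cast_ofNat]
  intro l hl hl2
  rw [Finset.sum_eq_zero fun p _ => ?_, smul_zero]
  rw [Pi.add_apply, Pi.single_eq_of_ne (Finset.ne_of_mem_erase hl), Pi.single_eq_of_ne hl2,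
    add_zero, Pi.zero_apply, smul_zero]

theorem map_twoBlockSum {N F : Type*} [AddCommGroup N] [FunLike F W N]
    [AddMonoidHomClass F W N] (π : F) (B : (Fin 2 → W) → W) (P Q : W → W → N)
    (hB : ∀ y, π (B y) = P (y 0) (y 1) + Q (y 1) (y 0)) (φ : Operations V W)
    (hP : ∀ k, k ≠ 1 → ∀ y w, P (φ k y) w = 0) (hQ : ∀ k, k ≠ 1 → ∀ y w, Q (φ k y) w = 0) {n : ℕ}
    (d : Fin (n + 2) → ℤ) (x : Fin (n + 2) → V) :
    π (twoBlockSum B φ d x) =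
      ∑ i, (shuffleSign {i} d • P (φ 1 fun _ => x i) (φ (n + 1) (i.removeNth x)) +
        shuffleSign {i}ᶜ d • Q (φ 1 fun _ => x i) (φ (n + 1) (i.removeNth x))) := by
  simp only [twoBlockSum, map_sum, map_units_smul, hB, smul_add, Finset.sum_add_distrib,
    Matrix.cons_val_zero, Matrix.cons_val_one]
  congr 1
  · rw [← Finset.sum_subset_zero_on_sdiff (s₁ := Finset.univ.filter fun S => S.card = 1)
      (fun S hS => ?_) (fun S hS => ?_) fun _ _ => rfl, sum_card_one]
    · simp only [apply_subtuple_singleton φ, apply_subtuple_compl_singleton φ]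
    · have hS := (Finset.mem_filter.1 hS).2
      have := card_compl_add_card_fin S
      refine Finset.mem_filter.2 ⟨Finset.mem_univ _, ?_, ?_⟩ <;> rw [← Finset.card_pos] <;> omega
    · rw [hP _ fun h => (Finset.mem_sdiff.1 hS).2 (by simp [h]), smul_zero]
  · rw [← Finset.sum_subset_zero_on_sdiff (s₁ := Finset.univ.filter fun S => S.card = n + 1)
      (fun S hS => ?_) (fun S hS => ?_) fun _ _ => rfl, sum_card_compl]
    · refine Finset.sum_congr rfl fun i _ => ?_
      rw [compl_compl, apply_subtuple_singleton φ, apply_subtuple_compl_singleton φ]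
    · have hS := (Finset.mem_filter.1 hS).2
      have := card_compl_add_card_fin S
      refine Finset.mem_filter.2 ⟨Finset.mem_univ _, ?_, ?_⟩ <;> rw [← Finset.card_pos] <;> omega
    · have := card_compl_add_card_fin S
      rw [hQ _ fun h => (Finset.mem_sdiff.1 hS).2 (by simp; omega), smul_zero]

end Blocks

section Symmetry

variable {V W : Type*} [AddCommGroup W]

theorem koszulSign_swap (d : Fin 2 → ℤ) :
    koszulSign (Equiv.swap (0 : Fin 2) 1) d = ((d 0 - 1) * (d 1 - 1)).negOnePow := by
  simp [koszulSign]

theorem single_two_comp_perm {k : ℕ} (B : V → V → W) (d : Fin k → ℤ) (x : Fin k → V)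
    (h : ∀ i j : Fin k, B (x j) (x i) = ((d i - 1) * (d j - 1)).negOnePow • B (x i) (x j))
    (σ : Equiv.Perm (Fin k)) :
    (Pi.single 2 fun y => B (y 0) (y 1) : Operations V W) k (x ∘ σ.symm) =
      koszulSign σ d • (Pi.single 2 fun y => B (y 0) (y 1) : Operations V W) k x := by
  obtain rfl | hk := eq_or_ne k 2
  · rw [Pi.single_eq_same]
    obtain rfl | rfl : σ = 1 ∨ σ = Equiv.swap 0 1 := by decide +revert
    · rw [show koszulSign (1 : Equiv.Perm (Fin 2)) d = 1 from koszulSign_of_monotone monotone_id d,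
        one_smul]
      rfl
    · rw [koszulSign_swap, ← h 0 1]
      rfl
  · rw [Pi.single_eq_of_ne hk, Pi.zero_apply, Pi.zero_apply, smul_zero]

end Symmetry

section DgLie

variable {R V : Type*} [CommRing R] [AddCommGroup V] [Module R V] {k : ℕ} {d : Fin k → ℤ}
  {x : Fin k → V}

/-- The graded antisymmetry of a bracket, on shifted arguments, for elements `u`, `v` of degrees
`a`, `b`. -/
def SymmetryIdentity (B : V → V → V) (a b : ℤ) (u v : V) : Prop :=
  B v u = ((a - 1) * (b - 1)).negOnePow • B u v

/-- The Leibniz rule for a differential and a bracket, on shifted arguments, for elements `u`, `v`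
of degrees `a`, `b`. -/
def LeibnizIdentity (D : V → V) (B : V → V → V) (a b : ℤ) (u v : V) : Prop :=
  B (D u) v + ((a - 1) * (b - 1)).negOnePow • B (D v) u + D (B u v) = 0

/-- The Jacobi identity, on shifted arguments, for elements `u`, `v`, `w` of degrees `a`, `b`,
`c`. -/
def JacobiIdentity (B : V → V → V) (a b c : ℤ) (u v w : V) : Prop :=
  B (B u v) w + ((b - 1) * (c - 1)).negOnePow • B (B u w) v +
    (((a - 1) * (b - 1)).negOnePow * ((a - 1) * (c - 1)).negOnePow) • B (B v w) u = 0

theorem shuffleSum_bracket_bracket (B : V →ₗ[R] V →ₗ[R] V)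
    (hB : ∀ i j l, JacobiIdentity (fun u v => B u v) (d i) (d j) (d l) (x i) (x j) (x l)) :
    shuffleSum (Pi.single 2 fun y => B (y 0) (y 1)) (Pi.single 2 fun y => B (y 0) (y 1)) d x =
      0 := by
  obtain rfl | hk := eq_or_ne k 3
  · rw [shuffleSum_binary _ (.binary B)]
    exact hB 0 1 2
  · exact shuffleSum_single_single_of_ne two_pos _ (.binary B) hk d x

/-- The operations of a dg Lie algebra with differential `D` and bracket `B`, on shifted
arguments. -/
def dgLieBrackets (D : V →ₗ[R] V) (B : V →ₗ[R] V →ₗ[R] V) : Operations V V :=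
  (Pi.single 1 fun y => D (y 0) : Operations V V) +
    (Pi.single 2 fun y => B (y 0) (y 1) : Operations V V)

variable (D : V →ₗ[R] V) (B : V →ₗ[R] V →ₗ[R] V)

theorem isMultilinear_dgLieBrackets (k : ℕ) : IsMultilinear R (dgLieBrackets D B k) :=
  ((IsMultilinear.unary D).piSingle k).add ((IsMultilinear.binary B).piSingle k)

theorem dgLieBrackets_of_three_le (hk : 3 ≤ k) : dgLieBrackets D B k = 0 := by
  rw [dgLieBrackets, Pi.add_apply, Pi.single_eq_of_ne (by omega), Pi.single_eq_of_ne (by omega),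
    add_zero]

theorem dgLieBrackets_comp_perm
    (hB : ∀ i j, SymmetryIdentity (fun u v => B u v) (d i) (d j) (x i) (x j))
    (σ : Equiv.Perm (Fin k)) :
    dgLieBrackets D B k (x ∘ σ.symm) = koszulSign σ d • dgLieBrackets D B k x := by
  refine (congrArg₂ (· + ·) ?_ (single_two_comp_perm (fun u v => B u v) d x hB σ)).trans
    (smul_add _ _ _).symm
  obtain rfl | hk := eq_or_ne k 1
  · rw [Subsingleton.elim σ 1, show koszulSign (1 : Equiv.Perm (Fin 1)) d = 1 from
      koszulSign_of_monotone monotone_id d, one_smul]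
    rfl
  · rw [Pi.single_eq_of_ne hk, Pi.zero_apply, Pi.zero_apply, smul_zero]

theorem shuffleSum_differential_bracket
    (hDB : ∀ i j, LeibnizIdentity D (fun u v => B u v) (d i) (d j) (x i) (x j)) :
    shuffleSum (Pi.single 1 fun y => D (y 0)) (Pi.single 2 fun y => B (y 0) (y 1)) d x +
      shuffleSum (Pi.single 2 fun y => B (y 0) (y 1)) (Pi.single 1 fun y => D (y 0)) d x = 0 := by
  obtain rfl | hk := eq_or_ne k 2
  · have remove_zero : (0 : Fin 2).removeNth x = fun _ => x 1 := by ext i; fin_cases i; rfl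
    have remove_one : (1 : Fin 2).removeNth x = fun _ => x 0 := by ext i; fin_cases i; rfl
    rw [shuffleSum_single_compl one_pos _ (IsMultilinear.binary B).piSingle,
      shuffleSum_single_self two_pos _ (IsMultilinear.unary D).piSingle, Fin.sum_univ_two,
      Pi.single_eq_same, Pi.single_eq_same, remove_zero, remove_one, add_comm (_ • _)]
    refine Eq.trans ?_ (hDB 0 1)
    simp [shuffleSign, koszulSign]
  · rw [shuffleSum_single_single_of_ne one_pos _ (.binary B) hk,
      shuffleSum_single_single_of_ne two_pos _ (.unary D) hk, add_zero]

theorem shuffleSum_dgLieBrackets (hD : ∀ v, D (D v) = 0)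
    (hDB : ∀ i j, LeibnizIdentity D (fun u v => B u v) (d i) (d j) (x i) (x j))
    (hB : ∀ i j l, JacobiIdentity (fun u v => B u v) (d i) (d j) (d l) (x i) (x j) (x l)) :
    shuffleSum (dgLieBrackets D B) (dgLieBrackets D B) d x = 0 := by
  have differential_sq :
      shuffleSum (Pi.single 1 fun y => D (y 0)) (Pi.single 1 fun y => D (y 0)) d x = 0 := by
    obtain rfl | hk := eq_or_ne k 1
    · rw [shuffleSum_single_self one_pos _ (IsMultilinear.unary D).piSingle, Pi.single_eq_same, hD]
    · exact shuffleSum_single_single_of_ne one_pos _ (.unary D) hk d x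
  refine (shuffleSum_add_left _ _ (isMultilinear_dgLieBrackets D B) d x).trans ?_
  rw [dgLieBrackets, shuffleSum_add_right, shuffleSum_add_right, differential_sq,
    shuffleSum_bracket_bracket B hB, zero_add, add_zero, shuffleSum_differential_bracket D B hDB]

end DgLie

section Internal

variable {ι R M : Type*} [DecidableEq ι] [CommRing R] [AddCommGroup M] [Module R M]

theorem isInternal_of_projections (D : ι → Submodule R M) (π : ι → M →+ M)
    (hmem : ∀ i x, π i x ∈ D i) (hid : ∀ i, ∀ x ∈ D i, π i x = x)
    (hne : ∀ i j, i ≠ j → ∀ x ∈ D j, π i x = 0) (s : Finset ι) (hs : ∀ x, ∑ i ∈ s, π i x = x) :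
    DirectSum.IsInternal D := by
  classical
  constructor
  · have project (x : DirectSum ι fun i => D i) (i : ι) :
        π i (DirectSum.coeAddMonoidHom D x) = x i := by
      induction x using DirectSum.induction_on with
      | zero => simp
      | of j y =>
        rw [DirectSum.coeAddMonoidHom_of]
        obtain rfl | h := eq_or_ne i j
        · rw [hid i y y.2, DirectSum.of_eq_same]
        · rw [hne i j h y y.2, DirectSum.of_eq_of_ne _ _ _ h, Submodule.coe_zero]
      | add x y ihx ihy => rw [map_add, map_add, ihx, ihy, DirectSum.add_apply, Submodule.coe_add]
    refine (injective_iff_map_eq_zero _).2 fun x hx => ?_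
    ext i
    rw [← project, hx, map_zero]
    rfl
  · intro x
    refine ⟨∑ i ∈ s, DirectSum.of (fun i => D i) i ⟨π i x, hmem i x⟩, ?_⟩
    simp only [map_sum, DirectSum.coeAddMonoidHom_of, hs]

end Internal

section Semidirect

variable {R : Type*} [CommRing R] [Algebra ℝ R] {n : ℕ} {d e : ℤ}

/-- The binary operation `(X, f), (Y, h) ↦ ([X, Y], X h ± Y f)` on pairs of derivations and
functions, where functions have a degree of the parity of `n + 1`. -/
def semidirectBracket (n : ℕ) :
    Derivation ℝ R R × R →ₗ[ℝ] Derivation ℝ R R × R →ₗ[ℝ] Derivation ℝ R R × R :=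
  LinearMap.mk₂ ℝ (fun x y => (⁅x.1, y.1⁆, x.1 y.2 + (-1 : ℝ) ^ n • y.1 x.2))
    (fun x y z => Prod.ext (add_lie _ _ _) (by simp; abel))
    (fun c x y => Prod.ext (smul_lie _ _ _) (by simp [smul_comm c]))
    (fun x y z => Prod.ext (lie_add _ _ _) (by simp; abel))
    (fun c x y => Prod.ext (lie_smul _ _ _) (by simp [smul_comm c]))

/-- The degree `d` is admissible for the pair `x` of a derivation and a function if derivations have
degree zero and functions have a degree of the parity of `n + 1`. -/
structure HasDegree (n : ℕ) (d : ℤ) (x : Derivation ℝ R R × R) : Prop where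
  fst_eq_zero : d ≠ 0 → x.1 = 0
  negOnePow_eq : x.2 ≠ 0 → (d - 1).negOnePow = (-1) ^ n

theorem negOnePow_shifted_zero_mul (e : ℤ) :
    ((0 - 1) * (e - 1) : ℤ).negOnePow = (e - 1).negOnePow := by
  rw [zero_sub, neg_one_mul, Int.negOnePow_neg]

theorem negOnePow_mul_shifted_zero (d : ℤ) :
    ((d - 1) * (0 - 1) : ℤ).negOnePow = (d - 1).negOnePow := by
  rw [mul_comm, negOnePow_shifted_zero_mul]

theorem negOnePow_shifted_zero : (0 - 1 : ℤ).negOnePow = -1 := rfl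

theorem HasDegree.smul_apply {x y : Derivation ℝ R R × R} (hx : HasDegree n d x)
    (hy : HasDegree n e y) :
    ((d - 1) * (e - 1)).negOnePow • x.1 y.2 = (-1 : ℤˣ) ^ n • x.1 y.2 := by
  obtain rfl | hd := eq_or_ne d 0
  · obtain h | h := eq_or_ne y.2 0
    · simp only [h, map_zero, smul_zero]
    · rw [negOnePow_shifted_zero_mul, hy.negOnePow_eq h]
  · simp only [hx.fst_eq_zero hd, Derivation.zero_apply, smul_zero]

theorem HasDegree.smul_lie {x y : Derivation ℝ R R × R} (hx : HasDegree n d x)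
    (hy : HasDegree n e y) : ((d - 1) * (e - 1)).negOnePow • ⁅x.1, y.1⁆ = -⁅x.1, y.1⁆ := by
  obtain rfl | hd := eq_or_ne d 0
  · obtain rfl | he := eq_or_ne e 0
    · rw [negOnePow_shifted_zero_mul, negOnePow_shifted_zero, Units.neg_smul, one_smul]
    · rw [hy.fst_eq_zero he, lie_zero, smul_zero, neg_zero]
  · rw [hx.fst_eq_zero hd, zero_lie, smul_zero, neg_zero]

theorem semidirectBracket_swap {x y : Derivation ℝ R R × R} (hx : HasDegree n d x)
    (hy : HasDegree n e y) :
    semidirectBracket n y x = ((d - 1) * (e - 1)).negOnePow • semidirectBracket n x y := by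
  refine Prod.ext ((lie_skew _ _).symm.trans (hx.smul_lie hy).symm) ?_
  change y.1 x.2 + (-1 : ℝ) ^ n • x.1 y.2 =
    ((d - 1) * (e - 1)).negOnePow • (x.1 y.2 + (-1 : ℝ) ^ n • y.1 x.2)
  rw [← neg_one_pow_units_smul, ← neg_one_pow_units_smul, smul_add, hx.smul_apply hy, smul_comm,
    mul_comm, hy.smul_apply hx, smul_smul, Int.units_mul_self, one_smul, add_comm]

theorem graded_lie_jacobi {L : Type*} [LieRing L] {X Y Z : L} {d₀ d₁ d₂ : ℤ}
    (hX : d₀ ≠ 0 → X = 0) (hY : d₁ ≠ 0 → Y = 0) (hZ : d₂ ≠ 0 → Z = 0) :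
    ⁅⁅X, Y⁆, Z⁆ + ((d₁ - 1) * (d₂ - 1)).negOnePow • ⁅⁅X, Z⁆, Y⁆ +
      (((d₀ - 1) * (d₁ - 1)).negOnePow * ((d₀ - 1) * (d₂ - 1)).negOnePow) • ⁅⁅Y, Z⁆, X⁆ = 0 := by
  obtain rfl | h₀ := eq_or_ne d₀ 0
  swap
  · simp [hX h₀]
  obtain rfl | h₁ := eq_or_ne d₁ 0
  swap
  · simp [hY h₁]
  obtain rfl | h₂ := eq_or_ne d₂ 0
  swap
  · simp [hZ h₂]
  rw [negOnePow_shifted_zero_mul, negOnePow_shifted_zero, Int.units_mul_self, one_smul,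
    Units.neg_smul, one_smul, lie_lie X Y Z, ← lie_skew Y ⁅X, Z⁆, ← lie_skew X ⁅Y, Z⁆]
  abel

theorem smul_commutator_add {X Y : Derivation ℝ R R} {w : R} {a b c : ℤˣ}
    (h : X ≠ 0 → Y ≠ 0 → w ≠ 0 → a = c ∧ b = -c) :
    c • ⁅X, Y⁆ w + a • Y (X w) + b • X (Y w) = 0 := by
  obtain rfl | hX := eq_or_ne X 0
  · simp
  obtain rfl | hY := eq_or_ne Y 0
  · simp
  obtain rfl | hw := eq_or_ne w 0
  · simp
  obtain ⟨rfl, rfl⟩ := h hX hY hw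
  rw [Derivation.commutator_apply, smul_sub, Units.neg_smul]
  abel

theorem graded_action_jacobi {x y z : Derivation ℝ R R × R} {d₀ d₁ d₂ : ℤ}
    (hx : HasDegree n d₀ x) (hy : HasDegree n d₁ y) (hz : HasDegree n d₂ z) :
    ⁅x.1, y.1⁆ z.2 + (-1 : ℤˣ) ^ n • z.1 (x.1 y.2 + (-1 : ℤˣ) ^ n • y.1 x.2) +
      ((d₁ - 1) * (d₂ - 1)).negOnePow •
        (⁅x.1, z.1⁆ y.2 + (-1 : ℤˣ) ^ n • y.1 (x.1 z.2 + (-1 : ℤˣ) ^ n • z.1 x.2)) +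
      (((d₀ - 1) * (d₁ - 1)).negOnePow * ((d₀ - 1) * (d₂ - 1)).negOnePow) •
        (⁅y.1, z.1⁆ x.2 + (-1 : ℤˣ) ^ n • x.1 (y.1 z.2 + (-1 : ℤˣ) ^ n • z.1 y.2)) = 0 := by
  have degree_zero {d : ℤ} {u : Derivation ℝ R R × R} (hu : HasDegree n d u) (h : u.1 ≠ 0) :
      d = 0 := not_imp_comm.1 hu.fst_eq_zero h
  have act_z := smul_commutator_add (X := x.1) (Y := y.1) (w := z.2) (c := 1)
    (a := ((d₁ - 1) * (d₂ - 1)).negOnePow * (-1) ^ n)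
    (b := ((d₀ - 1) * (d₁ - 1)).negOnePow * ((d₀ - 1) * (d₂ - 1)).negOnePow * (-1) ^ n)
    fun hX hY hw => by
      rw [degree_zero hx hX, degree_zero hy hY, negOnePow_shifted_zero_mul,
        negOnePow_shifted_zero_mul, negOnePow_shifted_zero, hz.negOnePow_eq hw, mul_assoc,
        Int.units_mul_self]
      exact ⟨rfl, rfl⟩
  have act_y := smul_commutator_add (X := x.1) (Y := z.1) (w := y.2) (a := (-1) ^ n)
    (b := ((d₀ - 1) * (d₁ - 1)).negOnePow * ((d₀ - 1) * (d₂ - 1)).negOnePow)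
    (c := ((d₁ - 1) * (d₂ - 1)).negOnePow) fun hX hZ hv => by
      rw [degree_zero hx hX, degree_zero hz hZ, negOnePow_shifted_zero_mul,
        negOnePow_mul_shifted_zero, negOnePow_shifted_zero_mul, negOnePow_shifted_zero,
        hy.negOnePow_eq hv, mul_neg_one]
      exact ⟨rfl, rfl⟩
  have act_x := smul_commutator_add (X := y.1) (Y := z.1) (w := x.2) (a := 1)
    (b := ((d₁ - 1) * (d₂ - 1)).negOnePow)
    (c := ((d₀ - 1) * (d₁ - 1)).negOnePow * ((d₀ - 1) * (d₂ - 1)).negOnePow) fun hY hZ hu => by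
      rw [degree_zero hy hY, degree_zero hz hZ, negOnePow_mul_shifted_zero,
        negOnePow_mul_shifted_zero, negOnePow_shifted_zero, hx.negOnePow_eq hu,
        Int.units_mul_self]
      exact ⟨rfl, rfl⟩
  have sq (w : R) : (-1 : ℤˣ) ^ n • (-1 : ℤˣ) ^ n • w = w := by
    rw [smul_smul, Int.units_mul_self, one_smul]
  simp only [mul_smul, one_smul] at act_x act_y act_z
  simp only [map_add, map_units_smul, smul_add, mul_smul, sq]
  linear_combination (norm := abel) act_z + act_y + act_x

theorem semidirectBracket_jacobi {x y z : Derivation ℝ R R × R} {d₀ d₁ d₂ : ℤ}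
    (hx : HasDegree n d₀ x) (hy : HasDegree n d₁ y) (hz : HasDegree n d₂ z) :
    JacobiIdentity (fun u v => semidirectBracket n u v) d₀ d₁ d₂ x y z := by
  refine Prod.ext (graded_lie_jacobi hx.fst_eq_zero hy.fst_eq_zero hz.fst_eq_zero) ?_
  have := graded_action_jacobi hx hy hz
  simp only [neg_one_pow_units_smul] at this
  exact this

theorem semidirectBracket_smul_right (n : ℕ) (a : R) (x y : Derivation ℝ R R × R) :
    semidirectBracket n x (a • y) = a • semidirectBracket n x y + x.1 a • y := by
  refine Prod.ext ?_ ?_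
  · ext b
    simp [semidirectBracket, Derivation.commutator_apply]
  · simp only [semidirectBracket, LinearMap.mk₂_apply, Prod.smul_fst, Prod.smul_snd,
      Derivation.smul_apply, Derivation.leibniz, smul_eq_mul, Prod.snd_add, mul_add,
      mul_smul_comm]
    ring

theorem fst_semidirectBracket_eq_zero {x y : Derivation ℝ R R × R} (hx : d ≠ 0 → x.1 = 0)
    (hy : e ≠ 0 → y.1 = 0) (h : d + e ≠ 0) : (semidirectBracket n x y).1 = 0 := by
  change ⁅x.1, y.1⁆ = 0
  obtain hd | he : d ≠ 0 ∨ e ≠ 0 := by omega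
  · rw [hx hd, zero_lie]
  · rw [hy he, lie_zero]

theorem apply_eq_zero_of_degree {X : Derivation ℝ R R} {f : R} {r : ℤ} (hX : d ≠ 0 → X = 0)
    (hf : e ≠ r → f = 0) (h : d + e ≠ r) : X f = 0 := by
  obtain hd | he : d ≠ 0 ∨ e ≠ r := by omega
  · rw [hX hd, Derivation.zero_apply]
  · rw [hf he, map_zero]

theorem snd_semidirectBracket_eq_zero {x y : Derivation ℝ R R × R} {r : ℤ} (hx : d ≠ 0 → x.1 = 0)
    (hy : e ≠ 0 → y.1 = 0) (hx' : d ≠ r → x.2 = 0) (hy' : e ≠ r → y.2 = 0) (h : d + e ≠ r) :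
    (semidirectBracket n x y).2 = 0 := by
  change x.1 y.2 + (-1 : ℝ) ^ n • y.1 x.2 = 0
  rw [apply_eq_zero_of_degree hx hy' h, apply_eq_zero_of_degree hy hx' (by rwa [add_comm]),
    smul_zero, add_zero]

theorem snd_semidirectBracket_of_snd_eq_zero {x y : Derivation ℝ R R × R} (hx : x.2 = 0)
    (hy : y.2 = 0) : (semidirectBracket n x y).2 = 0 := by
  change x.1 y.2 + (-1 : ℝ) ^ n • y.1 x.2 = 0
  rw [hx, hy, map_zero, map_zero, smul_zero, add_zero]

end Semidirect

theorem alternatingMap_comp_perm {R L N : Type*} [Semiring R] [AddCommGroup L] [Module R L]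
    [AddCommGroup N] [Module R N] {k : ℕ} (η : L [⋀^Fin k]→ₗ[R] N) {d : Fin k → ℤ} {X : Fin k → L}
    (hd : ∀ i, d i ≠ 0 → X i = 0) (σ : Equiv.Perm (Fin k)) :
    η (X ∘ σ.symm) = koszulSign σ d • η X := by
  rw [koszulSign_smul_of_degree, koszulSign_perm_zero, ← Equiv.Perm.sign_symm]
  · exact η.map_perm X σ.symm
  · intro h
    obtain ⟨i, hi⟩ := Function.ne_iff.1 h
    exact η.map_coord_zero i (hd i hi)

section FormBracket

variable {R : Type*} [CommRing R] [Algebra ℝ R] {k m : ℕ}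

/-- The global formula for the exterior derivative of a form `η` on the derivations of an arbitrary
algebra, in the shape of `exteriorDeriv`. -/
def derivationDeriv (η : Derivation ℝ R R [⋀^Fin k]→ₗ[R] R) (X : Fin (k + 1) → Derivation ℝ R R) :
    R :=
  (∑ i : Fin (k + 1), (-1 : ℝ) ^ (i : ℕ) • X i (η (i.removeNth X))) +
  ∑ j : Fin (k + 1), ∑ i ∈ Finset.univ.filter (· < j),
    (-1 : ℝ) ^ (j : ℕ) • η (j.removeNth (Function.update X i ⁅X i, X j⁆))

theorem derivationDeriv_zero (X : Fin (k + 1) → Derivation ℝ R R) :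
    derivationDeriv (0 : Derivation ℝ R R [⋀^Fin k]→ₗ[R] R) X = 0 := by
  simp [derivationDeriv]

/-- The operation `(X_1, f_1), …, (X_k, f_k) ↦ (0, η (X_1, …, X_k))`. -/
def formBracket (η : Derivation ℝ R R [⋀^Fin k]→ₗ[R] R) (x : Fin k → Derivation ℝ R R × R) :
    Derivation ℝ R R × R :=
  (0, η fun i => (x i).1)

variable (η : Derivation ℝ R R [⋀^Fin k]→ₗ[R] R)

theorem isMultilinear_formBracket : IsMultilinear R (formBracket η) :=
  ⟨(LinearMap.inr R (Derivation ℝ R R) R).compMultilinearMap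
    (η.toMultilinearMap.compLinearMap fun _ => LinearMap.fst R (Derivation ℝ R R) R), rfl⟩

theorem isMultilinear_semidirectBracket (n : ℕ) :
    IsMultilinear ℝ fun x : Fin 2 → Derivation ℝ R R × R => semidirectBracket n (x 0) (x 1) :=
  IsMultilinear.binary (V := Derivation ℝ R R × R) (W := Derivation ℝ R R × R)
    (semidirectBracket n)

theorem IsMultilinear.restrictScalars {V W : Type*} [AddCommGroup V] [Module ℝ V] [Module R V]
    [IsScalarTower ℝ R V] [AddCommGroup W] [Module ℝ W] [Module R W] [IsScalarTower ℝ R W]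
    {B : (Fin k → V) → W} (hB : IsMultilinear R B) : IsMultilinear ℝ B := by
  obtain ⟨F, rfl⟩ := hB
  exact ⟨F.restrictScalars ℝ, rfl⟩

theorem formBracket_eq_zero {x : Fin k → Derivation ℝ R R × R} {i : Fin k} (hi : (x i).1 = 0) :
    formBracket η x = 0 :=
  Prod.ext rfl (η.map_coord_zero i hi)

theorem single_formBracket (r : ℕ) (x : Fin r → Derivation ℝ R R × R) :
    (Pi.single k (formBracket η) : Operations _ _) r x = LinearMap.inr R (Derivation ℝ R R) R
      ((Pi.single k fun x => η fun i => (x i).1 : Operations (Derivation ℝ R R × R) R) r x) := by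
  obtain rfl | h := eq_or_ne r k
  · simp only [Pi.single_eq_same]
    rfl
  · simp only [Pi.single_eq_of_ne h, Pi.zero_apply, map_zero]

theorem fst_single_formBracket (r : ℕ) (x : Fin r → Derivation ℝ R R × R) :
    ((Pi.single k (formBracket η) : Operations _ _) r x).1 = 0 := by
  rw [single_formBracket]
  rfl

theorem single_formBracket_cons (r : ℕ) {v : Derivation ℝ R R × R} (hv : v.1 = 0)
    (y : Fin r → Derivation ℝ R R × R) :
    (Pi.single k (formBracket η) : Operations _ _) (r + 1) (Fin.cons v y) = 0 := by
  obtain rfl | h := eq_or_ne k (r + 1)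
  · rw [Pi.single_eq_same]
    exact formBracket_eq_zero η (i := 0) hv
  · rw [Pi.single_eq_of_ne h.symm, Pi.zero_apply]

theorem shuffleSum_formBracket_formBracket {l : ℕ} (d : Fin l → ℤ)
    (x : Fin l → Derivation ℝ R R × R) :
    shuffleSum (Pi.single k (formBracket η)) (Pi.single k (formBracket η)) d x = 0 :=
  Finset.sum_eq_zero fun S _ => by
    rw [single_formBracket_cons η _ (by rw [single_formBracket]; rfl), smul_zero]

theorem shuffleSum_semidirectBracket_formBracket (η : Derivation ℝ R R [⋀^Fin (m + 1)]→ₗ[R] R)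
    (n : ℕ) {d : Fin (m + 2) → ℤ} {x : Fin (m + 2) → Derivation ℝ R R × R}
    (hx : ∀ i, HasDegree n (d i) (x i)) :
    shuffleSum (Pi.single 2 fun y => semidirectBracket n (y 0) (y 1))
        (Pi.single (m + 1) (formBracket η)) d x =
      LinearMap.inr R (Derivation ℝ R R) R
        (-∑ j : Fin (m + 2), ∑ i ∈ Finset.univ.filter (· < j), (-1 : ℝ) ^ (j : ℕ) •
          η (j.removeNth (Function.update (fun a => (x a).1) i ⁅(x i).1, (x j).1⁆))) := by
  have hη : IsMultilinear R fun x : Fin (m + 1) → Derivation ℝ R R × R => η fun i => (x i).1 :=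
    (isMultilinear_formBracket η).map (LinearMap.snd R (Derivation ℝ R R) R)
  rw [show (Pi.single (m + 1) (formBracket η) : Operations _ _) = _ from
      funext fun r => funext (single_formBracket η r), ← map_shuffleSum,
    shuffleSum_single_two_alternating η _ hη.piSingle Prod.fst
      (fun y => by rw [Pi.single_eq_same]; rfl) (fun u v => rfl) fun i => (hx i).fst_eq_zero]
  rfl

theorem semidirectBracket_inr (n : ℕ) (f : R) (x : Derivation ℝ R R × R) :
    semidirectBracket n (LinearMap.inr R (Derivation ℝ R R) R f) x =
      LinearMap.inr R (Derivation ℝ R R) R ((-1 : ℤˣ) ^ n • x.1 f) := by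
  rw [neg_one_pow_units_smul]
  exact Prod.ext (zero_lie x.1) (zero_add _)

theorem shuffleSum_formBracket_semidirectBracket (η : Derivation ℝ R R [⋀^Fin (m + 1)]→ₗ[R] R)
    {d : Fin (m + 2) → ℤ} {x : Fin (m + 2) → Derivation ℝ R R × R}
    (hx : ∀ i, HasDegree m (d i) (x i)) :
    shuffleSum (Pi.single (m + 1) (formBracket η))
        (Pi.single 2 fun y => semidirectBracket m (y 0) (y 1)) d x =
      LinearMap.inr R (Derivation ℝ R R) R
        (-∑ i : Fin (m + 2), (-1 : ℝ) ^ (i : ℕ) • (x i).1 (η (i.removeNth fun a => (x a).1))) := by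
  rw [shuffleSum_single_compl m.succ_pos _ (isMultilinear_semidirectBracket m).piSingle,
    ← Finset.sum_neg_distrib, map_sum]
  refine Finset.sum_congr rfl fun i _ => ?_
  have vanish (h : d ≠ 0) : (x i).1 (η (i.removeNth fun a => (x a).1)) = 0 := by
    obtain ⟨a, ha⟩ := Function.ne_iff.1 h
    obtain rfl | hai := eq_or_ne a i
    · rw [(hx a).fst_eq_zero ha, Derivation.zero_apply]
    · obtain ⟨l, rfl⟩ := Fin.exists_succAbove_eq hai
      rw [η.map_coord_zero l ((hx _).fst_eq_zero ha), map_zero]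
  rw [Pi.single_eq_same]
  change _ • semidirectBracket m (LinearMap.inr R (Derivation ℝ R R) R
    (η (i.removeNth fun a => (x a).1))) (x i) = _
  rw [semidirectBracket_inr, ← map_units_smul, shuffleSign,
    koszulSign_smul_of_degree _ fun h => by rw [vanish h, smul_zero], ← shuffleSign,
    shuffleSign_compl_singleton_zero, smul_smul, ← pow_add, ← neg_one_pow_units_smul,
    ← Units.neg_smul]
  congr 2
  rw [show m + 1 + (i : ℕ) + m = 2 * m + (i + 1) by ring, pow_add, pow_mul, Int.units_sq, one_pow,
    one_mul, pow_succ, mul_neg_one]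

theorem shuffleSum_mixed_eq_zero (η : Derivation ℝ R R [⋀^Fin (m + 1)]→ₗ[R] R)
    (hη : ∀ X, derivationDeriv η X = 0) {l : ℕ} {d : Fin l → ℤ} {x : Fin l → Derivation ℝ R R × R}
    (hx : ∀ i, HasDegree m (d i) (x i)) :
    shuffleSum (Pi.single 2 fun y => semidirectBracket m (y 0) (y 1))
        (Pi.single (m + 1) (formBracket η)) d x +
      shuffleSum (Pi.single (m + 1) (formBracket η))
        (Pi.single 2 fun y => semidirectBracket m (y 0) (y 1)) d x = 0 := by
  obtain rfl | hl := eq_or_ne l (m + 2)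
  · have := hη fun i => (x i).1
    rw [derivationDeriv, add_comm] at this
    rw [shuffleSum_semidirectBracket_formBracket η m hx,
      shuffleSum_formBracket_semidirectBracket η hx, ← map_add, ← neg_add, this, neg_zero, map_zero]
  · rw [shuffleSum_single_single_of_ne two_pos _ (isMultilinear_formBracket η) (by omega),
      shuffleSum_single_single_of_ne m.succ_pos _ (isMultilinear_semidirectBracket m) (by omega),
      add_zero]

/-- The brackets of `At_m(η)` on `Der R ⊕ R[m]`: the binary semidirect product bracket together with
the bracket of arity `m + 1` given by `η`. -/
def twistedBrackets (η : Derivation ℝ R R [⋀^Fin (m + 1)]→ₗ[R] R) :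
    Operations (Derivation ℝ R R × R) (Derivation ℝ R R × R) :=
  (Pi.single 2 fun y => semidirectBracket m (y 0) (y 1) : Operations _ _) +
    (Pi.single (m + 1) (formBracket η) : Operations _ _)

theorem shuffleSum_semidirectBracket (n : ℕ) {l : ℕ} {d : Fin l → ℤ}
    {x : Fin l → Derivation ℝ R R × R} (hx : ∀ i, HasDegree n (d i) (x i)) :
    shuffleSum (Pi.single 2 fun y => semidirectBracket n (y 0) (y 1))
      (Pi.single 2 fun y => semidirectBracket n (y 0) (y 1)) d x = 0 := by
  have jacobi i j l := semidirectBracket_jacobi (hx i) (hx j) (hx l)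
  exact shuffleSum_bracket_bracket (V := Derivation ℝ R R × R) (semidirectBracket n) jacobi

theorem isMultilinear_twistedBrackets (η : Derivation ℝ R R [⋀^Fin (m + 1)]→ₗ[R] R) (k : ℕ) :
    IsMultilinear ℝ (twistedBrackets η k) :=
  ((isMultilinear_semidirectBracket m).piSingle k).add
    ((isMultilinear_formBracket η).restrictScalars.piSingle k)

theorem shuffleSum_twistedBrackets (η : Derivation ℝ R R [⋀^Fin (m + 1)]→ₗ[R] R)
    (hη : ∀ X, derivationDeriv η X = 0) {l : ℕ} {d : Fin l → ℤ} {x : Fin l → Derivation ℝ R R × R}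
    (hx : ∀ i, HasDegree m (d i) (x i)) :
    shuffleSum (twistedBrackets η) (twistedBrackets η) d x = 0 := by
  have add_left := shuffleSum_add_left (Pi.single 2 fun y => semidirectBracket m (y 0) (y 1))
    (Pi.single (m + 1) (formBracket η)) (isMultilinear_twistedBrackets η) d x
  rw [twistedBrackets] at add_left ⊢
  rw [add_left, shuffleSum_add_right, shuffleSum_add_right, shuffleSum_semidirectBracket m hx,
    shuffleSum_formBracket_formBracket, zero_add, add_zero, shuffleSum_mixed_eq_zero η hη hx]

theorem twistedBrackets_comp_perm (η : Derivation ℝ R R [⋀^Fin (m + 1)]→ₗ[R] R) {d : Fin k → ℤ}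
    {x : Fin k → Derivation ℝ R R × R} (hx : ∀ i, HasDegree m (d i) (x i))
    (σ : Equiv.Perm (Fin k)) :
    twistedBrackets η k (x ∘ σ.symm) = koszulSign σ d • twistedBrackets η k x := by
  rw [twistedBrackets, Pi.add_apply, Pi.add_apply, Pi.add_apply, smul_add]
  congr 1
  · exact single_two_comp_perm (fun v w => semidirectBracket m v w) d x
      (fun i j => semidirectBracket_swap (hx i) (hx j)) σ
  · rw [single_formBracket, single_formBracket, ← map_units_smul]
    congr 1
    obtain rfl | hk := eq_or_ne k (m + 1)
    · rw [Pi.single_eq_same]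
      exact alternatingMap_comp_perm η (fun i => (hx i).fst_eq_zero) σ
    · rw [Pi.single_eq_of_ne hk, Pi.zero_apply, Pi.zero_apply, smul_zero]

theorem twistedBrackets_of_ne_two (η : Derivation ℝ R R [⋀^Fin (m + 1)]→ₗ[R] R) (hk : k ≠ 2) :
    twistedBrackets η k = (Pi.single (m + 1) (formBracket η) : Operations _ _) k := by
  rw [twistedBrackets, Pi.add_apply, Pi.single_eq_of_ne hk, zero_add]

theorem fst_twistedBrackets (η : Derivation ℝ R R [⋀^Fin (m + 1)]→ₗ[R] R) (hk : k ≠ 2)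
    (x : Fin k → Derivation ℝ R R × R) : (twistedBrackets η k x).1 = 0 := by
  rw [twistedBrackets_of_ne_two η hk, single_formBracket]
  rfl

theorem twistedBrackets_two (η : Derivation ℝ R R [⋀^Fin (m + 1)]→ₗ[R] R)
    (x y : Derivation ℝ R R × R) :
    twistedBrackets η 2 ![x, y] =
      semidirectBracket m x y + (Pi.single (m + 1) (formBracket η) : Operations _ _) 2 ![x, y] := by
  rw [twistedBrackets, Pi.add_apply, Pi.add_apply, Pi.single_eq_same]
  rfl

theorem twistedBrackets_leibniz (η : Derivation ℝ R R [⋀^Fin (m + 1)]→ₗ[R] R) (a : R)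
    (x y : Derivation ℝ R R × R) :
    twistedBrackets η 2 ![x, a • y] = a • twistedBrackets η 2 ![x, y] + x.1 a • y := by
  have smul_right : (Pi.single (m + 1) (formBracket η) : Operations _ _) 2 ![x, a • y] =
      a • (Pi.single (m + 1) (formBracket η) : Operations _ _) 2 ![x, y] := by
    obtain ⟨F, hF⟩ := (isMultilinear_formBracket η).piSingle 2
    have eq_update (z) : ![x, z] = Function.update ![x, y] 1 z := by
      ext i : 1
      fin_cases i <;> rfl
    rw [← hF, eq_update, F.map_update_smul, ← eq_update]
  rw [twistedBrackets_two, twistedBrackets_two, smul_right, semidirectBracket_smul_right, smul_add,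
    add_right_comm]

end FormBracket

section AtiyahAlgebroid

variable {E : Type*} [NormedAddCommGroup E] [NormedSpace ℝ E]
variable {M : Type*} [TopologicalSpace M] [ChartedSpace E M] {m : ℕ} (H : DiffForm E M (m + 2))

theorem atiyah_bracket : (atiyah H).bracket = twistedBrackets (m := m + 1) H := by
  refine funext fun k => funext fun x => congrArg₂ (· + ·) ?_ ?_
  · obtain rfl | hk := eq_or_ne k 2
    · rw [dif_pos rfl, Pi.single_eq_same]
      rfl
    · rw [dif_neg hk, Pi.single_eq_of_ne hk]
      rfl
  · obtain rfl | hk := eq_or_ne k (m + 2)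
    · rw [dif_pos rfl, Pi.single_eq_same]
      rfl
    · rw [dif_neg hk, Pi.single_eq_of_ne hk]
      rfl

theorem negOnePow_sub_one_of_eq_add {m k : ℕ} {d : ℤ} (h : (k : ℤ) = m + d) :
    (d - 1).negOnePow = (-1) ^ (m + 1 + k) := by
  have hd : d - 1 = ((m + 1 + k : ℕ) : ℤ) - (((m + 1) + (m + 1) : ℕ) : ℤ) := by
    push_cast
    omega
  rw [hd, Int.negOnePow_sub, Int.negOnePow_even _ ⟨m + 1, Nat.cast_add _ _⟩, mul_one,
    Int.negOnePow_def, zpow_natCast]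

variable {H} in
theorem hasDegree_of_mem_atiyah_deg {d : ℤ} {x : VectorFields E M × SmoothFn E M}
    (hx : x ∈ (atiyah H).deg d) : HasDegree (m + 1) d x :=
  ⟨hx.1, fun h => negOnePow_sub_one_of_eq_add (k := 0) <| by
    rw [not_imp_comm.1 hx.2 h, Nat.cast_zero, add_neg_cancel]⟩

theorem atiyah_isInternal : DirectSum.IsInternal (atiyah H).deg := by
  refine isInternal_of_projections (atiyah H).deg
    (fun i => AddMonoidHom.mk' (fun x : VectorFields E M × SmoothFn E M =>
        (if i = 0 then x.1 else 0, if i = -(m : ℤ) then x.2 else 0)) fun x y =>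
      Prod.ext (ite_add_zero (a := x.1) (b := y.1)) (ite_add_zero (a := x.2) (b := y.2)))
    (fun i x => ⟨fun h => if_neg h, fun h => if_neg h⟩)
    (fun i x hx => Prod.ext (ite_eq_left_iff.2 fun h => (hx.1 h).symm)
      (ite_eq_left_iff.2 fun h => (hx.2 h).symm))
    (fun i j hij x hx => Prod.ext (ite_eq_right_iff.2 fun h => hx.1 fun e => hij (h.trans e.symm))
      (ite_eq_right_iff.2 fun h => hx.2 fun e => hij (h.trans e.symm))) {0, -(m : ℤ)} fun x => ?_
  refine Prod.ext (Prod.fst_sum.trans ?_) (Prod.snd_sum.trans ?_)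
  · exact (Finset.sum_ite_eq' _ _ _).trans (if_pos (Finset.mem_insert_self _ _))
  · exact (Finset.sum_ite_eq' _ _ _).trans (if_pos (by simp))

theorem atiyah_bracket_mem (k : ℕ) (d : Fin k → ℤ) (x : Fin k → VectorFields E M × SmoothFn E M)
    (hx : ∀ i, x i ∈ (atiyah H).deg (d i)) :
    (atiyah H).bracket k x ∈ (atiyah H).deg ((∑ i, d i) + 2 - k) := by
  rw [atiyah_bracket]
  refine Submodule.add_mem _ ?_ ?_
  · obtain rfl | hk := eq_or_ne k 2
    · rw [Pi.single_eq_same, Fin.sum_univ_two, Nat.cast_ofNat, add_sub_cancel_right]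
      exact ⟨fst_semidirectBracket_eq_zero (hx 0).1 (hx 1).1,
        fun h => snd_semidirectBracket_eq_zero (hx 0).1 (hx 1).1 (hx 0).2 (hx 1).2 h⟩
    · rw [Pi.single_eq_of_ne hk]
      exact Submodule.zero_mem _
  · obtain rfl | hk := eq_or_ne k (m + 2)
    · rw [Pi.single_eq_same]
      by_cases hd : ∀ i, d i = 0
      · refine ⟨fun _ => rfl, fun h => absurd ?_ h⟩
        simp only [hd, Finset.sum_const_zero]
        push_cast
        ring
      · obtain ⟨i, hi⟩ := not_forall.1 hd
        rw [formBracket_eq_zero H ((hx i).1 hi)]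
        exact Submodule.zero_mem _
    · rw [Pi.single_eq_of_ne hk]
      exact Submodule.zero_mem _

theorem atiyah_isLInftyAlgebroid (hH : ∀ X, exteriorDeriv H X = 0) :
    (atiyah H).IsLInftyAlgebroid where
  graded := atiyah_isInternal H
  bracket_zero x := by
    rw [atiyah_bracket, twistedBrackets_of_ne_two _ (by omega), Pi.single_eq_of_ne (by omega)]
    rfl
  multilinear k := by
    rw [atiyah_bracket]
    exact isMultilinear_twistedBrackets _ k
  bracket_mem := atiyah_bracket_mem H
  symmetric k d x hx σ := by
    rw [atiyah_bracket]
    exact twistedBrackets_comp_perm _ (fun i => hasDegree_of_mem_atiyah_deg (hx i)) σ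
  jacobi k d x hx := by
    rw [atiyah_bracket]
    exact shuffleSum_twistedBrackets _ hH fun i => hasDegree_of_mem_atiyah_deg (hx i)
  diff_smul a x := by
    rw [PreLInftyAlgebroid.diff, PreLInftyAlgebroid.diff, atiyah_bracket,
      twistedBrackets_of_ne_two _ (by omega), Pi.single_eq_of_ne (by omega)]
    exact (smul_zero a).symm
  leibniz a x y := by
    rw [atiyah_bracket]
    exact twistedBrackets_leibniz _ a x y
  linear k hk := by
    rw [atiyah_bracket, twistedBrackets_of_ne_two _ (by omega)]
    exact (isMultilinear_formBracket _).piSingle k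
  anchor_deg i hi x hx := hx.1 hi
  anchor_diff x := by
    rw [PreLInftyAlgebroid.diff, atiyah_bracket]
    exact fst_twistedBrackets _ (by omega) _
  anchor_bracket x y := by
    rw [atiyah_bracket]
    refine (congrArg Prod.fst (twistedBrackets_two _ x y)).trans ?_
    rw [single_formBracket]
    exact add_zero _
  anchor_higher k hk x := by
    rw [atiyah_bracket]
    exact fst_twistedBrackets _ (by omega) x

end AtiyahAlgebroid

section CechAtiyahAlgebroid

open TopologicalSpace (Opens)

variable {E : Type*} [NormedAddCommGroup E] [NormedSpace ℝ E] [FiniteDimensional ℝ E]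
variable {M : Type*} [TopologicalSpace M] [ChartedSpace E M]
  [IsManifold (modelWithCornersSelf ℝ E) ∞ M] [T2Space M]
variable {Λ : Type*} {U : Λ → Opens M} {m : ℕ} (g : CircleCochain E U (m + 1))

/-- The vector field underlying an element of `ČAt(g)`. -/
def cechField : cechAtiyahModule g →ₗ[SmoothFn E M] VectorFields E M :=
  LinearMap.fst _ _ _ ∘ₗ (cechAtiyahModule g).subtype

/-- The Čech `k`-cochain underlying an element of `ČAt(g)`. -/
def cechCochain (k : ℕ) : cechAtiyahModule g →ₗ[SmoothFn E M] CechFn (E := E) U k :=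
  LinearMap.proj k ∘ₗ LinearMap.snd (SmoothFn E M) (VectorFields E M) (CechCochains E U) ∘ₗ
    (cechAtiyahModule g).subtype

/-- The vector field underlying an element of `ČAt(g)` and one of its components, on an
intersection of members of the cover; the brackets of `ČAt(g)` are semidirect product brackets in
these coordinates. -/
def cechSlot (k : ℕ) (a : Fin (k + 1) → Λ) :
    cechAtiyahModule g →ₗ[ℝ] VectorFields E (inter U a) × SmoothFn E (inter U a) where
  toFun x := (resVF (inter U a) x.1.1, x.1.2 k a)
  map_add' _ _ := rfl
  map_smul' _ _ := rfl

variable {g} {d e : ℤ} {x y : cechAtiyahModule g}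

theorem cech_ext (field : cechField g x = cechField g y)
    (cochain : ∀ k, cechCochain g k x = cechCochain g k y) : x = y :=
  Subtype.ext (Prod.ext field (funext cochain))

theorem cechSlot_ext (field : cechField g x = cechField g y)
    (slot : ∀ k a, cechSlot g k a x = cechSlot g k a y) : x = y :=
  cech_ext field fun k => funext fun a => congrArg Prod.snd (slot k a)

theorem resVF_resFn (V : Opens M) (X : VectorFields E M) (a : SmoothFn E M) :
    resVF V X (resFn V a) = resFn V (X a) := by
  ext x
  exact resVF_apply V X _ x a (.of_forall fun _ => rfl)

theorem cechSlot_smul (k : ℕ) (b : Fin (k + 1) → Λ) (a : SmoothFn E M) (x : cechAtiyahModule g) :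
    cechSlot g k b (a • x) = resFn (inter U b) a • cechSlot g k b x := rfl

theorem cechSlot_bracket (k : ℕ) (a : Fin (k + 1) → Λ) (x y : cechAtiyahModule g) :
    cechSlot g k a (cechAtiyahBracket g x y) =
      semidirectBracket (m + 1 + k) (cechSlot g k a x) (cechSlot g k a y) :=
  Prod.ext (resVF_lie _ _ _) rfl

variable (g) in
/-- The bracket of `ČAt(g)` as a bilinear map. -/
def cechBracket : cechAtiyahModule g →ₗ[ℝ] cechAtiyahModule g →ₗ[ℝ] cechAtiyahModule g :=
  LinearMap.mk₂ ℝ (cechAtiyahBracket g)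
    (fun x y z => cechSlot_ext
      (add_lie (L := VectorFields E M) (M := VectorFields E M) x.1.1 y.1.1 z.1.1) fun k a => by
        simp only [map_add, cechSlot_bracket, LinearMap.add_apply])
    (fun c x y => cechSlot_ext
      (smul_lie (L := VectorFields E M) (M := VectorFields E M) c x.1.1 y.1.1) fun k a => by
        simp only [map_smul, cechSlot_bracket, LinearMap.smul_apply])
    (fun x y z => cechSlot_ext
      (lie_add (L := VectorFields E M) (M := VectorFields E M) x.1.1 y.1.1 z.1.1) fun k a => by
        simp only [map_add, cechSlot_bracket])
    (fun c x y => cechSlot_ext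
      (lie_smul (L := VectorFields E M) (M := VectorFields E M) c x.1.1 y.1.1) fun k a => by
        simp only [map_smul, cechSlot_bracket])

theorem cechCochain_diff_zero (x : cechAtiyahModule g) :
    cechCochain g 0 (cechAtiyahDiff g x) = 0 := by
  change (if 0 ≤ m then (-1 : ℝ) ^ (m + 0) • (0 : CechFn (E := E) U 0) else 0) = 0
  rw [smul_zero, ite_self]

theorem cechCochain_diff_succ (k : ℕ) (x : cechAtiyahModule g) :
    cechCochain g (k + 1) (cechAtiyahDiff g x) =
      if k + 1 ≤ m then (-1 : ℝ) ^ (m + (k + 1)) • cechDiff U k (cechCochain g k x) else 0 := rfl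

variable (g) in
/-- The differential of `ČAt(g)` as a linear map. -/
def cechDifferential : cechAtiyahModule g →ₗ[SmoothFn E M] cechAtiyahModule g where
  toFun := cechAtiyahDiff g
  map_add' x y := cech_ext (add_zero _).symm fun
    | 0 => by simp only [map_add, cechCochain_diff_zero, add_zero]
    | k + 1 => by
      simp only [map_add, cechCochain_diff_succ, smul_add, ite_add_zero]
  map_smul' a x := cech_ext (smul_zero a).symm fun
    | 0 => by simp only [map_smul, cechCochain_diff_zero, smul_zero]
    | k + 1 => by
      simp only [map_smul, cechCochain_diff_succ, smul_ite, smul_zero, RingHom.id_apply,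
        smul_comm a]

theorem cechAtiyah_bracket : (cechAtiyah g).bracket =
    dgLieBrackets (V := cechAtiyahModule g) ((cechDifferential g).restrictScalars ℝ)
      (cechBracket g) := by
  refine funext fun k => funext fun x => ?_
  change _ = (Pi.single 1 _ : Operations (cechAtiyahModule g) (cechAtiyahModule g)) k x +
    (Pi.single 2 _ : Operations (cechAtiyahModule g) (cechAtiyahModule g)) k x
  obtain rfl | h₁ := eq_or_ne k 1
  · rw [Pi.single_eq_same, Pi.single_eq_of_ne (by omega : 1 ≠ 2)]
    exact (add_zero _).symm
  · rw [Pi.single_eq_of_ne h₁]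
    refine (dif_neg h₁).trans (Eq.trans ?_ (zero_add _).symm)
    obtain rfl | h₂ := eq_or_ne k 2
    · rw [Pi.single_eq_same]
      rfl
    · rw [Pi.single_eq_of_ne h₂]
      exact dif_neg h₂

variable (g) in
/-- The projection of `ČAt(g)` onto its homogeneous component of degree `i`, which exhibits the
grading. -/
def cechComponent (i : ℤ) : cechAtiyahModule g →+ cechAtiyahModule g where
  toFun x := ⟨(if i = 0 then x.1.1 else 0, fun k => if (k : ℤ) = m + i then x.1.2 k else 0), by
    refine ⟨fun k hk => ?_, ?_⟩
    · change (if (k : ℤ) = m + i then x.1.2 k else 0) = 0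
      rw [x.2.1 k hk, ite_self]
    · change cechDlog g (if i = 0 then x.1.1 else 0) =
        cechDiff U m (if (m : ℤ) = m + i then x.1.2 m else 0)
      obtain rfl | h := eq_or_ne i 0
      · rw [if_pos rfl, if_pos (add_zero _).symm]
        exact x.2.2
      · rw [if_neg h, if_neg (by omega), map_zero, map_zero]⟩
  map_zero' := cech_ext (ite_self _) fun _ => ite_self _
  map_add' x y := cech_ext (ite_add_zero (a := x.1.1) (b := y.1.1)) fun k =>
    ite_add_zero (a := x.1.2 k) (b := y.1.2 k)

variable (g) in
theorem cechAtiyah_isInternal : DirectSum.IsInternal (cechAtiyah g).deg := by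
  refine isInternal_of_projections (cechAtiyah g).deg (cechComponent g)
    (fun i x => ⟨fun h => if_neg h, fun k h => if_neg h⟩)
    (fun i x hx => cech_ext (ite_eq_left_iff.2 fun h => (hx.1 h).symm)
      fun k => ite_eq_left_iff.2 fun h => (hx.2 k h).symm)
    (fun i j hij x hx => cech_ext
      (ite_eq_right_iff.2 fun h => hx.1 fun e => hij (h.trans e.symm))
      fun k => ite_eq_right_iff.2 fun h => hx.2 k fun e => hij (by omega))
    (Finset.Icc (-m : ℤ) 0) fun x => cech_ext ?_ fun k => ?_
  · refine (map_sum (cechField g) _ _).trans ((Finset.sum_ite_eq' _ _ _).trans (if_pos ?_))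
    exact Finset.mem_Icc.2 ⟨by omega, le_rfl⟩
  · refine (map_sum (cechCochain g k) _ _).trans ?_
    change ∑ i ∈ Finset.Icc (-m : ℤ) 0, (if (k : ℤ) = m + i then x.1.2 k else 0) = x.1.2 k
    obtain hk | hk := le_or_gt k m
    · refine (Finset.sum_congr rfl fun i _ => if_congr ?_ rfl rfl).trans
        ((Finset.sum_ite_eq' _ (k - m : ℤ) fun _ => x.1.2 k).trans (if_pos ?_))
      · omega
      · exact Finset.mem_Icc.2 ⟨by omega, by omega⟩
    · rw [x.2.1 k hk]
      exact Finset.sum_eq_zero fun i _ => ite_self _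

theorem hasDegree_cechSlot (hx : x ∈ (cechAtiyah g).deg d) (k : ℕ) (a : Fin (k + 1) → Λ) :
    HasDegree (m + 1 + k) d (cechSlot g k a x) :=
  ⟨fun h => (congrArg (resVF (inter U a)) (hx.1 h)).trans (resVF_zero _),
    fun h => negOnePow_sub_one_of_eq_add (by_contra fun hk => h (congrFun (hx.2 k hk) a))⟩

theorem cechAtiyahBracket_mem (hx : x ∈ (cechAtiyah g).deg d) (hy : y ∈ (cechAtiyah g).deg e) :
    cechAtiyahBracket g x y ∈ (cechAtiyah g).deg (d + e) := by
  refine ⟨fst_semidirectBracket_eq_zero (n := 0) (x := (x.1.1, 0)) (y := (y.1.1, 0)) hx.1 hy.1,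
    fun k h => funext fun a => ?_⟩
  refine (congrArg Prod.snd (cechSlot_bracket k a x y)).trans ?_
  refine snd_semidirectBracket_eq_zero (r := k - m) (hasDegree_cechSlot hx k a).fst_eq_zero
    (hasDegree_cechSlot hy k a).fst_eq_zero (fun h => congrFun (hx.2 k ?_) a)
    (fun h => congrFun (hy.2 k ?_) a) ?_ <;> omega

theorem cechAtiyahDiff_mem (hx : x ∈ (cechAtiyah g).deg d) :
    cechAtiyahDiff g x ∈ (cechAtiyah g).deg (d + 1) := by
  refine ⟨fun _ => rfl, fun k hk => ?_⟩
  cases k with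
  | zero => exact cechCochain_diff_zero x
  | succ k =>
    have hxk : cechCochain g k x = 0 := hx.2 k (by push_cast at hk; omega)
    refine (cechCochain_diff_succ k x).trans ?_
    rw [hxk, map_zero, smul_zero, ite_self]

theorem cechAtiyah_bracket_mem (k : ℕ) (d : Fin k → ℤ) (x : Fin k → cechAtiyahModule g)
    (hx : ∀ i, x i ∈ (cechAtiyah g).deg (d i)) :
    (cechAtiyah g).bracket k x ∈ (cechAtiyah g).deg ((∑ i, d i) + 2 - k) := by
  rw [cechAtiyah_bracket]
  refine Submodule.add_mem _ ?_ ?_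
  · obtain rfl | hk := eq_or_ne k 1
    · rw [Pi.single_eq_same, Fin.sum_univ_one,
        show d 0 + 2 - (1 : ℕ) = d 0 + 1 by push_cast; ring]
      exact cechAtiyahDiff_mem (hx 0)
    · rw [Pi.single_eq_of_ne hk]
      exact Submodule.zero_mem _
  · obtain rfl | hk := eq_or_ne k 2
    · rw [Pi.single_eq_same, Fin.sum_univ_two, Nat.cast_ofNat, add_sub_cancel_right]
      exact cechAtiyahBracket_mem (hx 0) (hx 1)
    · rw [Pi.single_eq_of_ne hk]
      exact Submodule.zero_mem _

theorem cechBracket_swap (hx : x ∈ (cechAtiyah g).deg d) (hy : y ∈ (cechAtiyah g).deg e) :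
    SymmetryIdentity (fun u v => cechBracket g u v) d e x y := by
  refine cechSlot_ext ?_ fun k a => ?_
  · simp only [map_units_smul]
    exact congrArg Prod.fst (semidirectBracket_swap (n := 0) (x := (x.1.1, 0)) (y := (y.1.1, 0))
      ⟨hx.1, fun h => absurd rfl h⟩ ⟨hy.1, fun h => absurd rfl h⟩)
  · refine Eq.trans ?_ (map_units_smul (cechSlot g k a) _ (cechBracket g x y)).symm
    exact (cechSlot_bracket k a y x).trans
      ((semidirectBracket_swap (hasDegree_cechSlot hx k a) (hasDegree_cechSlot hy k a)).trans
        (congrArg _ (cechSlot_bracket k a x y).symm))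

theorem cechBracket_jacobi {z : cechAtiyahModule g} {f : ℤ} (hx : x ∈ (cechAtiyah g).deg d)
    (hy : y ∈ (cechAtiyah g).deg e) (hz : z ∈ (cechAtiyah g).deg f) :
    JacobiIdentity (fun u v => cechBracket g u v) d e f x y z := by
  refine cechSlot_ext ?_ fun k a => ?_
  · simp only [map_add, map_units_smul, map_zero]
    exact graded_lie_jacobi hx.1 hy.1 hz.1
  · have slot (u v : cechAtiyahModule g) : cechSlot g k a (cechBracket g u v) =
        semidirectBracket (m + 1 + k) (cechSlot g k a u) (cechSlot g k a v) :=
      cechSlot_bracket k a u v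
    simp only [map_add, map_units_smul, map_zero, slot]
    exact semidirectBracket_jacobi (hasDegree_cechSlot hx k a) (hasDegree_cechSlot hy k a)
      (hasDegree_cechSlot hz k a)

theorem cechAtiyahDiff_cechAtiyahDiff (x : cechAtiyahModule g) :
    cechAtiyahDiff g (cechAtiyahDiff g x) = 0 := by
  refine cech_ext rfl fun
    | 0 => cechCochain_diff_zero _
    | 1 => ?_
    | k + 2 => ?_
  · rw [cechCochain_diff_succ, cechCochain_diff_zero, map_zero, smul_zero, ite_self, map_zero]
  · rw [cechCochain_diff_succ, cechCochain_diff_succ, map_zero]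
    split_ifs
    · rw [LinearMap.map_smul_of_tower, cechDiff_cechDiff, smul_zero, smul_zero]
    · rw [map_zero, smul_zero]
    · rfl

theorem cechCochain_bracket (k : ℕ) (x y : cechAtiyahModule g) :
    cechCochain g k (cechAtiyahBracket g x y) = lieCech U (cechField g x) (cechCochain g k y) +
      (-1 : ℝ) ^ (m + 1 + k) • lieCech U (cechField g y) (cechCochain g k x) := rfl

theorem lieCech_zero_right {k : ℕ} (X : VectorFields E M) :
    lieCech U X (0 : CechFn (E := E) U k) = 0 :=
  funext fun a => map_zero (resVF (inter U a) X)

theorem lieCech_zero_left {k : ℕ} (f : CechFn (E := E) U k) : lieCech U 0 f = 0 := rfl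

theorem lieCech_smul_right {k : ℕ} (X : VectorFields E M) (c : ℝ) (f : CechFn (E := E) U k) :
    lieCech U X (c • f) = c • lieCech U X f :=
  funext fun a => (resVF (inter U a) X).map_smul c _

theorem cechCochain_diff_bracket_zero (x y : cechAtiyahModule g) :
    cechCochain g 0 (cechAtiyahBracket g (cechAtiyahDiff g x) y) = 0 := by
  rw [cechCochain_bracket, cechCochain_diff_zero, lieCech_zero_right, smul_zero, add_zero]
  exact lieCech_zero_left _

theorem cechCochain_diff_bracket_succ (k : ℕ) (x y : cechAtiyahModule g) :
    cechCochain g (k + 1) (cechAtiyahBracket g (cechAtiyahDiff g x) y) =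
      if k + 1 ≤ m then -cechDiff U k (lieCech U (cechField g y) (cechCochain g k x)) else 0 := by
  have sign : (-1 : ℝ) ^ (m + 1 + (k + 1)) * (-1) ^ (m + (k + 1)) = -1 := by
    rw [← pow_add]
    exact Odd.neg_one_pow ⟨m + (k + 1), by ring⟩
  refine (zero_add _).trans ?_
  change _ • lieCech U (cechField g y) (cechCochain g (k + 1) (cechAtiyahDiff g x)) = _
  rw [cechCochain_diff_succ]
  split_ifs
  · rw [lieCech_smul_right, smul_smul, sign, neg_one_smul, lieCech_cechDiff]
  · rw [lieCech_zero_right, smul_zero]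

theorem smul_lieCech_of_mem (hx : x ∈ (cechAtiyah g).deg d) (hy : y ∈ (cechAtiyah g).deg e)
    (k : ℕ) :
    ((d - 1) * (e - 1)).negOnePow • lieCech U (cechField g x) (cechCochain g k y) =
      (-1 : ℝ) ^ (m + 1 + k) • lieCech U (cechField g x) (cechCochain g k y) := by
  refine Eq.trans (funext fun a => ?_) (neg_one_pow_units_smul _ _)
  exact ((hasDegree_cechSlot hx k a).smul_apply (hasDegree_cechSlot hy k a) :)

theorem cechAtiyahDiff_bracket (hx : x ∈ (cechAtiyah g).deg d) (hy : y ∈ (cechAtiyah g).deg e) :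
    LeibnizIdentity (cechAtiyahDiff g) (cechAtiyahBracket g) d e x y := by
  refine cech_ext ?_ fun
    | 0 => ?_
    | k + 1 => ?_
  · have field_zero (x y : cechAtiyahModule g) :
        cechField g (cechAtiyahBracket g (cechAtiyahDiff g x) y) = 0 :=
      zero_lie (L := VectorFields E M) (M := VectorFields E M) y.1.1
    simp only [map_add, map_units_smul, field_zero, smul_zero, zero_add, map_zero]
    rfl
  · simp only [map_add, map_units_smul, cechCochain_diff_bracket_zero, cechCochain_diff_zero,
      smul_zero, add_zero, map_zero]
  · have sign : (-1 : ℝ) ^ (m + (k + 1)) * (-1) ^ (m + 1 + k) = 1 := by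
      rw [← pow_add]
      exact Even.neg_one_pow ⟨m + 1 + k, by ring⟩
    simp only [map_add, map_units_smul, cechCochain_diff_bracket_succ, cechCochain_diff_succ,
      map_zero]
    split_ifs
    · rw [smul_neg, ← map_units_smul, smul_lieCech_of_mem hx hy, cechCochain_bracket, map_add,
        LinearMap.map_smul_of_tower, LinearMap.map_smul_of_tower, smul_add, smul_smul, sign,
        one_smul, add_right_comm m 1 k, add_assoc m k 1]
      abel
    · rw [smul_zero, add_zero, add_zero]

theorem cechAtiyahBracket_smul_right (a : SmoothFn E M) (x y : cechAtiyahModule g) :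
    cechAtiyahBracket g x (a • y) =
      a • cechAtiyahBracket g x y + cechField g x a • y := by
  refine cechSlot_ext ?_ fun k b => ?_
  · rw [map_add, map_smul, map_smul]
    exact congrArg Prod.fst (semidirectBracket_smul_right 0 a (x.1.1, 0) (y.1.1, 0))
  · rw [map_add, cechSlot_smul, cechSlot_smul, cechSlot_bracket, cechSlot_bracket, cechSlot_smul,
      ← resVF_resFn]
    exact semidirectBracket_smul_right _ _ _ _

theorem cechAtiyah_bracket_of_three_le {k : ℕ} (hk : 3 ≤ k) : (cechAtiyah g).bracket k = 0 :=
  (congrFun cechAtiyah_bracket k).trans (dgLieBrackets_of_three_le _ _ hk)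

variable (g) in
theorem cechAtiyah_isLInftyAlgebroid : (cechAtiyah g).IsLInftyAlgebroid where
  graded := cechAtiyah_isInternal g
  bracket_zero x := rfl
  multilinear k := by
    rw [cechAtiyah_bracket]
    exact isMultilinear_dgLieBrackets _ _ k
  bracket_mem := cechAtiyah_bracket_mem
  symmetric k d x hx σ := by
    refine (congrFun₂ cechAtiyah_bracket k (x ∘ σ.symm)).trans
      ((dgLieBrackets_comp_perm (V := cechAtiyahModule g) _ _
        (fun i j => cechBracket_swap (hx i) (hx j)) σ).trans ?_)
    exact congrArg (koszulSign σ d • ·) (congrFun₂ cechAtiyah_bracket k x).symm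
  jacobi k d x hx := by
    rw [cechAtiyah_bracket]
    exact shuffleSum_dgLieBrackets (V := cechAtiyahModule g) _ _ cechAtiyahDiff_cechAtiyahDiff
      (fun i j => cechAtiyahDiff_bracket (hx i) (hx j))
      fun i j l => cechBracket_jacobi (hx i) (hx j) (hx l)
  diff_smul := (cechDifferential g).map_smul
  leibniz a x y := cechAtiyahBracket_smul_right a x y
  linear k hk := ⟨0, by rw [cechAtiyah_bracket_of_three_le hk]; rfl⟩
  anchor_deg i hi x hx := hx.1 hi
  anchor_diff x := rfl
  anchor_bracket x y := rfl
  anchor_higher k hk x := by rw [cechAtiyah_bracket_of_three_le hk, Pi.zero_apply, map_zero]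

end CechAtiyahAlgebroid

section CechExactness

open TopologicalSpace (Opens)

variable {E : Type*} [NormedAddCommGroup E] [NormedSpace ℝ E]
variable {M : Type*} [TopologicalSpace M] [ChartedSpace E M]
variable {Λ : Type*} {U : Λ → Opens M} {k : ℕ}

theorem mem_inter {a : Fin k → Λ} {x : M} : x ∈ inter U a ↔ ∀ i, x ∈ U (a i) :=
  Set.mem_iInter

/-- A function on an open subset, extended by zero. -/
def extendByZero (V : Opens M) (f : SmoothFn E V) (x : M) : ℝ :=
  open Classical in if h : x ∈ V then f ⟨x, h⟩ else 0

theorem extendByZero_of_mem {V : Opens M} (f : SmoothFn E V) {x : M} (h : x ∈ V) :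
    extendByZero V f x = f ⟨x, h⟩ := dif_pos h

theorem contMDiffAt_extendByZero {V : Opens M} (f : SmoothFn E V) {x : M} (h : x ∈ V) :
    ContMDiffAt (modelWithCornersSelf ℝ E) 𝓘(ℝ, ℝ) ∞ (extendByZero V f) x := by
  rw [← contMDiffAt_subtype_iff (U := V) (x := ⟨x, h⟩)]
  exact (f.contMDiff ⟨x, h⟩).congr_of_eventuallyEq
    (.of_forall fun z => extendByZero_of_mem f z.2)

/-- The values of the components of a Čech cochain at a point, extended by zero. -/
def cechValue (f : CechFn (E := E) U k) (x : M) (a : Fin (k + 1) → Λ) : ℝ :=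
  extendByZero (inter U a) (f a) x

theorem cechValue_of_mem (f : CechFn (E := E) U k) {x : M} {a : Fin (k + 1) → Λ}
    (h : x ∈ inter U a) : cechValue f x a = f a ⟨x, h⟩ := extendByZero_of_mem _ h

theorem cechDiff_apply_eq_sum (f : CechFn (E := E) U k) (a : Fin (k + 2) → Λ) {x : M}
    (hx : x ∈ inter U a) :
    cechDiff U k f a ⟨x, hx⟩ =
      ∑ i : Fin (k + 2), (-1 : ℝ) ^ (i : ℕ) * cechValue f x (a ∘ i.succAbove) := by
  let eval : SmoothFn E (inter U a) →+ ℝ := ⟨⟨fun f => f ⟨x, hx⟩, rfl⟩, fun _ _ => rfl⟩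
  refine (map_sum eval _ _).trans (Finset.sum_congr rfl fun i _ => ?_)
  rw [cechValue_of_mem f (inter_le U a i.succAbove hx)]
  rfl

theorem cechValue_eq_sum_of_cocycle {f : CechFn (E := E) U k} (hf : cechDiff U k f = 0)
    {a : Fin (k + 1) → Λ} {c : Λ} {x : M} (hx : x ∈ inter U a) (hc : x ∈ U c) :
    f a ⟨x, hx⟩ =
      ∑ i : Fin (k + 1), (-1 : ℝ) ^ (i : ℕ) * cechValue f x (Fin.cons c (a ∘ i.succAbove)) := by
  have hx' : x ∈ inter U (Fin.cons c a : Fin (k + 2) → Λ) :=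
    mem_inter.2 (Fin.cases hc (mem_inter.1 hx))
  have cons_comp_zero : (Fin.cons c a : Fin (k + 2) → Λ) ∘ (0 : Fin (k + 2)).succAbove = a :=
    funext fun i => by simp
  have cons_comp_succ (i : Fin (k + 1)) : (Fin.cons c a : Fin (k + 2) → Λ) ∘ i.succ.succAbove =
      Fin.cons c (a ∘ i.succAbove) :=
    funext (Fin.cases (by simp) fun l => by simp)
  have cocycle := cechDiff_apply_eq_sum f (Fin.cons c a) hx'
  rw [hf, Fin.sum_univ_succ, cons_comp_zero, cechValue_of_mem f hx] at cocycle
  simp only [cons_comp_succ, Fin.val_zero, Fin.val_succ, pow_zero, one_mul, pow_succ, mul_neg_one,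
    neg_mul, Finset.sum_neg_distrib] at cocycle
  exact eq_of_sub_eq_zero ((sub_eq_add_neg _ _).trans cocycle.symm)

theorem augment_injective (hU : ∀ x : M, ∃ a, x ∈ U a) {F : SmoothFn E M}
    (hF : augment U F = 0) : F = 0 := by
  ext x
  obtain ⟨a, ha⟩ := hU x
  exact congrArg (fun f : CechFn (E := E) U 0 => f (fun _ => a) ⟨x, mem_inter.2 fun _ => ha⟩) hF

theorem cechDiff_augment (F : SmoothFn E M) : cechDiff U 0 (augment U F) = 0 := by
  funext a
  ext ⟨x, hx⟩
  rw [cechDiff_apply_eq_sum, Fin.sum_univ_two,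
    cechValue_of_mem _ (inter_le U a (Fin.succAbove 0) hx),
    cechValue_of_mem _ (inter_le U a (Fin.succAbove 1) hx)]
  change (-1 : ℝ) ^ 0 * F x + (-1 : ℝ) ^ 1 * F x = 0
  ring

section PartitionOfUnity

variable {ρ : SmoothPartitionOfUnity Λ (modelWithCornersSelf ℝ E) M}

variable (ρ) in
/-- The contracting homotopy of the Čech complex given by a partition of unity. -/
def cechContraction (f : CechFn (E := E) U k) (b : Fin k → Λ) (x : M) : ℝ :=
  ∑ᶠ c, ρ c x • cechValue f x (Fin.cons c b)

theorem contMDiffAt_cechContraction (hρ : ρ.IsSubordinate fun c => (U c : Set M))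
    (f : CechFn (E := E) U k) (b : Fin k → Λ) {x : M} (hx : x ∈ inter U b) :
    ContMDiffAt (modelWithCornersSelf ℝ E) 𝓘(ℝ, ℝ) ∞ (cechContraction ρ f b) x :=
  ρ.contMDiffAt_finsum fun c hc =>
    contMDiffAt_extendByZero _ (mem_inter.2 (Fin.cases (hρ c hc) (mem_inter.1 hx)))

theorem cechContraction_of_cocycle (hρ : ρ.IsSubordinate fun c => (U c : Set M))
    {f : CechFn (E := E) U k} (hf : cechDiff U k f = 0) (a : Fin (k + 1) → Λ) {x : M}
    (hx : x ∈ inter U a) :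
    ∑ i : Fin (k + 1), (-1 : ℝ) ^ (i : ℕ) * cechContraction ρ f (a ∘ i.succAbove) x =
      f a ⟨x, hx⟩ := by
  have finite_support_smul (v : Λ → ℝ) : (Function.support fun c => ρ c x • v c).Finite :=
    (ρ.locallyFinite.point_finite x).subset (Function.support_smul_subset_left (fun c => ρ c x) v)
  calc
    _ = ∑ᶠ c, ∑ i : Fin (k + 1),
        (-1 : ℝ) ^ (i : ℕ) * (ρ c x • cechValue f x (Fin.cons c (a ∘ i.succAbove))) := by
      rw [finsum_sum_comm _ _ fun i _ =>
        (finite_support_smul _).subset (Function.support_mul_subset_right _ _)]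
      simp only [cechContraction, mul_finsum]
    _ = ∑ᶠ c, ρ c x * f a ⟨x, hx⟩ := by
      refine finsum_congr fun c => ?_
      obtain h | h := eq_or_ne (ρ c x) 0
      · simp only [h, zero_smul, mul_zero, Finset.sum_const_zero, zero_mul]
      · rw [cechValue_eq_sum_of_cocycle hf hx (hρ c (subset_closure h)), Finset.mul_sum]
        exact Finset.sum_congr rfl fun i _ => mul_left_comm _ _ _
    _ = f a ⟨x, hx⟩ := by
      rw [← finsum_mul, ρ.sum_eq_one (Set.mem_univ x), one_mul]

end PartitionOfUnity

variable [FiniteDimensional ℝ E] [IsManifold (modelWithCornersSelf ℝ E) ∞ M] [T2Space M]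
  [SigmaCompactSpace M]

theorem exists_subordinate_partition (hU : ∀ x : M, ∃ a, x ∈ U a) :
    ∃ ρ : SmoothPartitionOfUnity Λ (modelWithCornersSelf ℝ E) M,
      ρ.IsSubordinate fun c => (U c : Set M) :=
  SmoothPartitionOfUnity.exists_isSubordinate _ isClosed_univ _ (fun c => (U c).isOpen)
    fun x _ => Set.mem_iUnion.2 (hU x)

theorem cechDiff_exact (hU : ∀ x : M, ∃ a, x ∈ U a) {f : CechFn (E := E) U (k + 1)}
    (hf : cechDiff U (k + 1) f = 0) : ∃ h : CechFn (E := E) U k, cechDiff U k h = f := by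
  obtain ⟨ρ, hρ⟩ := exists_subordinate_partition (E := E) hU
  let h : CechFn (E := E) U k := fun b => ⟨fun x => cechContraction ρ f b x, fun x =>
    contMDiffAt_subtype_iff.2 (contMDiffAt_cechContraction hρ f b x.2)⟩
  refine ⟨h, ?_⟩
  funext a
  ext ⟨x, hx⟩
  rw [← cechContraction_of_cocycle hρ hf a hx, cechDiff_apply_eq_sum h]
  refine Finset.sum_congr rfl fun i _ => ?_
  rw [cechValue_of_mem h (inter_le U a i.succAbove hx)]
  rfl

theorem exists_augment_eq (hU : ∀ x : M, ∃ a, x ∈ U a) {f : CechFn (E := E) U 0}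
    (hf : cechDiff U 0 f = 0) : ∃ F : SmoothFn E M, augment U F = f := by
  obtain ⟨ρ, hρ⟩ := exists_subordinate_partition (E := E) hU
  refine ⟨⟨cechContraction ρ f Fin.elim0, fun x =>
    contMDiffAt_cechContraction hρ f _ (mem_inter.2 fun i => i.elim0)⟩, ?_⟩
  funext a
  ext ⟨x, hx⟩
  rw [← cechContraction_of_cocycle hρ hf a hx, Fin.sum_univ_one, Fin.val_zero, pow_zero, one_mul,
    Subsingleton.elim (a ∘ (0 : Fin 1).succAbove) Fin.elim0]
  rfl

end CechExactness

section ConnectionOperations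

variable {R : Type*} [CommRing R] [Algebra ℝ R] {n q : ℕ}

/-- The operations on pairs of derivations and functions given by forms of all positive degrees. -/
def formOperations (η : ∀ q, Derivation ℝ R R [⋀^Fin (q + 1)]→ₗ[R] R) :
    Operations (Derivation ℝ R R × R) (Derivation ℝ R R × R)
  | 0, _ => 0
  | q + 1, x => formBracket (η q) x

/-- The components of the `∞`-morphism induced by a connection, in the coordinates of `cechSlot`:
the identity perturbed by the connection forms. -/
def connectionOperations (η : ∀ q, Derivation ℝ R R [⋀^Fin (q + 1)]→ₗ[R] R) :
    Operations (Derivation ℝ R R × R) (Derivation ℝ R R × R) :=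
  (Pi.single 1 fun x => x 0 : Operations _ _) + formOperations η

variable (η : ∀ q, Derivation ℝ R R [⋀^Fin (q + 1)]→ₗ[R] R)

theorem isMultilinear_formOperations : ∀ k, IsMultilinear R (formOperations η k)
  | 0 => IsMultilinear.zero
  | q + 1 => isMultilinear_formBracket (η q)

theorem isMultilinear_connectionOperations (k : ℕ) :
    IsMultilinear R (connectionOperations η k) :=
  ((IsMultilinear.unary LinearMap.id).piSingle k).add (isMultilinear_formOperations η k)

theorem connectionOperations_one (x : Fin 1 → Derivation ℝ R R × R) :
    connectionOperations η 1 x = x 0 + formBracket (η 0) x := rfl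

theorem connectionOperations_zero : connectionOperations η 0 = 0 := by
  rw [connectionOperations, Pi.add_apply, Pi.single_eq_of_ne zero_ne_one]
  exact zero_add _

theorem connectionOperations_succ_succ (q : ℕ) :
    connectionOperations η (q + 2) = formBracket (η (q + 1)) := by
  rw [connectionOperations, Pi.add_apply, Pi.single_eq_of_ne (by omega)]
  exact zero_add _

theorem connectionOperations_comp_perm {k : ℕ} {d : Fin k → ℤ} {x : Fin k → Derivation ℝ R R × R}
    (hx : ∀ i, d i ≠ 0 → (x i).1 = 0) (σ : Equiv.Perm (Fin k)) :
    connectionOperations η k (x ∘ σ.symm) = koszulSign σ d • connectionOperations η k x := by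
  match k with
  | 0 | 1 =>
    rw [Subsingleton.elim σ 1, Equiv.Perm.coe_one, koszulSign_of_monotone monotone_id, one_smul]
    rfl
  | q + 2 =>
    rw [connectionOperations_succ_succ]
    exact Prod.ext (smul_zero _).symm
      (alternatingMap_comp_perm (η (q + 1)) (X := fun i => (x i).1) hx σ)

theorem fst_connectionOperations_of_ne_one {k : ℕ} (hk : k ≠ 1)
    (x : Fin k → Derivation ℝ R R × R) : (connectionOperations η k x).1 = 0 := by
  match k, hk with
  | 0, _ => rw [connectionOperations_zero]; rfl
  | q + 2, _ => rw [connectionOperations_succ_succ]; rfl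

theorem fst_connectionOperations_one (x : Fin 1 → Derivation ℝ R R × R) :
    (connectionOperations η 1 x).1 = (x 0).1 :=
  add_zero _

variable (d : Fin (q + 2) → ℤ) (x : Fin (q + 2) → Derivation ℝ R R × R)

theorem fst_twoBlockSum_connectionOperations (n : ℕ) :
    (twoBlockSum (fun y => semidirectBracket n (y 0) (y 1)) (connectionOperations η) d x).1 =
      ∑ i, shuffleSign {i} d •
        ⁅(x i).1, (connectionOperations η (q + 1) (i.removeNth x)).1⁆ := by
  refine (map_twoBlockSum (LinearMap.fst R _ _) _ (fun u w => ⁅u.1, w.1⁆) 0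
    (fun y => (add_zero _).symm) _ (fun k hk y w => ?_) (fun _ _ _ _ => rfl) d x).trans ?_
  · rw [fst_connectionOperations_of_ne_one η hk, zero_lie]
  · simp only [fst_connectionOperations_one, Pi.zero_apply, smul_zero, add_zero]

theorem snd_twoBlockSum_connectionOperations (n : ℕ) :
    (twoBlockSum (fun y => semidirectBracket n (y 0) (y 1)) (connectionOperations η) d x).2 =
      ∑ i, (shuffleSign {i} d • (x i).1 (connectionOperations η (q + 1) (i.removeNth x)).2 +
        shuffleSign {i}ᶜ d • (-1 : ℝ) ^ n •
          (x i).1 (connectionOperations η (q + 1) (i.removeNth x)).2) := by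
  refine (map_twoBlockSum (LinearMap.snd R _ _) _ (fun u w => u.1 w.2)
    (fun u w => (-1 : ℝ) ^ n • u.1 w.2) (fun y => rfl) _ (fun k hk y w => ?_)
    (fun k hk y w => ?_) d x).trans ?_
  · rw [fst_connectionOperations_of_ne_one η hk, Derivation.zero_apply]
  · rw [fst_connectionOperations_of_ne_one η hk, Derivation.zero_apply, smul_zero]
  · simp only [fst_connectionOperations_one]

variable {d x} {η : Derivation ℝ R R [⋀^Fin (q + 1)]→ₗ[R] R}

theorem shuffleSign_singleton_smul_add {X : Fin (q + 2) → Derivation ℝ R R}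
    (hX : ∀ i, d i ≠ 0 → X i = 0) (hη : η ≠ 0 → (-1 : ℝ) ^ n = (-1) ^ (q + 1))
    (i : Fin (q + 2)) :
    shuffleSign {i} d • X i (η (i.removeNth X)) +
        shuffleSign {i}ᶜ d • (-1 : ℝ) ^ n • X i (η (i.removeNth X)) =
      (2 : ℝ) • (-1 : ℝ) ^ (i : ℕ) • X i (η (i.removeNth X)) := by
  obtain rfl | h := eq_or_ne η 0
  · simp
  have degree (hd : d ≠ 0) : X i (η (i.removeNth X)) = 0 := by
    obtain ⟨a, ha⟩ := Function.ne_iff.1 hd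
    obtain rfl | hai := eq_or_ne a i
    · rw [hX a ha, Derivation.zero_apply]
    · obtain ⟨b, rfl⟩ := Fin.exists_succAbove_eq hai
      rw [η.map_coord_zero b (hX _ ha), map_zero]
  rw [shuffleSign, shuffleSign, koszulSign_smul_of_degree (w := X i _) _ degree,
    koszulSign_smul_of_degree (w := (-1 : ℝ) ^ n • _) _ fun hd => by rw [degree hd, smul_zero],
    ← shuffleSign,
    ← shuffleSign, shuffleSign_singleton_zero, shuffleSign_compl_singleton_zero, hη h,
    neg_one_pow_units_smul, neg_one_pow_units_smul, smul_smul, ← pow_add, two_smul]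
  rw [show q + 1 + (i : ℕ) + (q + 1) = i + 2 * (q + 1) by ring, pow_add, pow_mul, neg_one_sq,
    one_pow, mul_one]

theorem shuffleSign_two (d : Fin 2 → ℤ) : shuffleSign {0} d = 1 ∧ shuffleSign {0}ᶜ d =
    ((d 0 - 1) * (d 1 - 1)).negOnePow ∧ shuffleSign {1} d = ((d 0 - 1) * (d 1 - 1)).negOnePow ∧
    shuffleSign {1}ᶜ d = 1 := by
  simp [shuffleSign, koszulSign, Fin.prod_univ_two]

theorem sum_shuffleSign_two_fst {d : Fin 2 → ℤ} {x : Fin 2 → Derivation ℝ R R × R}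
    (hx : ∀ i, HasDegree n (d i) (x i)) :
    ∑ i, shuffleSign {i} d • ⁅(x i).1, (i.removeNth x 0).1⁆ = (2 : ℝ) • ⁅(x 0).1, (x 1).1⁆ := by
  obtain ⟨h0, -, h1, -⟩ := shuffleSign_two d
  rw [Fin.sum_univ_two, h0, h1, two_smul, one_smul]
  have swap : ((d 0 - 1) * (d 1 - 1)).negOnePow • ⁅(x 1).1, (x 0).1⁆ = ⁅(x 0).1, (x 1).1⁆ := by
    rw [← lie_skew, smul_neg, (hx 0).smul_lie (hx 1), neg_neg]
  exact congrArg (⁅(x 0).1, (x 1).1⁆ + ·) swap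

theorem sum_shuffleSign_two_snd {d : Fin 2 → ℤ} {x : Fin 2 → Derivation ℝ R R × R}
    (hx : ∀ i, HasDegree n (d i) (x i)) :
    ∑ i, (shuffleSign {i} d • (x i).1 (i.removeNth x 0).2 +
        shuffleSign {i}ᶜ d • (-1 : ℝ) ^ n • (x i).1 (i.removeNth x 0).2) =
      (2 : ℝ) • (semidirectBracket n (x 0) (x 1)).2 := by
  obtain ⟨h0, h0', h1, h1'⟩ := shuffleSign_two d
  have swap_zero : ((d 0 - 1) * (d 1 - 1)).negOnePow • (-1 : ℝ) ^ n • (x 0).1 (x 1).2 =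
      (x 0).1 (x 1).2 := by
    rw [smul_comm, (hx 0).smul_apply (hx 1), neg_one_pow_units_smul, smul_smul,
      ← mul_pow, neg_mul_neg, one_mul, one_pow, one_smul]
  have swap_one : ((d 0 - 1) * (d 1 - 1)).negOnePow • (x 1).1 (x 0).2 =
      (-1 : ℝ) ^ n • (x 1).1 (x 0).2 := by
    rw [mul_comm, (hx 1).smul_apply (hx 0), neg_one_pow_units_smul]
  rw [Fin.sum_univ_two, h0, h0', h1, h1']
  change _ • (x 0).1 (x 1).2 + _ • _ • (x 0).1 (x 1).2 +
    (_ • (x 1).1 (x 0).2 + _ • _ • (x 1).1 (x 0).2) =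
    (2 : ℝ) • ((x 0).1 (x 1).2 + (-1 : ℝ) ^ n • (x 1).1 (x 0).2)
  rw [swap_zero, swap_one, one_smul, one_smul, ← two_smul ℝ, ← two_smul ℝ, smul_add]

theorem half_twoBlockSum_two {η : ∀ q, Derivation ℝ R R [⋀^Fin (q + 1)]→ₗ[R] R}
    {d : Fin 2 → ℤ} {x : Fin 2 → Derivation ℝ R R × R} (hx : ∀ i, HasDegree n (d i) (x i))
    (hη : η 0 ≠ 0 → (-1 : ℝ) ^ n = (-1) ^ 1) :
    (2 : ℝ)⁻¹ • twoBlockSum (fun y => semidirectBracket n (y 0) (y 1)) (connectionOperations η)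
        d x =
      semidirectBracket n (x 0) (x 1) + LinearMap.inr R (Derivation ℝ R R) R
        (∑ i : Fin 2, (-1 : ℝ) ^ (i : ℕ) • (x i).1 (η 0 (i.removeNth fun a => (x a).1))) := by
  rw [inv_smul_eq_iff₀ two_ne_zero]
  have apply_one (y : Fin (0 + 1) → Derivation ℝ R R × R) :
      connectionOperations η (0 + 1) y = y 0 + formBracket (η 0) y := rfl
  refine Prod.ext ?_ ?_
  · rw [fst_twoBlockSum_connectionOperations]
    simp only [apply_one, Prod.fst_add, formBracket, add_zero]
    exact (sum_shuffleSign_two_fst hx).trans (congrArg _ (add_zero _).symm)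
  · rw [snd_twoBlockSum_connectionOperations]
    simp only [apply_one, Prod.snd_add, map_add, smul_add, Prod.smul_snd]
    refine (Finset.sum_congr rfl fun i _ => add_add_add_comm _ _ _ _).trans ?_
    rw [Finset.sum_add_distrib, sum_shuffleSign_two_snd hx]
    exact congrArg ((2 : ℝ) • (semidirectBracket n (x 0) (x 1)).2 + ·)
      ((Finset.sum_congr rfl fun i _ => shuffleSign_singleton_smul_add
        (fun i => (hx i).fst_eq_zero) hη i).trans Finset.smul_sum.symm)

theorem half_twoBlockSum_of_two_lt {η : ∀ q, Derivation ℝ R R [⋀^Fin (q + 1)]→ₗ[R] R}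
    {d : Fin (q + 3) → ℤ} {x : Fin (q + 3) → Derivation ℝ R R × R}
    (hx : ∀ i, d i ≠ 0 → (x i).1 = 0)
    (hη : η (q + 1) ≠ 0 → (-1 : ℝ) ^ n = (-1) ^ (q + 2)) :
    (2 : ℝ)⁻¹ • twoBlockSum (fun y => semidirectBracket n (y 0) (y 1)) (connectionOperations η)
        d x =
      LinearMap.inr R (Derivation ℝ R R) R (∑ i : Fin (q + 3), (-1 : ℝ) ^ (i : ℕ) •
        (x i).1 (η (q + 1) (i.removeNth fun a => (x a).1))) := by
  rw [inv_smul_eq_iff₀ two_ne_zero]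
  refine Prod.ext ?_ ?_
  · rw [fst_twoBlockSum_connectionOperations]
    simp only [connectionOperations_succ_succ, formBracket, lie_zero, smul_zero,
      Finset.sum_const_zero]
    exact (smul_zero (2 : ℝ)).symm
  · simp only [snd_twoBlockSum_connectionOperations, connectionOperations_succ_succ, formBracket]
    refine (Finset.sum_congr rfl fun i _ => shuffleSign_singleton_smul_add hx hη i).trans ?_
    exact Finset.smul_sum.symm

end ConnectionOperations

section MaurerCartan

variable {R : Type*} [CommRing R] [Algebra ℝ R] {n q : ℕ}
  (η : ∀ q, Derivation ℝ R R [⋀^Fin (q + 1)]→ₗ[R] R)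

theorem shuffleSum_semidirectBracket_formOperations (n : ℕ) {d : Fin (q + 2) → ℤ}
    {x : Fin (q + 2) → Derivation ℝ R R × R} (hx : ∀ i, d i ≠ 0 → (x i).1 = 0) :
    shuffleSum (Pi.single 2 fun y => semidirectBracket n (y 0) (y 1)) (formOperations η) d x =
      -LinearMap.inr R (Derivation ℝ R R) R
        (∑ j : Fin (q + 2), ∑ i ∈ Finset.univ.filter (· < j), (-1 : ℝ) ^ (j : ℕ) •
          η q (j.removeNth (Function.update (fun a => (x a).1) i ⁅(x i).1, (x j).1⁆))) := by
  refine (shuffleSum_single_two_alternating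
    ((LinearMap.inr R (Derivation ℝ R R) R).compAlternatingMap (η q)) _
    (isMultilinear_formOperations η) Prod.fst (fun _ => rfl) (fun _ _ => rfl) hx).trans ?_
  simp only [map_sum, LinearMap.map_smul_of_tower]
  rfl

theorem half_twoBlockSum_connectionOperations {d : Fin (q + 2) → ℤ}
    {x : Fin (q + 2) → Derivation ℝ R R × R} (hx : ∀ i, HasDegree n (d i) (x i))
    (hη : η q ≠ 0 → (-1 : ℝ) ^ n = (-1) ^ (q + 1)) :
    (2 : ℝ)⁻¹ • twoBlockSum (fun y => semidirectBracket n (y 0) (y 1)) (connectionOperations η)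
        d x =
      shuffleSum (Pi.single 2 fun y => semidirectBracket n (y 0) (y 1)) (connectionOperations η)
          d x +
        LinearMap.inr R (Derivation ℝ R R) R (derivationDeriv (η q) fun i => (x i).1) := by
  have isMultilinear_id : IsMultilinear R fun y : Fin 1 → Derivation ℝ R R × R => y 0 :=
    IsMultilinear.unary LinearMap.id
  have fst_eq_zero i := (hx i).fst_eq_zero
  rw [connectionOperations, shuffleSum_add_right,
    shuffleSum_semidirectBracket_formOperations η n fst_eq_zero, ← connectionOperations,
    derivationDeriv, add_comm (∑ i : Fin (q + 2), _), map_add, add_assoc, neg_add_cancel_left]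
  match q with
  | 0 =>
    rw [half_twoBlockSum_two hx hη, shuffleSum_single_self two_pos _ isMultilinear_id.piSingle,
      Pi.single_eq_same]
  | q + 1 =>
    rw [half_twoBlockSum_of_two_lt fst_eq_zero hη,
      shuffleSum_single_single_of_ne (r := 0) two_pos _ isMultilinear_id (by omega), zero_add]

end MaurerCartan

section Transport

variable {V V' W W' F : Type*} [AddCommGroup W] [AddCommGroup W'] [FunLike F W W']
  [AddMonoidHomClass F W W'] (f : F) (s : V → V') {k : ℕ} (d : Fin k → ℤ) (x : Fin k → V)

theorem map_shuffleSum_of_comp {A : Operations V V} {A' : Operations V' V'}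
    {C : Operations V W} {C' : Operations V' W'} (hA : ∀ k y, s (A k y) = A' k (s ∘ y))
    (hC : ∀ k y, f (C k y) = C' k (s ∘ y)) :
    f (shuffleSum A C d x) = shuffleSum A' C' d (s ∘ x) := by
  simp only [shuffleSum, map_sum, map_units_smul, hC, Fin.comp_cons, hA]
  rfl

theorem map_twoBlockSum_of_comp {B : (Fin 2 → W) → W} {B' : (Fin 2 → W') → W'}
    {C : Operations V W} {C' : Operations V' W'} (hB : ∀ u v, f (B ![u, v]) = B' ![f u, f v])
    (hC : ∀ k y, f (C k y) = C' k (s ∘ y)) :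
    f (twoBlockSum B C d x) = twoBlockSum B' C' d (s ∘ x) := by
  simp only [twoBlockSum, map_sum, map_units_smul, hB, hC]
  rfl

theorem shuffleSum_of_cons_eq_zero (hk : 0 < k) (A : Operations V V) {C : Operations V W}
    (hC : ∀ (r : ℕ) (y : Fin r → V) (t : ℕ), 0 < t → ∀ z : Fin t → V,
      C (t + 1) (Fin.cons (A r y) z) = 0) :
    shuffleSum A C d x = C 1 fun _ => A k x := by
  rw [shuffleSum, Finset.sum_eq_single_of_mem Finset.univ]
  · rw [apply_subtuple_univ A, Finset.compl_univ, shuffleSign_univ,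
      one_smul, apply_subtuple_empty fun k y => C (k + 1) (Fin.cons (A _ x) y)]
    exact congrArg (C 1) (funext (Fin.forall_fin_one.2 rfl))
  · exact Finset.mem_filter.2 ⟨Finset.mem_univ _, ⟨⟨0, hk⟩, Finset.mem_univ _⟩⟩
  · intro S _ hS
    rw [hC _ _ _ (Finset.card_pos.2 (Finset.nonempty_iff_ne_empty.2
      (mt (Finset.compl_eq_empty_iff S).1 hS))), smul_zero]

end Transport

section MaurerCartanComponent

variable {R : Type*} [CommRing R] [Algebra ℝ R] {V W : Type*} [AddCommGroup V] [AddCommGroup W]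
  [Module ℝ W] {n q : ℕ}

/-- The quadratic part of the Maurer–Cartan equation, in coordinates such as those of `cechSlot`. -/
theorem map_half_twoBlockSum (f : W →ₗ[ℝ] Derivation ℝ R R × R) (s : V →+ Derivation ℝ R R × R)
    {η : ∀ q, Derivation ℝ R R [⋀^Fin (q + 1)]→ₗ[R] R} {A : (Fin 2 → V) → V}
    {B : (Fin 2 → W) → W} {φ : Operations V W}
    (hA : ∀ y, s (A y) = semidirectBracket n (s (y 0)) (s (y 1)))
    (hB : ∀ u v, f (B ![u, v]) = semidirectBracket n (f u) (f v))
    (hφ : ∀ k y, f (φ k y) = connectionOperations η k (s ∘ y)) {d : Fin (q + 2) → ℤ}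
    {x : Fin (q + 2) → V} (hx : ∀ i, HasDegree n (d i) (s (x i)))
    (hη : η q ≠ 0 → (-1 : ℝ) ^ n = (-1) ^ (q + 1)) :
    f ((2 : ℝ)⁻¹ • twoBlockSum B φ d x) = f (shuffleSum (Pi.single 2 A) φ d x) +
      LinearMap.inr R (Derivation ℝ R R) R (derivationDeriv (η q) fun i => (s (x i)).1) := by
  have map_single (k : ℕ) (y : Fin k → V) : s ((Pi.single 2 A : Operations V V) k y) =
      (Pi.single 2 fun y => semidirectBracket n (y 0) (y 1) : Operations _ _) k (s ∘ y) := by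
    obtain rfl | hk := eq_or_ne k 2
    · rw [Pi.single_eq_same, Pi.single_eq_same]
      exact hA y
    · rw [Pi.single_eq_of_ne hk, Pi.single_eq_of_ne hk]
      exact map_zero s
  rw [map_smul, map_twoBlockSum_of_comp f s d x (B' := fun y => semidirectBracket n (y 0) (y 1))
    hB hφ, map_shuffleSum_of_comp f s d x map_single hφ]
  exact half_twoBlockSum_connectionOperations η hx hη

end MaurerCartanComponent

section InducedMorphism

open TopologicalSpace (Opens)

variable {E : Type*} [NormedAddCommGroup E] [NormedSpace ℝ E]
variable {M : Type*} [TopologicalSpace M] [ChartedSpace E M]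
variable {Λ : Type*} {U : Λ → Opens M} {m : ℕ}

section AtiyahSlot

variable {j : ℕ} (a : Fin (j + 1) → Λ)

/-- The restriction of a function on `M` to a component of `Č_j U` if `j = 0`, and zero
otherwise. -/
def augmentSlot : SmoothFn E M →ₗ[SmoothFn E M] SmoothFn E (inter U a) :=
  LinearMap.proj a ∘ₗ LinearMap.proj j ∘ₗ
    LinearMap.single (SmoothFn E M) (fun k => CechFn (E := E) U k) 0 ∘ₗ augment U

theorem augmentSlot_zero (a : Fin 1 → Λ) (f : SmoothFn E M) :
    augmentSlot (U := U) a f = resFn (inter U a) f :=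
  congrFun (Pi.single_eq_same (M := fun k => CechFn (E := E) U k) 0 (augment U f)) a

theorem augmentSlot_of_ne (hj : j ≠ 0) (f : SmoothFn E M) : augmentSlot (U := U) a f = 0 :=
  congrFun (Pi.single_eq_of_ne (M := fun k => CechFn (E := E) U k) hj (augment U f)) a

variable [FiniteDimensional ℝ E] [IsManifold (modelWithCornersSelf ℝ E) ∞ M] [T2Space M]

theorem resVF_augmentSlot (X : VectorFields E M) (f : SmoothFn E M) :
    resVF (inter U a) X (augmentSlot a f) = augmentSlot a (X f) := by
  obtain _ | j := j
  · rw [augmentSlot_zero, augmentSlot_zero, resVF_resFn]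
  · rw [augmentSlot_of_ne a j.succ_ne_zero, augmentSlot_of_ne a j.succ_ne_zero, map_zero]

/-- The coordinates of an element of `At_{n-1}(H)` that correspond to those of `cechSlot` under the
linear part `f ↦ f|_{Č_0 U}` of the induced morphism. -/
def atiyahSlot :
    VectorFields E M × SmoothFn E M →+ VectorFields E (inter U a) × SmoothFn E (inter U a) where
  toFun x := (resVF (inter U a) x.1, augmentSlot a x.2)
  map_zero' := Prod.ext (resVF_zero _) (map_zero _)
  map_add' _ _ := Prod.ext (resVF_add _ _ _) (map_add _ _ _)

theorem atiyahSlot_smul (c : SmoothFn E M) (x : VectorFields E M × SmoothFn E M) :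
    atiyahSlot (U := U) a (c • x) = resFn (inter U a) c • atiyahSlot (U := U) a x :=
  Prod.ext (resVF_smul _ _ _) (map_smul (augmentSlot a) c x.2)

theorem atiyahSlot_semidirectBracket (x y : VectorFields E M × SmoothFn E M) :
    atiyahSlot (U := U) a (semidirectBracket (m + 1) x y) =
      semidirectBracket (m + 1 + j) (atiyahSlot a x) (atiyahSlot a y) := by
  refine Prod.ext (resVF_lie _ _ _) ?_
  change augmentSlot a (x.1 y.2 + (-1 : ℝ) ^ (m + 1) • y.1 x.2) =
    resVF _ x.1 (augmentSlot a y.2) + (-1 : ℝ) ^ (m + 1 + j) • resVF _ y.1 (augmentSlot a x.2)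
  rw [map_add, LinearMap.map_smul_of_tower, resVF_augmentSlot, resVF_augmentSlot]
  obtain _ | j := j
  · rfl
  · simp only [augmentSlot_of_ne a j.succ_ne_zero, smul_zero]

theorem hasDegree_atiyahSlot {H : DiffForm E M (m + 2)} {d : ℤ}
    {x : VectorFields E M × SmoothFn E M} (hx : x ∈ (atiyah H).deg d) :
    HasDegree (m + 1 + j) d (atiyahSlot (U := U) a x) := by
  refine ⟨fun h => (congrArg _ (hx.1 h)).trans (resVF_zero _), fun h => ?_⟩
  obtain _ | j := j
  · exact (hasDegree_of_mem_atiyah_deg hx).negOnePow_eq fun h0 =>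
      h ((congrArg (augmentSlot a) h0).trans (map_zero _))
  · exact absurd (augmentSlot_of_ne a j.succ_ne_zero x.2) h

end AtiyahSlot

variable [FiniteDimensional ℝ E] [IsManifold (modelWithCornersSelf ℝ E) ∞ M] [T2Space M]
variable {g : CircleCochain E U (m + 1)} (𝒜 : FullConnection g)

/-- The form `A^(q+1)` on a component of `Č_j U`, and zero if `A^(q+1)` is not a form on
`Č_j U`. -/
def slotForm {j : ℕ} (a : Fin (j + 1) → Λ) (q : ℕ) : DiffForm E (inter U a) (q + 1) :=
  if h : q + j = m then 𝒜.form q j h a else 0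

theorem slotForm_of_eq {q j : ℕ} (h : q + j = m) (a : Fin (j + 1) → Λ) :
    slotForm 𝒜 a q = 𝒜.form q j h a := dif_pos h

theorem slotForm_of_ne {q j : ℕ} (h : q + j ≠ m) (a : Fin (j + 1) → Λ) :
    slotForm 𝒜 a q = 0 := dif_neg h

variable (g) in
theorem inr_augment_mem (f : SmoothFn E M) :
    ((0, Pi.single 0 (augment U f)) : VectorFields E M × CechCochains E U) ∈
      cechAtiyahModule g := by
  refine ⟨fun k hk => Pi.single_eq_of_ne (by omega) _, (map_zero _).trans (Eq.symm ?_)⟩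
  change cechDiff U m (Pi.single (M := fun k => CechFn (E := E) U k) 0 (augment U f) m) = 0
  obtain _ | m := m
  · rw [Pi.single_eq_same, cechDiff_augment]
  · rw [Pi.single_eq_of_ne m.succ_ne_zero, map_zero]

theorem inducedMap_mem :
    ∀ (k : ℕ) (x : Fin k → VectorFields E M × SmoothFn E M), 𝒜.inducedMap k x ∈ cechAtiyahModule g
  | 0, _ => Submodule.zero_mem _
  | 1, x => by
    refine Submodule.add_mem _ ⟨fun j hj => dif_neg (by omega), ?_⟩ (inr_augment_mem g (x 0).2)
    refine (𝒜.dlog_eq fun i => (x i).1).trans (congrArg (cechDiff U m) ?_)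
    simp only [zero_add, dite_true]
  | q + 2, x => by
    refine Submodule.add_mem _ ⟨fun j hj => dif_neg (by omega), ?_⟩ (Submodule.zero_mem _)
    exact (map_zero _).trans ((congrArg _ (dif_neg (by omega))).trans (map_zero _)).symm

/-- The components of the `∞`-morphism induced by a full connection. -/
def inducedComp : Operations (VectorFields E M × SmoothFn E M) (cechAtiyahModule g) :=
  fun k x => ⟨𝒜.inducedMap k x, inducedMap_mem 𝒜 k x⟩

theorem inducedForm_apply {q j : ℕ} (a : Fin (j + 1) → Λ)
    (X : Fin (q + 1) → VectorFields E M) :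
    (if h : q + j = m then (𝒜.form q j h).eval X else 0) a =
      slotForm 𝒜 a q fun i => resVF (inter U a) (X i) := by
  by_cases h : q + j = m
  · rw [dif_pos h, slotForm_of_eq 𝒜 h]
    rfl
  · rw [dif_neg h, slotForm_of_ne 𝒜 h]
    rfl

theorem cechSlot_inducedComp {j : ℕ} (a : Fin (j + 1) → Λ) :
    ∀ (k : ℕ) (x : Fin k → VectorFields E M × SmoothFn E M), cechSlot g j a (inducedComp 𝒜 k x) =
      connectionOperations (slotForm 𝒜 a) k (atiyahSlot a ∘ x)
  | 0, _ => by
    rw [connectionOperations_zero]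
    exact map_zero (cechSlot g j a)
  | 1, x => Prod.ext rfl ((congrArg (· + augmentSlot a (x 0).2)
      (inducedForm_apply 𝒜 a fun i => (x i).1)).trans (add_comm _ _))
  | q + 2, x => by
    rw [connectionOperations_succ_succ]
    exact Prod.ext ((congrArg (resVF (inter U a)) (add_zero (0 : VectorFields E M))).trans
      (resVF_zero _)) ((add_zero _).trans (inducedForm_apply 𝒜 a fun i => (x i).1))

variable (g) in
/-- The vector field underlying an element of `ČAt(g)`, as a pair, so that it is a coordinate of
the same kind as those of `cechSlot`. -/
def cechFieldSlot : cechAtiyahModule g →ₗ[ℝ] VectorFields E M × SmoothFn E M :=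
  (LinearMap.inl (SmoothFn E M) (VectorFields E M) (SmoothFn E M) ∘ₗ cechField g).restrictScalars ℝ

/-- The coordinate on `At_{n-1}(H)` corresponding to `cechFieldSlot`. -/
def atiyahFieldSlot : VectorFields E M × SmoothFn E M →+ VectorFields E M × SmoothFn E M :=
  ((LinearMap.inl (SmoothFn E M) (VectorFields E M) (SmoothFn E M)) ∘ₗ
    LinearMap.fst _ _ _).toAddMonoidHom

theorem cechFieldSlot_inducedComp :
    ∀ (k : ℕ) (x : Fin k → VectorFields E M × SmoothFn E M),
      cechFieldSlot g (inducedComp 𝒜 k x) = connectionOperations 0 k (atiyahFieldSlot ∘ x)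
  | 0, _ => by
    rw [connectionOperations_zero]
    exact map_zero (cechFieldSlot g)
  | 1, x => Prod.ext rfl (add_zero _).symm
  | q + 2, x => by
    rw [connectionOperations_succ_succ]
    exact Prod.ext (add_zero _) rfl

theorem cechSlots_ext {x y : cechAtiyahModule g} (field : cechFieldSlot g x = cechFieldSlot g y)
    (slot : ∀ k a, cechSlot g k a x = cechSlot g k a y) : x = y :=
  cechSlot_ext (Prod.ext_iff.1 field).1 slot

theorem isMultilinear_inducedComp (k : ℕ) : IsMultilinear (SmoothFn E M) (inducedComp 𝒜 k) := by
  have field := isMultilinear_connectionOperations (R := SmoothFn E M) 0 k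
  have slot {j : ℕ} (a : Fin (j + 1) → Λ) :=
    isMultilinear_connectionOperations (slotForm 𝒜 a) k
  refine ⟨.mk' (inducedComp 𝒜 k) (fun x i u v => cechSlots_ext ?_ fun j a => ?_)
    (fun x i c u => cechSlots_ext ?_ fun j a => ?_), rfl⟩
  · simp only [map_add, cechFieldSlot_inducedComp, Function.comp_update, field.map_update_add]
  · simp only [map_add, cechSlot_inducedComp, Function.comp_update, (slot a).map_update_add]
  · have smul_field (y : cechAtiyahModule g) : cechFieldSlot g (c • y) = c • cechFieldSlot g y :=
      map_smul (LinearMap.inl _ _ _ ∘ₗ cechField g) c y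
    have smul_atiyah : atiyahFieldSlot (c • u) = c • atiyahFieldSlot u :=
      map_smul (LinearMap.inl _ _ _ ∘ₗ LinearMap.fst _ _ _) c u
    simp only [smul_field, cechFieldSlot_inducedComp, Function.comp_update, smul_atiyah,
      field.map_update_smul]
  · simp only [cechSlot_smul, cechSlot_inducedComp, Function.comp_update, atiyahSlot_smul,
      (slot a).map_update_smul]

end InducedMorphism

section InducedMorphismDegree

open TopologicalSpace (Opens)

variable {E : Type*} [NormedAddCommGroup E] [NormedSpace ℝ E]
variable {M : Type*} [TopologicalSpace M] [ChartedSpace E M]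
variable {Λ : Type*} {U : Λ → Opens M} {m : ℕ} {H : DiffForm E M (m + 2)}

theorem augmentSlot_eq_zero_of_mem {x : VectorFields E M × SmoothFn E M} {d : ℤ}
    (hx : x ∈ (atiyah H).deg d) {j : ℕ} (a : Fin (j + 1) → Λ) (hj : (j : ℤ) ≠ m + d) :
    augmentSlot (U := U) a x.2 = 0 := by
  obtain _ | j := j
  · exact (congrArg (augmentSlot a) (hx.2 fun h => hj (by omega))).trans (map_zero _)
  · exact augmentSlot_of_ne a j.succ_ne_zero x.2

variable [FiniteDimensional ℝ E] [IsManifold (modelWithCornersSelf ℝ E) ∞ M] [T2Space M]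
variable {g : CircleCochain E U (m + 1)} (𝒜 : FullConnection g)

theorem slotForm_apply_eq_zero {q j : ℕ} {a : Fin (j + 1) → Λ} {d : Fin (q + 1) → ℤ}
    {X : Fin (q + 1) → VectorFields E (inter U a)} (hX : ∀ i, d i ≠ 0 → X i = 0)
    (hj : (j : ℤ) ≠ m + ((∑ i, d i) + 1 - (q + 1 : ℕ))) : slotForm 𝒜 a q X = 0 := by
  obtain rfl | hd := eq_or_ne d 0
  · simp only [Pi.zero_apply, Finset.sum_const_zero] at hj
    rw [slotForm_of_ne 𝒜 (by omega), AlternatingMap.zero_apply]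
  · obtain ⟨i, hi⟩ := Function.ne_iff.1 hd
    exact (slotForm 𝒜 a q).map_coord_zero i (hX i hi)

variable {k : ℕ} {d : Fin k → ℤ} {x : Fin k → VectorFields E M × SmoothFn E M}

theorem fst_inducedComp_eq_zero (hx : ∀ i, x i ∈ (atiyah H).deg (d i))
    (hd : (∑ i, d i) + 1 - k ≠ 0) : (cechFieldSlot g (inducedComp 𝒜 k x)).1 = 0 := by
  rw [cechFieldSlot_inducedComp]
  obtain rfl | hk := eq_or_ne k 1
  · rw [fst_connectionOperations_one]
    refine (hx 0).1 fun h => hd ?_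
    rw [Fin.sum_univ_one, h, zero_add, Nat.cast_one, sub_self]
  · exact fst_connectionOperations_of_ne_one 0 hk _

theorem snd_inducedComp_eq_zero (hx : ∀ i, x i ∈ (atiyah H).deg (d i)) {j : ℕ}
    (a : Fin (j + 1) → Λ) (hj : (j : ℤ) ≠ m + ((∑ i, d i) + 1 - k)) :
    (cechSlot g j a (inducedComp 𝒜 k x)).2 = 0 := by
  have field (i) (h : d i ≠ 0) : (atiyahSlot (U := U) a (x i)).1 = 0 :=
    (hasDegree_atiyahSlot a (hx i)).fst_eq_zero h
  rw [cechSlot_inducedComp]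
  match k with
  | 0 => rw [connectionOperations_zero]; rfl
  | 1 =>
    rw [connectionOperations_one]
    refine (congrArg₂ (· + ·) (augmentSlot_eq_zero_of_mem (hx 0) a ?_)
      (slotForm_apply_eq_zero 𝒜 field hj)).trans (add_zero _)
    rw [Fin.sum_univ_one] at hj
    omega
  | q + 2 =>
    rw [connectionOperations_succ_succ]
    exact slotForm_apply_eq_zero 𝒜 field hj

theorem inducedComp_mem (hx : ∀ i, x i ∈ (atiyah H).deg (d i)) :
    inducedComp 𝒜 k x ∈ (cechAtiyah g).deg ((∑ i, d i) + 1 - k) :=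
  ⟨fst_inducedComp_eq_zero 𝒜 hx, fun _ hj => funext fun a => snd_inducedComp_eq_zero 𝒜 hx a hj⟩

theorem inducedComp_comp_perm (hx : ∀ i, x i ∈ (atiyah H).deg (d i)) (σ : Equiv.Perm (Fin k)) :
    inducedComp 𝒜 k (x ∘ σ.symm) = koszulSign σ d • inducedComp 𝒜 k x := by
  refine cechSlots_ext ?_ fun j a => ?_
  · refine Eq.trans ?_ (map_units_smul (cechFieldSlot g) _ (inducedComp 𝒜 k x)).symm
    rw [cechFieldSlot_inducedComp, cechFieldSlot_inducedComp]
    exact connectionOperations_comp_perm (x := atiyahFieldSlot ∘ x) 0 (fun i => (hx i).1) σ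
  · refine Eq.trans ?_ (map_units_smul (cechSlot g j a) _ (inducedComp 𝒜 k x)).symm
    rw [cechSlot_inducedComp, cechSlot_inducedComp]
    exact connectionOperations_comp_perm _
      (fun i => (hasDegree_atiyahSlot a (hx i)).fst_eq_zero) σ

end InducedMorphismDegree

section InducedMorphismEquations

open TopologicalSpace (Opens)

variable {E : Type*} [NormedAddCommGroup E] [NormedSpace ℝ E] [FiniteDimensional ℝ E]
variable {M : Type*} [TopologicalSpace M] [ChartedSpace E M]
  [IsManifold (modelWithCornersSelf ℝ E) ∞ M] [T2Space M]
variable {Λ : Type*} {U : Λ → Opens M} {m : ℕ} {g : CircleCochain E U (m + 1)}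
  (𝒜 : FullConnection g) {H : DiffForm E M (m + 2)}

theorem cechSlot_inducedComp_one_of_fst_eq_zero {j : ℕ} (a : Fin (j + 1) → Λ)
    {v : VectorFields E M × SmoothFn E M} (hv : v.1 = 0) :
    cechSlot g j a (inducedComp 𝒜 1 fun _ => v) = (0, augmentSlot a v.2) := by
  have slot_fst : (atiyahSlot (U := U) a v).1 = 0 := (congrArg _ hv).trans (resVF_zero _)
  rw [cechSlot_inducedComp, connectionOperations_one,
    formBracket_eq_zero (slotForm 𝒜 a 0) (i := 0) slot_fst, add_zero]
  exact Prod.ext slot_fst rfl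

theorem inducedComp_cons_of_fst_eq_zero {t : ℕ} (ht : 0 < t)
    {v : VectorFields E M × SmoothFn E M} (hv : v.1 = 0)
    (z : Fin t → VectorFields E M × SmoothFn E M) :
    inducedComp 𝒜 (t + 1) (Fin.cons v z) = 0 := by
  obtain ⟨q, rfl⟩ := Nat.exists_eq_succ_of_ne_zero ht.ne'
  refine cechSlots_ext ?_ fun j a => ?_
  · rw [cechFieldSlot_inducedComp, connectionOperations_succ_succ, map_zero]
    rfl
  · rw [cechSlot_inducedComp, connectionOperations_succ_succ, map_zero]
    exact formBracket_eq_zero (slotForm 𝒜 a (q + 1)) (i := 0)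
      ((congrArg _ hv).trans (resVF_zero _))

theorem cechCochain_inducedComp_one_of_ne {k : ℕ} (hk : k ≠ m)
    (x : Fin 1 → VectorFields E M × SmoothFn E M) :
    cechCochain g k (inducedComp 𝒜 1 x) =
      Pi.single (M := fun k => CechFn (E := E) U k) 0 (augment U (x 0).2) k :=
  (congrArg (· + Pi.single (M := fun k => CechFn (E := E) U k) 0 (augment U (x 0).2) k)
    (dif_neg fun h => hk ((zero_add k).symm.trans h))).trans (zero_add _)

theorem cechAtiyahDiff_inducedComp_one (x : Fin 1 → VectorFields E M × SmoothFn E M) :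
    cechAtiyahDiff g (inducedComp 𝒜 1 x) = 0 := by
  refine cech_ext rfl fun
    | 0 => cechCochain_diff_zero _
    | k + 1 => ?_
  rw [cechCochain_diff_succ, map_zero]
  split_ifs with hk
  · rw [cechCochain_inducedComp_one_of_ne 𝒜 (by omega)]
    obtain _ | k := k
    · rw [Pi.single_eq_same, cechDiff_augment, smul_zero]
    · rw [Pi.single_eq_of_ne k.succ_ne_zero, map_zero, smul_zero]
  · rfl

theorem cechCochain_inducedComp_succ_succ {q k : ℕ} (h : q + 1 + k = m)
    (x : Fin (q + 2) → VectorFields E M × SmoothFn E M) :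
    cechCochain g k (inducedComp 𝒜 (q + 2) x) = (𝒜.form (q + 1) k h).eval fun i => (x i).1 :=
  (add_zero _).trans (dif_pos h)

theorem cechCochain_inducedComp_succ_succ_of_ne {q k : ℕ} (h : q + 1 + k ≠ m)
    (x : Fin (q + 2) → VectorFields E M × SmoothFn E M) :
    cechCochain g k (inducedComp 𝒜 (q + 2) x) = 0 :=
  (add_zero _).trans (dif_neg h)

theorem cechDiff_inducedComp_add_deriv (q k : ℕ) (a : Fin (k + 2) → Λ)
    (x : Fin (q + 2) → VectorFields E M × SmoothFn E M) :
    cechCochain g (k + 1) (cechAtiyahDiff g (inducedComp 𝒜 (q + 2) x)) a +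
      derivationDeriv (slotForm 𝒜 a q) (fun i => resVF (inter U a) (x i).1) = 0 := by
  rw [cechCochain_diff_succ]
  by_cases h : q + (k + 1) = m
  · rw [if_pos (by omega), cechCochain_inducedComp_succ_succ 𝒜 (by omega), slotForm_of_eq 𝒜 h]
    have sign : (-1 : ℝ) ^ (m + (k + 1)) = (-1) ^ (q + 2) := by
      rw [← h, show q + (k + 1) + (k + 1) = q + 2 * (k + 1) by ring, pow_add, pow_add, pow_mul]
      simp
    rw [sign]
    exact (add_comm _ _).trans <| congrFun (𝒜.deligne q k h fun i => (x i).1) a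
  · rw [cechCochain_inducedComp_succ_succ_of_ne 𝒜 (by omega), map_zero, smul_zero, ite_self,
      slotForm_of_ne 𝒜 h, derivationDeriv_zero]
    exact add_zero 0

variable {𝒜} in
theorem deriv_slotForm_zero (h𝒜 : 𝒜.HasCurvature H) (q : ℕ) (a : Fin 1 → Λ)
    (x : Fin (q + 2) → VectorFields E M × SmoothFn E M) :
    derivationDeriv (slotForm 𝒜 a q) (fun i => resVF (inter U a) (x i).1) =
      augmentSlot a ((Pi.single (m + 2) (formBracket H) : Operations _ _) (q + 2) x).2 := by
  obtain rfl | h := eq_or_ne q m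
  · rw [slotForm_of_eq 𝒜 (add_zero q), Pi.single_eq_same, augmentSlot_zero]
    exact congrFun (h𝒜 fun i => (x i).1) a
  · rw [slotForm_of_ne 𝒜 (by omega), derivationDeriv_zero, Pi.single_eq_of_ne (by omega)]
    exact (map_zero (augmentSlot a)).symm

variable {𝒜} in
theorem cechSlot_diff_inducedComp (h𝒜 : 𝒜.HasCurvature H) (q : ℕ) {j : ℕ} (a : Fin (j + 1) → Λ)
    (x : Fin (q + 2) → VectorFields E M × SmoothFn E M) :
    cechSlot g j a (cechAtiyahDiff g (inducedComp 𝒜 (q + 2) x)) +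
        LinearMap.inr (SmoothFn E (inter U a)) (VectorFields E (inter U a)) (SmoothFn E (inter U a))
          (derivationDeriv (slotForm 𝒜 a q) fun i => resVF (inter U a) (x i).1) =
      cechSlot g j a (inducedComp 𝒜 1 fun _ =>
        (Pi.single (m + 2) (formBracket H) : Operations _ _) (q + 2) x) := by
  rw [cechSlot_inducedComp_one_of_fst_eq_zero 𝒜 a (fst_single_formBracket H _ x)]
  refine Prod.ext ((add_zero _).trans (resVF_zero _)) ?_
  obtain _ | j := j
  · refine (congrArg (· + _) (congrFun (cechCochain_diff_zero _) a)).trans ((zero_add _).trans ?_)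
    exact deriv_slotForm_zero h𝒜 q a x
  · exact (cechDiff_inducedComp_add_deriv 𝒜 q j a x).trans
      (augmentSlot_of_ne a j.succ_ne_zero _).symm

end InducedMorphismEquations

section InducedMorphismMaurerCartan

open TopologicalSpace (Opens)

variable {E : Type*} [NormedAddCommGroup E] [NormedSpace ℝ E] [FiniteDimensional ℝ E]
variable {M : Type*} [TopologicalSpace M] [ChartedSpace E M]
  [IsManifold (modelWithCornersSelf ℝ E) ∞ M] [T2Space M]
variable {Λ : Type*} {U : Λ → Opens M} {m : ℕ} {g : CircleCochain E U (m + 1)}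
  {𝒜 : FullConnection g} {H : DiffForm E M (m + 2)}

theorem shuffleSum_atiyah_inducedComp {k : ℕ} (d : Fin (k + 1) → ℤ)
    (x : Fin (k + 1) → VectorFields E M × SmoothFn E M) :
    shuffleSum (twistedBrackets (m := m + 1) H) (inducedComp 𝒜) d x =
      shuffleSum (Pi.single 2 fun y => semidirectBracket (m + 1) (y 0) (y 1)) (inducedComp 𝒜) d x +
        inducedComp 𝒜 1 fun _ => (Pi.single (m + 2) (formBracket H) : Operations _ _) (k + 1) x :=
  (shuffleSum_add_left _ _ (isMultilinear_inducedComp 𝒜) d x).trans <| congrArg (_ + ·) <|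
    shuffleSum_of_cons_eq_zero d x k.succ_pos _ fun r y _ ht z =>
      inducedComp_cons_of_fst_eq_zero 𝒜 ht (fst_single_formBracket H r y) z

theorem cechField_half_twoBlockSum_inducedComp {q : ℕ} {d : Fin (q + 2) → ℤ}
    {x : Fin (q + 2) → VectorFields E M × SmoothFn E M} (hx : ∀ i, x i ∈ (atiyah H).deg (d i)) :
    cechFieldSlot g ((2 : ℝ)⁻¹ •
        twoBlockSum (fun y => cechBracket g (y 0) (y 1)) (inducedComp 𝒜) d x) =
      cechFieldSlot g (shuffleSum (Pi.single 2 fun y => semidirectBracket (m + 1) (y 0) (y 1))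
        (inducedComp 𝒜) d x) := by
  have map_semidirect (y : Fin 2 → VectorFields E M × SmoothFn E M) :
      atiyahFieldSlot (semidirectBracket (m + 1) (y 0) (y 1)) =
        semidirectBracket (m + 1) (atiyahFieldSlot (y 0)) (atiyahFieldSlot (y 1)) :=
    Prod.ext rfl (snd_semidirectBracket_of_snd_eq_zero rfl rfl).symm
  have map_bracket (u v : cechAtiyahModule g) : cechFieldSlot g (cechBracket g u v) =
      semidirectBracket (m + 1) (cechFieldSlot g u) (cechFieldSlot g v) :=
    Prod.ext rfl (snd_semidirectBracket_of_snd_eq_zero rfl rfl).symm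
  refine (map_half_twoBlockSum (n := m + 1) (η := 0)
    (A := fun y => semidirectBracket (m + 1) (y 0) (y 1))
    (B := fun y => cechBracket g (y 0) (y 1)) (φ := inducedComp 𝒜) (cechFieldSlot g)
    atiyahFieldSlot map_semidirect map_bracket (cechFieldSlot_inducedComp 𝒜)
    (fun i => ⟨(hx i).1, fun h => absurd rfl h⟩) fun h => absurd rfl h).trans ?_
  rw [Pi.zero_apply, derivationDeriv_zero, map_zero, add_zero]

theorem cechSlot_half_twoBlockSum_inducedComp {q j : ℕ} (a : Fin (j + 1) → Λ)
    {d : Fin (q + 2) → ℤ} {x : Fin (q + 2) → VectorFields E M × SmoothFn E M}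
    (hx : ∀ i, x i ∈ (atiyah H).deg (d i)) :
    cechSlot g j a ((2 : ℝ)⁻¹ •
        twoBlockSum (fun y => cechBracket g (y 0) (y 1)) (inducedComp 𝒜) d x) =
      cechSlot g j a (shuffleSum (Pi.single 2 fun y => semidirectBracket (m + 1) (y 0) (y 1))
        (inducedComp 𝒜) d x) +
        LinearMap.inr (SmoothFn E (inter U a)) (VectorFields E (inter U a)) (SmoothFn E (inter U a))
          (derivationDeriv (slotForm 𝒜 a q) fun i => resVF (inter U a) (x i).1) := by
  have map_bracket (u v : cechAtiyahModule g) : cechSlot g j a (cechBracket g u v) =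
      semidirectBracket (m + 1 + j) (cechSlot g j a u) (cechSlot g j a v) :=
    cechSlot_bracket j a u v
  refine map_half_twoBlockSum (A := fun y => semidirectBracket (m + 1) (y 0) (y 1))
    (B := fun y => cechBracket g (y 0) (y 1)) (φ := inducedComp 𝒜) (cechSlot g j a) (atiyahSlot a)
    (fun y => atiyahSlot_semidirectBracket a (y 0) (y 1)) map_bracket
    (cechSlot_inducedComp 𝒜 a) (fun i => hasDegree_atiyahSlot a (hx i)) fun h => ?_
  have hq : q + j = m := by_contra fun hq => h (slotForm_of_ne 𝒜 hq a)
  rw [← hq, show q + j + 1 + j = q + 1 + 2 * j by ring, pow_add, pow_mul, neg_one_sq, one_pow,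
    mul_one]

theorem inducedComp_maurerCartan (h𝒜 : 𝒜.HasCurvature H) :
    ∀ {k : ℕ} {d : Fin k → ℤ} {x : Fin k → VectorFields E M × SmoothFn E M},
      (∀ i, x i ∈ (atiyah H).deg (d i)) →
      blockSum (dgLieBrackets (V := cechAtiyahModule g)
        ((cechDifferential g).restrictScalars ℝ) (cechBracket g)) (inducedComp 𝒜) d x =
      shuffleSum (twistedBrackets (m := m + 1) H) (inducedComp 𝒜) d x
  | 0, d, x, _ => by
    refine (blockSum_zero _ _ _ _).trans (Finset.sum_eq_zero fun S hS => ?_).symm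
    exact (Finset.mem_filter.1 hS).2.elim fun i _ => i.elim0
  | 1, d, x, _ => by
    refine (blockSum_succ _ _ _ d x).trans (Eq.trans ?_ (shuffleSum_atiyah_inducedComp d x).symm)
    have curvature : (Pi.single (m + 2) (formBracket H) : Operations _ _) 1 x = 0 :=
      congrFun (Pi.single_eq_of_ne (M := fun r => (Fin r → VectorFields E M × SmoothFn E M) →
        VectorFields E M × SmoothFn E M) (by omega : 1 ≠ m + 2) (formBracket H)) x
    rw [twoBlockSum_one, smul_zero, add_zero,
      shuffleSum_single_of_lt _ (isMultilinear_inducedComp 𝒜) one_lt_two]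
    exact (cechAtiyahDiff_inducedComp_one 𝒜 x).trans
      ((zero_add _).trans ((isMultilinear_inducedComp 𝒜 1).map_coord_zero 0 curvature)).symm
  | q + 2, d, x, hx => by
    refine (blockSum_succ _ _ _ d x).trans (Eq.trans ?_ (shuffleSum_atiyah_inducedComp d x).symm)
    refine cechSlots_ext ?_ fun j a => ?_
    · have diff : cechFieldSlot g (cechAtiyahDiff g (inducedComp 𝒜 (q + 2) x)) = 0 :=
        Prod.ext rfl rfl
      have curvature : cechFieldSlot g (inducedComp 𝒜 1 fun _ =>
          (Pi.single (m + 2) (formBracket H) : Operations _ _) (q + 2) x) = 0 :=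
        Prod.ext ((add_zero _).trans (fst_single_formBracket H _ x)) rfl
      refine (map_add (cechFieldSlot g) _ _).trans
        (Eq.trans ?_ (map_add (cechFieldSlot g) _ _).symm)
      rw [cechField_half_twoBlockSum_inducedComp hx, curvature, add_zero]
      exact (congrArg (· + _) diff).trans (zero_add _)
    · rw [map_add, map_add, cechSlot_half_twoBlockSum_inducedComp a hx,
        ← cechSlot_diff_inducedComp h𝒜]
      exact add_left_comm _ _ _

end InducedMorphismMaurerCartan

section QuasiIsomorphism

open TopologicalSpace (Opens)

variable {E : Type*} [NormedAddCommGroup E] [NormedSpace ℝ E]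
variable {M : Type*} [TopologicalSpace M] [ChartedSpace E M]
variable {m : ℕ} {H : DiffForm E M (m + 2)}

variable (H) in
theorem atiyah_diff (x : VectorFields E M × SmoothFn E M) :
    (atiyah H).diff x = (0 : VectorFields E M × SmoothFn E M) := by
  have h : 1 ≠ m + 2 := by omega
  refine (congrFun₂ (atiyah_bracket H) 1 _).trans ?_
  exact (congrArg₂ (· + ·)
    (congrFun (Pi.single_eq_of_ne (M := fun r => (Fin r → VectorFields E M × SmoothFn E M) →
      VectorFields E M × SmoothFn E M) (by decide : 1 ≠ 2) _) _)
    (congrFun (Pi.single_eq_of_ne (M := fun r => (Fin r → VectorFields E M × SmoothFn E M) →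
      VectorFields E M × SmoothFn E M) h _) _)).trans (add_zero _)

variable [FiniteDimensional ℝ E] [IsManifold (modelWithCornersSelf ℝ E) ∞ M] [T2Space M]
variable {Λ : Type*} {U : Λ → Opens M} {g : CircleCochain E U (m + 1)}

theorem cech_ext_of_mem {i : ℤ} {x y : cechAtiyahModule g} (hx : x ∈ (cechAtiyah g).deg i)
    (hy : y ∈ (cechAtiyah g).deg i) (field : cechField g x = cechField g y)
    (cochain : ∀ k : ℕ, (k : ℤ) = m + i → cechCochain g k x = cechCochain g k y) : x = y :=
  cech_ext field fun k => by
    by_cases hk : (k : ℤ) = m + i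
    · exact cochain k hk
    · exact (hx.2 k hk).trans (hy.2 k hk).symm

variable (g) in
/-- The element of `ČAt(g)` of negative degree given by a Čech cochain. -/
def cechOfCochain {p : ℕ} (hp : p < m) (b : CechFn (E := E) U p) : cechAtiyahModule g :=
  ⟨(0, Pi.single p b), fun k hk => Pi.single_eq_of_ne (by omega) b, by
    change _ = cechDiff U m (Pi.single (M := fun k => CechFn (E := E) U k) p b m)
    rw [Pi.single_eq_of_ne hp.ne', map_zero, map_zero]⟩

theorem cechOfCochain_mem {p : ℕ} (hp : p < m) (b : CechFn (E := E) U p) :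
    cechOfCochain g hp b ∈ (cechAtiyah g).deg (p - m) :=
  ⟨fun _ => rfl, fun _ hk => Pi.single_eq_of_ne (by omega) b⟩

theorem cechCochain_diff_cechOfCochain {p : ℕ} (hp : p < m) (b : CechFn (E := E) U p) :
    cechCochain g (p + 1) (cechAtiyahDiff g (cechOfCochain g hp b)) =
      (-1 : ℝ) ^ (m + (p + 1)) • cechDiff U p b := by
  have single : cechCochain g p (cechOfCochain g hp b) = b := Pi.single_eq_same p b
  rw [cechCochain_diff_succ, if_pos (Nat.succ_le_of_lt hp), single]

theorem cechDiff_eq_zero_of_closed {v : cechAtiyahModule g} (field : cechField g v = 0)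
    (hv : cechAtiyahDiff g v = 0) (k : ℕ) : cechDiff U k (cechCochain g k v) = 0 := by
  obtain hk | rfl | hk := lt_trichotomy k m
  · have := (cechCochain_diff_succ k v).symm.trans (congrArg (cechCochain g (k + 1)) hv)
    rw [if_pos (Nat.succ_le_of_lt hk), map_zero] at this
    exact (smul_eq_zero_iff_right (pow_ne_zero _ (neg_ne_zero.2 one_ne_zero))).1 this
  · exact v.2.2.symm.trans ((congrArg (cechDlog g) field).trans (map_zero _))
  · exact (congrArg (cechDiff U k) (v.2.1 k hk)).trans (map_zero _)

theorem exists_diff_eq_of_closed [SigmaCompactSpace M] (hU : ∀ x : M, ∃ a, x ∈ U a) {i : ℤ}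
    (hi : i ≠ -m) {v : cechAtiyahModule g} (hvi : v ∈ (cechAtiyah g).deg i)
    (field : cechField g v = 0) (hv : cechAtiyahDiff g v = 0) :
    ∃ w ∈ (cechAtiyah g).deg (i - 1), cechAtiyahDiff g w = v := by
  by_cases h : ∃ p : ℕ, (p : ℤ) + 1 = m + i ∧ p < m
  · obtain ⟨p, hpi, hpm⟩ := h
    obtain ⟨b, hb⟩ := cechDiff_exact hU (cechDiff_eq_zero_of_closed field hv (p + 1))
    let w := cechOfCochain g hpm ((-1 : ℝ) ^ (m + (p + 1)) • b)
    have hw : w ∈ (cechAtiyah g).deg (i - 1) := by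
      rw [show i - 1 = p - m by omega]
      exact cechOfCochain_mem hpm _
    refine ⟨w, hw, cech_ext_of_mem (sub_add_cancel i 1 ▸ cechAtiyahDiff_mem hw) hvi field.symm
      fun k hk => ?_⟩
    obtain rfl : k = p + 1 := by omega
    rw [cechCochain_diff_cechOfCochain, LinearMap.map_smul_of_tower, hb, smul_smul, ← mul_pow,
      neg_mul_neg, one_mul, one_pow, one_smul]
  · refine ⟨0, Submodule.zero_mem _, ?_⟩
    refine ((cechDifferential g).map_zero).trans
      (cech_ext_of_mem hvi (Submodule.zero_mem _) field fun k hk => v.2.1 k ?_).symm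
    by_contra hkm
    exact h ⟨k - 1, by omega, by omega⟩

variable (𝒜 : FullConnection g)

theorem cechField_inducedComp_one (x : VectorFields E M × SmoothFn E M) :
    cechField g (inducedComp 𝒜 1 fun _ => x) = x.1 :=
  add_zero _

theorem cechCochain_inducedComp_one_of_fst_eq_zero (f : SmoothFn E M) (k : ℕ) :
    cechCochain g k (inducedComp 𝒜 1 fun _ => (0, f)) =
      Pi.single (M := fun k => CechFn (E := E) U k) 0 (augment U f) k :=
  funext fun a => congrArg Prod.snd (cechSlot_inducedComp_one_of_fst_eq_zero 𝒜 a rfl)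

theorem exists_inducedComp_eq_of_closed [SigmaCompactSpace M] (hU : ∀ x : M, ∃ a, x ∈ U a)
    {v : cechAtiyahModule g} (hvm : v ∈ (cechAtiyah g).deg (-m)) (field : cechField g v = 0)
    (hv : cechAtiyahDiff g v = 0) :
    ∃ f : SmoothFn E M, inducedComp 𝒜 1 (fun _ => (0, f)) = v := by
  obtain ⟨f, hf⟩ := exists_augment_eq hU (cechDiff_eq_zero_of_closed field hv 0)
  refine ⟨f, cech_ext ((cechField_inducedComp_one 𝒜 (0, f)).trans field.symm) fun k => ?_⟩
  rw [cechCochain_inducedComp_one_of_fst_eq_zero]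
  obtain rfl | hk := eq_or_ne k 0
  · rw [Pi.single_eq_same, hf]
  · rw [Pi.single_eq_of_ne hk]
    exact (hvm.2 k (by omega)).symm

theorem inducedComp_one_add (x y : VectorFields E M × SmoothFn E M) :
    inducedComp 𝒜 1 (fun _ => x + y) =
      inducedComp 𝒜 1 (fun _ => x) + inducedComp 𝒜 1 fun _ => y := by
  have := (isMultilinear_inducedComp 𝒜 1).map_update_add (fun _ => 0) 0 x y
  simp only [Function.update_eq_const_of_subsingleton] at this
  exact this

theorem exists_eq_inducedComp_add_diff [SigmaCompactSpace M] (hU : ∀ x : M, ∃ a, x ∈ U a) {i : ℤ}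
    {z : cechAtiyahModule g} (hz : z ∈ (cechAtiyah g).deg i) (hz₀ : cechAtiyahDiff g z = 0) :
    ∃ x ∈ (atiyah H).deg i, ∃ w ∈ (cechAtiyah g).deg (i - 1),
      z = inducedComp 𝒜 1 (fun _ => x) + cechAtiyahDiff g w := by
  let X : VectorFields E M × SmoothFn E M := (cechField g z, 0)
  let y : cechAtiyahModule g := inducedComp 𝒜 1 fun _ => X
  have hX : X ∈ (atiyah H).deg i := ⟨hz.1, fun _ => rfl⟩
  have hy : y ∈ (cechAtiyah g).deg i := by
    have := inducedComp_mem 𝒜 (d := fun _ : Fin 1 => i) fun _ => hX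
    rwa [Fin.sum_univ_one, Nat.cast_one, add_sub_cancel_right] at this
  have hzy : z - y ∈ (cechAtiyah g).deg i := Submodule.sub_mem _ hz hy
  have field : cechField g (z - y) = 0 :=
    ((cechField g).map_sub z y).trans (sub_eq_zero.2 (cechField_inducedComp_one 𝒜 X).symm)
  have closed : cechAtiyahDiff g (z - y) = 0 :=
    (map_sub (cechDifferential g) z y).trans
      (sub_eq_zero.2 (hz₀.trans (cechAtiyahDiff_inducedComp_one 𝒜 _).symm))
  obtain rfl | hi := eq_or_ne i (-m)
  · obtain ⟨f, hf⟩ := exists_inducedComp_eq_of_closed 𝒜 hU hzy field closed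
    have linear : inducedComp 𝒜 1 (fun _ => X + (0, f)) = y + (z - y) :=
      (inducedComp_one_add 𝒜 X (0, f)).trans (congrArg (y + ·) hf)
    exact ⟨X + (0, f), Submodule.add_mem _ hX ⟨fun _ => rfl, fun h => absurd rfl h⟩, 0,
      Submodule.zero_mem _, ((congrArg₂ (· + ·) linear (map_zero (cechDifferential g))).trans
        ((add_zero _).trans (add_sub_cancel y z))).symm⟩
  · obtain ⟨w, hw, hwz⟩ := exists_diff_eq_of_closed hU hi hzy field closed
    exact ⟨X, hX, w, hw, ((congrArg (y + ·) hwz).trans (add_sub_cancel y z)).symm⟩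

theorem eq_zero_of_inducedComp_eq_diff (hU : ∀ x : M, ∃ a, x ∈ U a)
    {x : VectorFields E M × SmoothFn E M} {w : cechAtiyahModule g}
    (h : inducedComp 𝒜 1 (fun _ => x) = cechAtiyahDiff g w) : x = 0 := by
  obtain ⟨X, f⟩ := x
  obtain rfl : X = 0 := (cechField_inducedComp_one 𝒜 (X, f)).symm.trans (congrArg (cechField g) h)
  refine Prod.ext rfl (augment_injective hU ?_)
  have cochain := cechCochain_inducedComp_one_of_fst_eq_zero 𝒜 f 0
  rw [Pi.single_eq_same, h, cechCochain_diff_zero] at cochain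
  exact cochain.symm

variable (h𝒜 : 𝒜.HasCurvature H)

/-- The `∞`-morphism `Φ_{g,𝒜}` from `At_{n-1}(H)` to `ČAt(g)`. -/
def inducedMorphism : InfinityMorphism (atiyah H) (cechAtiyah g) where
  comp := inducedComp 𝒜
  comp_zero _ := rfl
  multilinear := isMultilinear_inducedComp 𝒜
  comp_mem _ _ _ hx := inducedComp_mem 𝒜 hx
  symmetric _ _ _ hx σ := inducedComp_comp_perm 𝒜 hx σ
  maurerCartan k d x hx := by
    refine (congrArg (fun B => blockSum (V := VectorFields E M × SmoothFn E M)
      (W := cechAtiyahModule g) B (inducedComp 𝒜) d x) cechAtiyah_bracket).trans ?_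
    refine (inducedComp_maurerCartan h𝒜 hx).trans ?_
    exact congrArg (fun B => shuffleSum (V := VectorFields E M × SmoothFn E M)
      (W := cechAtiyahModule g) B (inducedComp 𝒜) d x) (atiyah_bracket H).symm
  anchor_one x := add_zero _
  anchor_higher k hk x := (congrArg Prod.fst (cechFieldSlot_inducedComp 𝒜 k x)).trans
    (fst_connectionOperations_of_ne_one 0 (by omega) _)

theorem inducedMorphism_isQuasiIso [SigmaCompactSpace M] (hU : ∀ x : M, ∃ a, x ∈ U a) :
    (inducedMorphism 𝒜 h𝒜).IsQuasiIso where
  injective _ _ _ _ := fun ⟨_, _, hw⟩ => ⟨0, Submodule.zero_mem _,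
    (eq_zero_of_inducedComp_eq_diff 𝒜 hU hw).trans (atiyah_diff H 0).symm⟩
  surjective _ _ hz hz₀ := by
    obtain ⟨x, hx, w, hw, h⟩ := exists_eq_inducedComp_add_diff 𝒜 hU hz hz₀
    exact ⟨x, hx, atiyah_diff H x, w, hw, h⟩

end QuasiIsomorphism

end CechAtiyah

end

theorem theorem5p8_general
    {E : Type*} [NormedAddCommGroup E] [NormedSpace ℝ E] [FiniteDimensional ℝ E]
    {M : Type*} [TopologicalSpace M] [ChartedSpace E M]
    [IsManifold (modelWithCornersSelf ℝ E) ∞ M] [T2Space M] [SigmaCompactSpace M]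
    {Λ : Type*} (U : Λ → TopologicalSpace.Opens M) (hU : ∀ x : M, ∃ a, x ∈ U a)
    (m : ℕ) (g : CechAtiyah.CircleCochain E U (m + 1))
    (H : CechAtiyah.DiffForm E M (m + 2)) (hH : ∀ X, CechAtiyah.exteriorDeriv H X = 0)
    (𝒜 : CechAtiyah.FullConnection g) (h𝒜 : 𝒜.HasCurvature H) :
    (CechAtiyah.atiyah H).IsLInftyAlgebroid ∧
    (CechAtiyah.cechAtiyah g).IsLInftyAlgebroid ∧
    ∃ Φ : CechAtiyah.InfinityMorphism (CechAtiyah.atiyah H) (CechAtiyah.cechAtiyah g),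
      (∀ (k : ℕ) (x : Fin k → CechAtiyah.VectorFields E M × CechAtiyah.SmoothFn E M),
        (Φ.comp k x).1 = 𝒜.inducedMap k x) ∧
      Φ.IsQuasiIso :=
  ⟨CechAtiyah.atiyah_isLInftyAlgebroid H hH, CechAtiyah.cechAtiyah_isLInftyAlgebroid g,
    CechAtiyah.inducedMorphism 𝒜 h𝒜, fun _ _ => rfl,
    CechAtiyah.inducedMorphism_isQuasiIso 𝒜 h𝒜 hU⟩

theorem theorem5p8
    {E : Type*} [NormedAddCommGroup E] [NormedSpace ℝ E] [FiniteDimensional ℝ E]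
    {M : Type*} [TopologicalSpace M] [ChartedSpace E M]
    [IsManifold (modelWithCornersSelf ℝ E) ∞ M] [T2Space M] [SigmaCompactSpace M]
    {Λ : Type*} (U : Λ → TopologicalSpace.Opens M) (hU : ∀ x : M, ∃ a, x ∈ U a)
    (m : ℕ) (g : CechAtiyah.CircleCochain E U (m + 1)) (hg : CechAtiyah.IsCocycle g)
    (H : CechAtiyah.DiffForm E M (m + 2)) (hH : ∀ X, CechAtiyah.exteriorDeriv H X = 0)
    (𝒜 : CechAtiyah.FullConnection g) (h𝒜 : 𝒜.HasCurvature H) :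
    (CechAtiyah.atiyah H).IsLInftyAlgebroid ∧
    (CechAtiyah.cechAtiyah g).IsLInftyAlgebroid ∧
    ∃ Φ : CechAtiyah.InfinityMorphism (CechAtiyah.atiyah H) (CechAtiyah.cechAtiyah g),
      (∀ (k : ℕ) (x : Fin k → CechAtiyah.VectorFields E M × CechAtiyah.SmoothFn E M),
        (Φ.comp k x).1 = 𝒜.inducedMap k x) ∧
      Φ.IsQuasiIso :=
  theorem5p8_general U hU m g H hH 𝒜 h𝒜
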